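/- **Setting.** Let $\mathcal A\in\{0,1\}^{n\times n}$ be the structure of a system matrix; its social digraph has the states $x_1,\dots,x_n$ as nodes and a link $x_j\to x_i$ whenever $\mathcal A_{ij}=1$. For $\mathcal H\in\{0,1\}^{N\times n}$, where $\mathcal H_{ij}=1$ means that agent $i$ measures state $x_j$, the pair $(\mathcal A,\mathcal H)$ is *structurally observable* if some pair of real matrices $(A,H)$ with exactly this zero/nonzero structure is observable. An SCC is a maximal set of mutually reachable states; a *parent SCC* is an SCC without outgoing links to other states. The digraph is *matched* if it contains a family of disjoint cycles (self-links allowed) spanning all states. In the bipartite graph with an edge between $x_j\in V^+$ and $x_i\in V^-$ for each link $x_j\to x_i$, let $\mathcal M$ be a maximum matching. For each node of $V^+$ left unmatched by $\mathcal M$, its *contraction* is the set of all nodes of $V^+$ (itself included) that can be reached from it along paths alternating between edges outside $\mathcal M$ (from $V^+$ to $V^-$) and edges of $\mathcal M$ (from $V^-$ to $V^+$). Given real costs $c_{ij}$ ($1\le i\le N$, $1\le j\le n$), the *sensing cost optimization problem* is to minimize $\sum_{i=1}^N\sum_{j=1}^n c_{ij}\mathcal H_{ij}$ over all $\mathcal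 H\in\{0,1\}^{N\times n}$ such that $(\mathcal A,\mathcal H)$ is structurally observable and every agent measures exactly one state, $\sum_j\mathcal H_{ij}=1$ for all $i$. **Theorem.** Assume that one of the following holds. (i) The social digraph is matched; $T_1,\dots,T_N$ are its parent SCCs, $N$ being their number. (ii) All the parent SCCs and contractions (with respect to some maximum matching $\mathcal M$, one contraction for each unmatched node) are pairwise disjoint; $T_1,\dots,T_N$ are these parent SCCs and contractions, $N$ being their total number. Put $\bar c_{ij}=\min\{c_{il}: x_l\in T_j\}$ and consider the linear sum assignment problem (LSAP) of minimizing $\sum_{i,j=1}^N\bar c_{ij}\mathcal Z_{ij}$ over $\mathcal Z\in\{0,1\}^{N\times N}$ with $\sum_j\mathcal Z_{ij}=1$ for all $i$ and $\sum_i\mathcal Z_{ij}=1$ for all $j$. Then: 1. Every feasible $\mathcal H$ satisfies $\sum_i\mathcal H_{ij}\le1$ for all $j$, so that adding these constraints does not change the sensing problem. 2. $\mathcal H$ is an optimal solution of the sensing problem if and only if there is an optimal solution $\mathcal Z$ of the LSAP such that every agent $i$ measures exactly one state, namely a state of minimum cost $c_{il}$ in the set $T_j$ with $\mathcal Z_{ij}=1$.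 The LSAP has an optimal solution, each of its optimal solutions arises in this way from some $\mathcal H$, and both problems have the same optimal value. 3. On a random access machine with unit-cost addition, subtraction and comparison of natural and of real numbers, the LSAP with an arbitrary real $N\times N$ cost matrix is solved in $O(N^3)$ steps, for all $N$, by one program (as the Hungarian method does). On the same machine one program computes, from $n$, $N$, $\mathcal A$ and $c$, an optimal solution of the sensing problem in a number of steps bounded by a polynomial in $n+N$, for all inputs that satisfy (i) or (ii). -/

import Mathlib

noncomputable section

namespace SensingCost

/-! ### Structured systems and structural observability -/

/-- The 0-1 structure of a matrix. -/
abbrev Pattern (r s : ℕ) := Matrix (Fin r) (Fin s) Bool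

/-- A real matrix has the given zero/nonzero structure. -/
def HasPattern {r s : ℕ} (X : Matrix (Fin r) (Fin s) ℝ) (S : Pattern r s) : Prop :=
  ∀ i j, X i j ≠ 0 ↔ S i j = true

/-- Kalman observability of the numerical pair `(A, H)`: an initial state whose outputs
`H x, H A x, …, H A ^ (n - 1) x` all vanish is zero, i.e. the observability matrix has
rank `n`. -/
def Observable {n N : ℕ} (A : Matrix (Fin n) (Fin n) ℝ) (H : Matrix (Fin N) (Fin n) ℝ) : Prop :=
  ∀ x : Fin n → ℝ, (∀ k < n, (H * A ^ k).mulVec x = 0) → x = 0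

/-- Structural observability of the structured pair `(A, H)`: some numerical pair with exactly
this zero/nonzero structure is observable. -/
def StructurallyObservable {n N : ℕ} (A : Pattern n n) (H : Pattern N n) : Prop :=
  ∃ (A' : Matrix (Fin n) (Fin n) ℝ) (H' : Matrix (Fin N) (Fin n) ℝ),
    HasPattern A' A ∧ HasPattern H' H ∧ Observable A' H'

/-! ### The social digraph: edges, parent SCCs, matchings, contractions -/

/-- The social digraph has a link `x_j → x_i` exactly when the entry `a_ij` is nonzero;
`Edge A j i` says that there is a link from `x_j` to `x_i`. -/
def Edge {n : ℕ} (A : Pattern n n) (j i : Fin n) : Prop := A i j = true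

/-- There is a directed path (possibly of length zero) in the social digraph. -/
def Reach {n : ℕ} (A : Pattern n n) : Fin n → Fin n → Prop := Relation.ReflTransGen (Edge A)

/-- A strongly connected component: a maximal set of mutually reachable states. -/
def IsSCC {n : ℕ} (A : Pattern n n) (S : Finset (Fin n)) : Prop :=
  ∃ v, ∀ u, u ∈ S ↔ Reach A v u ∧ Reach A u v

/-- A parent SCC: an SCC without outgoing links to states outside of it. -/
def IsParentSCC {n : ℕ} (A : Pattern n n) (S : Finset (Fin n)) : Prop :=
  IsSCC A S ∧ ∀ u ∈ S, ∀ w, Edge A u w → w ∈ S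

/-- The type of all parent SCCs of the social digraph. -/
abbrev ParentSCC {n : ℕ} (A : Pattern n n) := {S : Finset (Fin n) // IsParentSCC A S}

theorem ParentSCC.nonempty {n : ℕ} {A : Pattern n n} (S : ParentSCC A) : S.1.Nonempty := by
  obtain ⟨v, hv⟩ := S.2.1
  exact ⟨v, (hv v).2 ⟨Relation.ReflTransGen.refl, Relation.ReflTransGen.refl⟩⟩

/-- The social digraph is matched: it contains a disjoint family of cycles spanning all states
(the cycles of the permutation `σ`, a fixed point of `σ` being a self-link). -/
def IsMatched {n : ℕ} (A : Pattern n n) : Prop :=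
  ∃ σ : Equiv.Perm (Fin n), ∀ j, Edge A j (σ j)

/-- A matching of the bipartite graph of the social digraph. The pair `(i, j)` stands for the
bipartite edge that joins `x_j` in `V⁺` to `x_i` in `V⁻`, which exists when `x_j → x_i` is a
link; no two edges of a matching share an end node. -/
def IsMatching {n : ℕ} (A : Pattern n n) (M : Finset (Fin n × Fin n)) : Prop :=
  (∀ p ∈ M, Edge A p.2 p.1) ∧
    ∀ p ∈ M, ∀ q ∈ M, (p.1 = q.1 ∨ p.2 = q.2) → p = q

/-- A matching of maximum size. -/
def IsMaximumMatching {n : ℕ} (A : Pattern n n) (M : Finset (Fin n × Fin n)) : Prop :=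
  IsMatching A M ∧ ∀ M', IsMatching A M' → M'.card ≤ M.card

/-- The unmatched nodes: nodes of `V⁺` that are not incident to `M`. -/
abbrev Unmatched {n : ℕ} (M : Finset (Fin n × Fin n)) := {v : Fin n // ∀ p ∈ M, p.2 ≠ v}

/-- Two consecutive steps in the auxiliary graph: an edge outside `M` from `j` in `V⁺` to some
`i` in `V⁻`, then a (reversed) edge of `M` from `i` to `k` in `V⁺`. -/
def AltStep {n : ℕ} (A : Pattern n n) (M : Finset (Fin n × Fin n)) (j k : Fin n) : Prop :=
  ∃ i, Edge A j i ∧ (i, j) ∉ M ∧ (i, k) ∈ M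

open Classical in
/-- The contraction of an unmatched node: all nodes of `V⁺` that are reachable from it by
`M`-alternating paths. -/
def contraction {n : ℕ} (A : Pattern n n) (M : Finset (Fin n × Fin n)) (v : Fin n) :
    Finset (Fin n) :=
  Finset.univ.filter fun k => Relation.ReflTransGen (AltStep A M) v k

theorem contraction_nonempty {n : ℕ} (A : Pattern n n) (M : Finset (Fin n × Fin n))
    (v : Fin n) : (contraction A M v).Nonempty := by
  exact ⟨v, by simpa [contraction] using Relation.ReflTransGen.refl⟩

/-- The family that consists of all parent SCCs and all contractions. -/
def component {n : ℕ} (A : Pattern n n) (M : Finset (Fin n × Fin n)) :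
    ParentSCC A ⊕ Unmatched M → Finset (Fin n)
  | Sum.inl S => S.1
  | Sum.inr v => contraction A M v.1

theorem component_nonempty {n : ℕ} (A : Pattern n n) (M : Finset (Fin n × Fin n))
    (t : ParentSCC A ⊕ Unmatched M) : (component A M t).Nonempty := by
  cases t with
  | inl S => exact S.nonempty
  | inr v => exact contraction_nonempty A M v.1

/-! ### The two optimization problems -/

/-- The total cost `∑ i, ∑ j, c_ij X_ij`. -/
def totalCost {r s : ℕ} (c : Matrix (Fin r) (Fin s) ℝ) (X : Pattern r s) : ℝ :=
  ∑ i, ∑ j, c i j * ((X i j).toNat : ℝ)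

/-- Feasible measurement structures: every agent measures exactly one state, and the system is
structurally observable. -/
def SensingFeasible {n N : ℕ} (A : Pattern n n) (H : Pattern N n) : Prop :=
  StructurallyObservable A H ∧ ∀ i, ∑ j, (H i j).toNat = 1

/-- An optimal solution of the sensing cost optimization problem. -/
def SensingOptimal {n N : ℕ} (A : Pattern n n) (c : Matrix (Fin N) (Fin n) ℝ)
    (H : Pattern N n) : Prop :=
  SensingFeasible A H ∧ ∀ H', SensingFeasible A H' → totalCost c H ≤ totalCost c H'

/-- Feasible assignments of the linear sum assignment problem. -/
def LSAPFeasible {N : ℕ} (Z : Pattern N N) : Prop :=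
  (∀ i, ∑ j, (Z i j).toNat = 1) ∧ ∀ j, ∑ i, (Z i j).toNat = 1

/-- An optimal solution of the linear sum assignment problem with cost matrix `d`. -/
def LSAPOptimal {N : ℕ} (d : Matrix (Fin N) (Fin N) ℝ) (Z : Pattern N N) : Prop :=
  LSAPFeasible Z ∧ ∀ Z', LSAPFeasible Z' → totalCost d Z ≤ totalCost d Z'

/-- The reduced cost `min {c_il : x_l ∈ T_j}` of assigning agent `i` to the component `T_j`. -/
def reducedCost {n N : ℕ} (c : Matrix (Fin N) (Fin n) ℝ) (T : Fin N → Finset (Fin n))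
    (hT : ∀ j, (T j).Nonempty) : Matrix (Fin N) (Fin N) ℝ :=
  fun i j => (T j).inf' (hT j) (c i)

/-- `H` lets every agent `i` measure exactly one state, a state of minimum cost for `i` in the
component `T_j` to which `Z` assigns `i`. -/
def Realizes {n N : ℕ} (c : Matrix (Fin N) (Fin n) ℝ) (T : Fin N → Finset (Fin n))
    (Z : Pattern N N) (H : Pattern N n) : Prop :=
  ∀ i, ∃ j, Z i j = true ∧ ∃ l ∈ T j, (∀ l' ∈ T j, c i l ≤ c i l') ∧
    ∀ l', H i l' = true ↔ l' = l

/-- Sensing cost optimization for `(A, c)` reduces to the linear sum assignment problem of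
assigning the agents to the components `T_1, …, T_N`. -/
structure ReducesToLSAP {n N : ℕ} (A : Pattern n n) (c : Matrix (Fin N) (Fin n) ℝ)
    (T : Fin N → Finset (Fin n)) (hT : ∀ j, (T j).Nonempty) : Prop where
  /-- The constraint that every state is measured by at most one agent is redundant. -/
  column_le_one : ∀ H : Pattern N n, SensingFeasible A H → ∀ l, ∑ i, (H i l).toNat ≤ 1
  /-- The optimal measurement structures are exactly the realizations of optimal assignments. -/
  optimal_iff : ∀ H : Pattern N n, SensingOptimal A c H ↔
    ∃ Z, LSAPOptimal (reducedCost c T hT) Z ∧ Realizes c T Z H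
  /-- Every optimal assignment is realized by some measurement structure. -/
  realizable : ∀ Z, LSAPOptimal (reducedCost c T hT) Z → ∃ H, Realizes c T Z H
  /-- An optimal assignment, hence an optimal measurement structure, exists. -/
  exists_optimal : ∃ Z, LSAPOptimal (reducedCost c T hT) Z
  /-- The two problems have the same optimal value. -/
  value_eq : ∀ H Z, SensingOptimal A c H → LSAPOptimal (reducedCost c T hT) Z →
    totalCost c H = totalCost (reducedCost c T hT) Z

/-! ### A unit-cost random access machine, programmed in a structured language

The memory holds two-dimensional arrays of natural numbers and of real numbers, indexed by
natural numbers. Every elementary operation (reading or writing a cell, addition, subtraction,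
comparison, Boolean connective, test of a branch or a loop) takes one step. There is no
multiplication, and zero is the only real constant. -/

/-- The memory: `nat a i j` is cell `(i, j)` of the `a`-th array of natural numbers, and
`real a i j` is cell `(i, j)` of the `a`-th array of real numbers. -/
structure Mem where
  nat : ℕ → ℕ → ℕ → ℕ
  real : ℕ → ℕ → ℕ → ℝ

/-- Overwrite one cell of an array of natural numbers. -/
def Mem.setNat (m : Mem) (a i j x : ℕ) : Mem :=
  { m with nat := fun a' i' j' => if a' = a ∧ i' = i ∧ j' = j then x else m.nat a' i' j' }

/-- Overwrite one cell of an array of real numbers. -/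
def Mem.setReal (m : Mem) (a i j : ℕ) (x : ℝ) : Mem :=
  { m with real := fun a' i' j' => if a' = a ∧ i' = i ∧ j' = j then x else m.real a' i' j' }

/-- Expressions with a natural number as value (subtraction is truncated). -/
inductive NExp where
  | const (k : ℕ)
  | load (a : ℕ) (i j : NExp)
  | add (e f : NExp)
  | sub (e f : NExp)

def NExp.eval (m : Mem) : NExp → ℕ
  | const k => k
  | load a i j => m.nat a (i.eval m) (j.eval m)
  | add e f => e.eval m + f.eval m
  | sub e f => e.eval m - f.eval m

def NExp.cost : NExp → ℕ
  | const _ => 1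
  | load _ i j => 1 + i.cost + j.cost
  | add e f => 1 + e.cost + f.cost
  | sub e f => 1 + e.cost + f.cost

/-- Expressions with a real number as value. -/
inductive RExp where
  | zero
  | load (a : ℕ) (i j : NExp)
  | add (e f : RExp)
  | sub (e f : RExp)

def RExp.eval (m : Mem) : RExp → ℝ
  | zero => 0
  | load a i j => m.real a (i.eval m) (j.eval m)
  | add e f => e.eval m + f.eval m
  | sub e f => e.eval m - f.eval m

def RExp.cost : RExp → ℕ
  | zero => 1
  | load _ i j => 1 + i.cost + j.cost
  | add e f => 1 + e.cost + f.cost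
  | sub e f => 1 + e.cost + f.cost

/-- Tests. -/
inductive BExp where
  | natLt (e f : NExp)
  | natEq (e f : NExp)
  | realLt (e f : RExp)
  | not (b : BExp)
  | and (b b' : BExp)

def BExp.Holds (m : Mem) : BExp → Prop
  | natLt e f => e.eval m < f.eval m
  | natEq e f => e.eval m = f.eval m
  | realLt e f => e.eval m < f.eval m
  | not b => ¬ b.Holds m
  | and b b' => b.Holds m ∧ b'.Holds m

def BExp.cost : BExp → ℕ
  | natLt e f => 1 + e.cost + f.cost
  | natEq e f => 1 + e.cost + f.cost
  | realLt e f => 1 + e.cost + f.cost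
  | not b => 1 + b.cost
  | and b b' => 1 + b.cost + b'.cost

/-- Programs. -/
inductive Prog where
  | skip
  | setNat (a : ℕ) (i j e : NExp)
  | setReal (a : ℕ) (i j : NExp) (e : RExp)
  | seq (P Q : Prog)
  | branch (b : BExp) (P Q : Prog)
  | loop (b : BExp) (P : Prog)

/-- `Exec P m m' t`: started on memory `m`, the program `P` halts after exactly `t` steps with
memory `m'`. -/
inductive Exec : Prog → Mem → Mem → ℕ → Prop where
  | skip (m : Mem) : Exec Prog.skip m m 1
  | setNat (a : ℕ) (i j e : NExp) (m : Mem) :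
      Exec (Prog.setNat a i j e) m (m.setNat a (i.eval m) (j.eval m) (e.eval m))
        (1 + i.cost + j.cost + e.cost)
  | setReal (a : ℕ) (i j : NExp) (e : RExp) (m : Mem) :
      Exec (Prog.setReal a i j e) m (m.setReal a (i.eval m) (j.eval m) (e.eval m))
        (1 + i.cost + j.cost + e.cost)
  | seq {P Q : Prog} {m m' m'' : Mem} {t t' : ℕ} :
      Exec P m m' t → Exec Q m' m'' t' → Exec (Prog.seq P Q) m m'' (t + t')
  | branch_true {b : BExp} {P Q : Prog} {m m' : Mem} {t : ℕ} :
      b.Holds m → Exec P m m' t → Exec (Prog.branch b P Q) m m' (1 + b.cost + t)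
  | branch_false {b : BExp} {P Q : Prog} {m m' : Mem} {t : ℕ} :
      ¬ b.Holds m → Exec Q m m' t → Exec (Prog.branch b P Q) m m' (1 + b.cost + t)
  | loop_true {b : BExp} {P : Prog} {m m' m'' : Mem} {t t' : ℕ} :
      b.Holds m → Exec P m m' t → Exec (Prog.loop b P) m' m'' t' →
        Exec (Prog.loop b P) m m'' (1 + b.cost + t + t')
  | loop_false {b : BExp} {P : Prog} {m : Mem} :
      ¬ b.Holds m → Exec (Prog.loop b P) m m (1 + b.cost)

/-- The initial memory of the assignment problem: `N` in cell `(0, 0)` of natural array `0`, the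
cost matrix in real array `0`, and zero everywhere else. -/
def lsapInput {N : ℕ} (d : Matrix (Fin N) (Fin N) ℝ) : Mem where
  nat := fun a i j => if a = 0 ∧ i = 0 ∧ j = 0 then N else 0
  real := fun a i j =>
    if h : a = 0 ∧ i < N ∧ j < N then d ⟨i, h.2.1⟩ ⟨j, h.2.2⟩ else 0

/-- The initial memory of the sensing problem: `n` and `N` in cells `(0, 0)` and `(0, 1)` of
natural array `0`, the structure of the system matrix in natural array `1`, the cost matrix in
real array `0`, and zero everywhere else. -/
def sensingInput {n N : ℕ} (A : Pattern n n) (c : Matrix (Fin N) (Fin n) ℝ) : Mem where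
  nat := fun a i j =>
    if a = 0 ∧ i = 0 ∧ j = 0 then n
    else if a = 0 ∧ i = 0 ∧ j = 1 then N
    else if h : a = 1 ∧ i < n ∧ j < n then (A ⟨i, h.2.1⟩ ⟨j, h.2.2⟩).toNat
    else 0
  real := fun a i j =>
    if h : a = 0 ∧ i < N ∧ j < n then c ⟨i, h.2.1⟩ ⟨j, h.2.2⟩ else 0

/-- The 0-1 matrix `X` is found in natural array `2`. -/
def Outputs {r s : ℕ} (m : Mem) (X : Pattern r s) : Prop :=
  ∀ (i : Fin r) (j : Fin s), m.nat 2 i j = (X i j).toNat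

end SensingCost

end

noncomputable section

namespace SensingCost

/-! ### Reasoning about programs -/

namespace Prog

/-! The proof has an algebraic half and an algorithmic half.

Feasibility. If no agent measures a parent SCC, the vectors supported on it form an invariant
subspace that no output sees (`exists_measured_of_parentSCC`). Since a maximum matching has no
augmenting path, the columns of a contraction `C` are nonzero in at most `|C| - 1` rows, so some
nonzero vector supported on `C` is killed by the system matrix (`exists_measured_of_unmatched`).
Hence each of the `N` sets is measured by some agent; as the sets are disjoint and each of the `N`
agents measures one state, agents and sets correspond bijectively. Conversely, given such a
bijection, Hall's theorem along alternating paths (`exists_injective_of_alternating`) sends the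
states to distinct successors or to agents that measure them, and
`structurallyObservable_of_injective` builds an observable realization: the successors are completed
to a permutation, its cycles get distinct positive weights, and every cycle without a measured state
is joined by one link to a cycle closer to a measured one. Comparing moduli in the eigenvector
equation, an unobserved eigenvector would be nonzero on all of some measured cycle
(`eq_zero_of_cactus`). A small perturbation switches on the remaining links. With this description
of feasibility (`sensingFeasible_iff`) the reduction compares two sums termwise
(`reducesToLSAP_of_feasible_iff`). A matched digraph is the case without contractions.

Algorithms. `Total` is a total-correctness judgement with the step bound `Prog.bound`, a polynomial
whose degree is at most the loop depth. The Hungarian method is the primal-dual one: rows are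
inserted one at a time along augmenting paths of zero slack, while potentials keep the slacks
nonnegative; complementary slackness gives optimality (`Matched.optimal`), and loop depth three
gives the cubic bound. It is verified with forbidden pairs, provided that some allowed perfect
matching exists. The sensing program computes no maximum matching and no contraction. It solves one
assignment problem of size `n + n + N`: every state goes to a successor or to an agent, the slot of
the least state of each parent SCC must go to an agent, and dummies fill the rest. Allowed
assignments decode to feasible structures of the same cost (`decode_assignment`), and under (i) or
(ii) feasible structures encode at no greater cost (`encode_assignment`). -/

/-- The arrays of natural numbers that a program may write. -/
def natW : Prog → List ℕ
  | skip => []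
  | setNat a _ _ _ => [a]
  | setReal _ _ _ _ => []
  | seq P Q => P.natW ++ Q.natW
  | branch _ P Q => P.natW ++ Q.natW
  | loop _ P => P.natW

/-- The arrays of real numbers that a program may write. -/
def realW : Prog → List ℕ
  | skip => []
  | setNat _ _ _ _ => []
  | setReal a _ _ _ => [a]
  | seq P Q => P.realW ++ Q.realW
  | branch _ P Q => P.realW ++ Q.realW
  | loop _ P => P.realW

/-- The number of steps of a program all of whose loops make at most `K` rounds. -/
def bound (K : ℕ) : Prog → ℕ
  | skip => 1
  | setNat _ i j e => 1 + i.cost + j.cost + e.cost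
  | setReal _ i j e => 1 + i.cost + j.cost + e.cost
  | seq P Q => P.bound K + Q.bound K
  | branch b P Q => 1 + b.cost + (P.bound K + Q.bound K)
  | loop b P => K * (1 + b.cost + P.bound K) + (1 + b.cost)

/-- The nesting depth of the loops of a program. -/
def depth : Prog → ℕ
  | skip => 0
  | setNat _ _ _ _ => 0
  | setReal _ _ _ _ => 0
  | seq P Q => max P.depth Q.depth
  | branch _ P Q => max P.depth Q.depth
  | loop _ P => P.depth + 1

/-- Each loop multiplies the bound of its body by at most `K + 1`; the constant absorbs the tests
and the lower powers. -/
theorem exists_bound_le (P : Prog) : ∃ C, ∀ K, P.bound K ≤ C * (K + 1) ^ P.depth := by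
  have mono : ∀ {C K a b : ℕ}, a ≤ b → C * (K + 1) ^ a ≤ C * (K + 1) ^ b := fun h =>
    Nat.mul_le_mul_left _ (Nat.pow_le_pow_right (Nat.succ_pos _) h)
  induction P with
  | skip => exact ⟨1, fun K => by simp [bound, depth]⟩
  | setNat a i j e => exact ⟨_, fun K => by simp only [bound, depth, pow_zero, mul_one]; exact le_rfl⟩
  | setReal a i j e => exact ⟨_, fun K => by simp only [bound, depth, pow_zero, mul_one]; exact le_rfl⟩
  | seq P Q hP hQ =>
    obtain ⟨C, hC⟩ := hP
    obtain ⟨D, hD⟩ := hQ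
    refine ⟨C + D, fun K => ?_⟩
    rw [add_mul]
    exact add_le_add ((hC K).trans (mono (le_max_left _ _))) ((hD K).trans (mono (le_max_right _ _)))
  | branch b P Q hP hQ =>
    obtain ⟨C, hC⟩ := hP
    obtain ⟨D, hD⟩ := hQ
    refine ⟨(1 + b.cost) + (C + D), fun K => ?_⟩
    rw [add_mul, add_mul C]
    refine add_le_add (Nat.le_mul_of_pos_right _ (by positivity)) ?_
    exact add_le_add ((hC K).trans (mono (le_max_left _ _))) ((hD K).trans (mono (le_max_right _ _)))
  | loop b P hP =>
    obtain ⟨C, hC⟩ := hP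
    refine ⟨(1 + b.cost + C) + (1 + b.cost), fun K => ?_⟩
    rw [add_mul]
    refine add_le_add ?_ (Nat.le_mul_of_pos_right _ (by positivity))
    have h1 : 1 + b.cost + P.bound K ≤ (1 + b.cost + C) * (K + 1) ^ P.depth := by
      rw [add_mul]
      exact add_le_add (Nat.le_mul_of_pos_right _ (by positivity)) (hC K)
    calc K * (1 + b.cost + P.bound K) ≤ (K + 1) * ((1 + b.cost + C) * (K + 1) ^ P.depth) :=
          Nat.mul_le_mul (Nat.le_succ K) h1
      _ = (1 + b.cost + C) * (K + 1) ^ (loop b P).depth := by simp only [depth]; ring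

end Prog

/-! ### Memory updates, frames and rules for total correctness. -/

@[simp] theorem Mem.setNat_nat (m : Mem) (a i j x a' i' : ℕ) : (m.setNat a i j x).nat a' i' =
    fun j' => if a' = a ∧ i' = i ∧ j' = j then x else m.nat a' i' j' := rfl

@[simp] theorem Mem.setNat_real (m : Mem) (a i j x : ℕ) : (m.setNat a i j x).real = m.real := rfl

@[simp] theorem Mem.setReal_real (m : Mem) (a i j : ℕ) (x : ℝ) (a' i' : ℕ) :
    (m.setReal a i j x).real a' i' =
      fun j' => if a' = a ∧ i' = i ∧ j' = j then x else m.real a' i' j' := rfl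

@[simp] theorem Mem.setReal_nat (m : Mem) (a i j : ℕ) (x : ℝ) : (m.setReal a i j x).nat = m.nat :=
  rfl

attribute [simp] NExp.eval RExp.eval BExp.Holds

/-- The memory `m'` differs from `m` only in arrays that `P` may write. -/
structure Frame (P : Prog) (m m' : Mem) : Prop where
  nat : ∀ a, a ∉ P.natW → m'.nat a = m.nat a
  real : ∀ a, a ∉ P.realW → m'.real a = m.real a

theorem Frame.refl (P : Prog) (m : Mem) : Frame P m m := ⟨fun _ _ => rfl, fun _ _ => rfl⟩

theorem Frame.trans {P : Prog} {m m' m'' : Mem} (h : Frame P m m') (h' : Frame P m' m'') :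
    Frame P m m'' :=
  ⟨fun a ha => (h'.nat a ha).trans (h.nat a ha), fun a ha => (h'.real a ha).trans (h.real a ha)⟩

/-- For a concrete program the arrays that are never written are found by `decide`, so invariants
need only mention what changes. -/
theorem Exec.frame {P : Prog} {m m' : Mem} {t : ℕ} (h : Exec P m m' t) : Frame P m m' := by
  induction h with
  | skip m => exact Frame.refl _ _
  | setNat a i j e m =>
    refine ⟨fun b hb => ?_, fun b hb => rfl⟩
    simp only [Prog.natW, List.mem_singleton] at hb
    funext i' j'
    simp [hb]
  | setReal a i j e m =>
    refine ⟨fun b hb => rfl, fun b hb => ?_⟩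
    simp only [Prog.realW, List.mem_singleton] at hb
    funext i' j'
    simp [hb]
  | seq _ _ h1 h2 =>
    refine ⟨fun b hb => ?_, fun b hb => ?_⟩
    · simp only [Prog.natW, List.mem_append, not_or] at hb
      rw [h2.nat b hb.2, h1.nat b hb.1]
    · simp only [Prog.realW, List.mem_append, not_or] at hb
      rw [h2.real b hb.2, h1.real b hb.1]
  | branch_true _ _ h1 =>
    refine ⟨fun b hb => ?_, fun b hb => ?_⟩
    · simp only [Prog.natW, List.mem_append, not_or] at hb
      rw [h1.nat b hb.1]
    · simp only [Prog.realW, List.mem_append, not_or] at hb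
      rw [h1.real b hb.1]
  | branch_false _ _ h1 =>
    refine ⟨fun b hb => ?_, fun b hb => ?_⟩
    · simp only [Prog.natW, List.mem_append, not_or] at hb
      rw [h1.nat b hb.2]
    · simp only [Prog.realW, List.mem_append, not_or] at hb
      rw [h1.real b hb.2]
  | loop_true _ _ _ h1 h2 =>
    refine ⟨fun b hb => ?_, fun b hb => ?_⟩
    · rw [h2.nat b hb, h1.nat b hb]
    · rw [h2.real b hb, h1.real b hb]
  | loop_false _ => exact Frame.refl _ _

/-- Started on `m`, the program `P` halts after at most `P.bound K` steps with a memory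
that satisfies `Q`. -/
def Total (K : ℕ) (P : Prog) (m : Mem) (Q : Mem → Prop) : Prop :=
  ∃ m' t, Exec P m m' t ∧ t ≤ P.bound K ∧ Q m'

namespace Total

variable {K : ℕ} {P P' : Prog} {m : Mem} {Q Q' : Mem → Prop}

/-- The rule of consequence supplies the frame for free, so specifications need not list unchanged
arrays. -/
theorem mono (h : Total K P m Q) (hQ : ∀ m', Frame P m m' → Q m' → Q' m') : Total K P m Q' := by
  obtain ⟨m', t, he, ht, hq⟩ := h
  exact ⟨m', t, he, ht, hQ m' he.frame hq⟩

theorem skip (h : Q m) : Total K Prog.skip m Q := ⟨m, 1, Exec.skip m, le_rfl, h⟩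

theorem setNat {a : ℕ} {i j e : NExp} (h : Q (m.setNat a (i.eval m) (j.eval m) (e.eval m))) :
    Total K (Prog.setNat a i j e) m Q := ⟨_, _, Exec.setNat a i j e m, le_rfl, h⟩

theorem setReal {a : ℕ} {i j : NExp} {e : RExp}
    (h : Q (m.setReal a (i.eval m) (j.eval m) (e.eval m))) :
    Total K (Prog.setReal a i j e) m Q := ⟨_, _, Exec.setReal a i j e m, le_rfl, h⟩

theorem seq (h : Total K P m fun m' => Total K P' m' Q) : Total K (Prog.seq P P') m Q := by
  obtain ⟨m', t, he, ht, m'', t', he', ht', hq⟩ := h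
  exact ⟨m'', t + t', Exec.seq he he', add_le_add ht ht', hq⟩

theorem branch {b : BExp} (h : b.Holds m → Total K P m Q) (h' : ¬ b.Holds m → Total K P' m Q) :
    Total K (Prog.branch b P P') m Q := by
  by_cases hb : b.Holds m
  · obtain ⟨m', t, he, ht, hq⟩ := h hb
    exact ⟨m', _, Exec.branch_true hb he, Nat.add_le_add_left (ht.trans (Nat.le_add_right _ _)) _, hq⟩
  · obtain ⟨m', t, he, ht, hq⟩ := h' hb
    exact ⟨m', _, Exec.branch_false hb he, Nat.add_le_add_left (ht.trans (Nat.le_add_left _ _)) _, hq⟩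

/-- A loop with invariant `I`, where the parameter of `I` counts the rounds. -/
theorem loop {b : BExp} (I : ℕ → Mem → Prop) (h0 : I 0 m)
    (hstep : ∀ k m', Frame P m m' → I k m' → b.Holds m' → k < K ∧ Total K P m' (I (k + 1)))
    (hpost : ∀ k m', Frame P m m' → I k m' → ¬ b.Holds m' → Q m') :
    Total K (Prog.loop b P) m Q := by
  -- Here `s` counts the rounds still available; at `s = 0` the test must fail, because a further
  -- round would need `k < K`.
  have key : ∀ s k m', s + k = K → Frame P m m' → I k m' → ∃ m'' t, Exec (Prog.loop b P) m' m'' t ∧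
      t ≤ s * (1 + b.cost + P.bound K) + (1 + b.cost) ∧ Q m'' := by
    intro s
    induction s with
    | zero =>
      intro k m' hk hf hI
      have hb : ¬ b.Holds m' := fun hb => by
        have := (hstep k m' hf hI hb).1
        omega
      exact ⟨m', _, Exec.loop_false hb, by omega, hpost k m' hf hI hb⟩
    | succ s ih =>
      intro k m' hk hf hI
      by_cases hb : b.Holds m'
      · obtain ⟨m1, t1, he1, ht1, hI1⟩ := (hstep k m' hf hI hb).2
        obtain ⟨m2, t2, he2, ht2, hq⟩ := ih (k + 1) m1 (by omega) (hf.trans he1.frame) hI1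
        exact ⟨m2, _, Exec.loop_true hb he1 he2, by rw [Nat.succ_mul]; omega, hq⟩
      · exact ⟨m', _, Exec.loop_false hb, by omega, hpost k m' hf hI hb⟩
  obtain ⟨m'', t, he, ht, hq⟩ := key K 0 m rfl (Frame.refl P m) h0
  exact ⟨m'', t, he, ht, hq⟩

end Total

/-! ### Scalar variables, one-dimensional arrays and `for` loops. -/

/-- The scalar variable stored in cell `(0, 0)` of natural array `a`. -/
abbrev NExp.var (a : ℕ) : NExp := .load a (.const 0) (.const 0)

/-- Cell `(0, i)` of natural array `a`. -/
abbrev NExp.arr (a : ℕ) (i : NExp) : NExp := .load a (.const 0) i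

/-- Cell `(0, i)` of real array `a`. -/
abbrev RExp.arr (a : ℕ) (i : NExp) : RExp := .load a (.const 0) i

namespace Prog

/-- Assignment to a scalar variable. -/
abbrev assign (a : ℕ) (e : NExp) : Prog := .setNat a (.const 0) (.const 0) e

/-- `for k < e do P`, with the scalar variable `k`. -/
def forLoop (k : ℕ) (e : NExp) (P : Prog) : Prog :=
  seq (assign k (.const 0)) (loop (.natLt (.var k) e) (seq P (assign k (.add (.var k) (.const 1)))))

end Prog

/-- The rule for `for` loops. The invariant may not depend on the loop variable. -/
theorem Total.forLoop {K k : ℕ} {e : NExp} {P : Prog} {m : Mem} {Q : Mem → Prop} (B : ℕ)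
    (I : ℕ → Mem → Prop) (hB : B ≤ K) (hk : k ∉ P.natW)
    (he : ∀ m', Frame (Prog.forLoop k e P) m m' → e.eval m' = B)
    (hI : ∀ i x m', I i m' → I i (m'.setNat k 0 0 x)) (h0 : I 0 m)
    (hstep : ∀ i m', i < B → Frame (Prog.forLoop k e P) m m' → m'.nat k 0 0 = i → I i m' →
      Total K P m' (I (i + 1)))
    (hpost : ∀ m', Frame (Prog.forLoop k e P) m m' → I B m' → Q m') :
    Total K (Prog.forLoop k e P) m Q := by
  have hkW : (k ∈ (Prog.forLoop k e P).natW) := by simp [Prog.forLoop, Prog.natW]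
  refine Total.seq (Total.setNat ?_)
  have hf0 : Frame (Prog.forLoop k e P) m (m.setNat k 0 0 0) := by
    refine ⟨fun a ha => ?_, fun _ _ => rfl⟩
    have : a ≠ k := fun h => ha (h ▸ hkW)
    funext i j
    simp [this]
  have hf1 : ∀ m' m'' : Mem, Frame (Prog.forLoop k e P) m m' →
      Frame (Prog.seq P (Prog.assign k (.add (.var k) (.const 1)))) m' m'' →
      Frame (Prog.forLoop k e P) m m'' := by
    refine fun m' m'' h h' => ⟨fun a ha => ?_, fun a ha => ?_⟩
    · rw [h'.nat a, h.nat a ha]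
      simp only [Prog.forLoop, Prog.natW, List.mem_append, List.mem_singleton, not_or] at ha ⊢
      exact ha.2
    · rw [h'.real a, h.real a ha]
      simpa [Prog.forLoop, Prog.realW] using ha
  -- Tying the loop variable to the round number, with `i ≤ B`, forces `i = B` at exit.
  refine Total.loop (fun i m' => I i m' ∧ m'.nat k 0 0 = i ∧ i ≤ B) ⟨hI _ _ _ h0, ?_, Nat.zero_le _⟩
    ?_ ?_
  · simp
  · rintro i m' hf ⟨hi, hki, hiB⟩ hb
    have hf' := hf1 _ _ hf0 hf
    have hlt : i < B := by
      have := he m' hf'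
      simp only [BExp.Holds, NExp.eval, hki, this] at hb
      exact hb
    refine ⟨hlt.trans_le hB, Total.seq ((hstep i m' hlt hf' hki hi).mono fun m1 hfr h1 => ?_)⟩
    refine Total.setNat ?_
    have h2 : m1.nat k 0 0 = i := by rw [hfr.nat k hk, hki]
    refine ⟨hI _ _ _ h1, ?_, hlt⟩
    simp [h2]
  · rintro i m' hf ⟨hi, hki, hiB⟩ hb
    have hf' := hf1 _ _ hf0 hf
    have : B ≤ i := by
      have := he m' hf'
      simp only [BExp.Holds, NExp.eval, hki, this] at hb
      omega
    obtain rfl : i = B := le_antisymm hiB this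
    exact hpost m' hf' hi

/-! ### The Hungarian method: invariants -/

/-- Rows `< r` are matched by `q` (with inverse `p`, shifted by one) along allowed pairs with
zero slack. -/
structure Matched (K r : ℕ) (W : ℕ → ℕ → Prop) (s : ℕ → ℕ → ℝ) (p q : ℕ → ℕ) : Prop where
  row : ∀ i < r, q i < K ∧ W i (q i) ∧ s i (q i) = 0 ∧ p (q i) = i + 1
  col : ∀ j < K, p j ≠ 0 → p j - 1 < r ∧ q (p j - 1) = j

/-- The state of the search for an augmenting path from row `r` with `k` visited columns:
`ur` and `uc` mark the visited rows and columns, `way` points to the predecessor rows. -/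
structure Search (K r k : ℕ) (g : Prop) (W : ℕ → ℕ → Prop) (s : ℕ → ℕ → ℝ)
    (p q way ur uc ord : ℕ → ℕ) : Prop where
  lt : r < K
  matched : Matched K r W s p q
  feas : ∀ i ≤ r, (i = r → g) → ∀ j < K, W i j → 0 ≤ s i j
  row_iff : ∀ i < K, ur i = 1 ↔ i = r ∨ (i < r ∧ uc (q i) = 1)
  col_matched : ∀ j < K, uc j = 1 → p j ≠ 0
  card : ((Finset.range K).filter fun j => uc j = 1).card = k
  tree : ∀ j < K, uc j = 1 → ord j < k ∧ way j ≤ r ∧ W (way j) j ∧ s (way j) j = 0 ∧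
    (way j < r → uc (q (way j)) = 1 ∧ ord (q (way j)) < ord j)

/-- `minv j` is the minimal slack of column `j` among the rows in `R`, attained at row `way j`,
provided that `fin j = 1`; otherwise column `j` has no allowed row in `R`. -/
structure ColMin (R : ℕ → Prop) (W : ℕ → ℕ → Prop) (s : ℕ → ℕ → ℝ) (minv : ℕ → ℝ)
    (way fin : ℕ → ℕ) (j : ℕ) : Prop where
  some : fin j = 1 → R (way j) ∧ W (way j) j ∧ minv j = s (way j) j ∧
    ∀ i, R i → W i j → minv j ≤ s i j
  none : fin j ≠ 1 → ∀ i, R i → ¬ W i j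

/-- A perfect matching along allowed pairs. -/
structure IsPerfect (K : ℕ) (W : ℕ → ℕ → Prop) (π : ℕ → ℕ) : Prop where
  lt : ∀ i < K, π i < K
  inj : ∀ i < K, ∀ j < K, π i = π j → i = j
  mem : ∀ i < K, W i (π i)

section

variable {K r k : ℕ} {g : Prop} {W : ℕ → ℕ → Prop} {s s' : ℕ → ℕ → ℝ}
  {p q way ur uc ord fin : ℕ → ℕ} {minv minv' : ℕ → ℝ}

theorem Matched.inj (h : Matched K r W s p q) {i j : ℕ} (hi : i < r) (hj : j < r)
    (hij : q i = q j) : i = j := by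
  have h1 := (h.row i hi).2.2.2
  have h2 := (h.row j hj).2.2.2
  rw [hij] at h1
  omega

/-- Each visited column is matched to a visited row other than the root `r`, and different columns
to different rows. -/
theorem Search.lt_card (h : Search K r k g W s p q way ur uc ord) :
    k < ((Finset.range K).filter fun i => ur i = 1).card := by
  have hlt := h.lt
  have h2 : ((Finset.range K).filter fun j => uc j = 1).card ≤
      (((Finset.range K).filter fun i => ur i = 1).erase r).card := by
    refine Finset.card_le_card_of_injOn (fun j => p j - 1) ?_ ?_
    · intro j hj
      simp only [Finset.coe_filter, Finset.mem_range, Set.mem_ofPred_eq] at hj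
      obtain ⟨h3, h4⟩ := h.matched.col j hj.1 (h.col_matched j hj.1 hj.2)
      simp only [Finset.coe_erase, Finset.coe_filter, Finset.mem_range, Set.mem_sdiff,
        Set.mem_ofPred_eq, Set.mem_singleton_iff]
      refine ⟨⟨by omega, (h.row_iff _ (by omega)).2 (Or.inr ⟨h3, by rw [h4]; exact hj.2⟩)⟩, by omega⟩
    · intro i hi j hj hij
      simp only [Finset.coe_filter, Finset.mem_range, Set.mem_ofPred_eq] at hi hj
      rw [← (h.matched.col j hj.1 (h.col_matched j hj.1 hj.2)).2,
        ← (h.matched.col i hi.1 (h.col_matched i hi.1 hi.2)).2]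
      exact congrArg q hij
  have h3 : r ∈ (Finset.range K).filter fun i => ur i = 1 := by
    simp only [Finset.mem_filter, Finset.mem_range]
    exact ⟨hlt, (h.row_iff r hlt).2 (Or.inl rfl)⟩
  have h4 := Finset.card_erase_lt_of_mem h3
  have h5 := h.card
  omega

theorem Search.lt_size (h : Search K r k g W s p q way ur uc ord) : k < K := by
  refine h.lt_card.trans_le ((Finset.card_filter_le _ _).trans ?_)
  rw [Finset.card_range]

/-- Visited rows outnumber visited columns, so `π` sends some visited row to an unvisited column.
That column has an allowed visited row, hence a finite minimal slack. -/
theorem Search.exists_col (h : Search K r k g W s p q way ur uc ord)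
    (hc : ∀ j < K, uc j ≠ 1 → ColMin (fun i => i < K ∧ ur i = 1) W s minv way fin j)
    {π : ℕ → ℕ} (hπ : IsPerfect K W π) : ∃ j < K, uc j ≠ 1 ∧ fin j = 1 := by
  by_contra! hno
  have h1 : ((Finset.range K).filter fun i => ur i = 1).card ≤
      ((Finset.range K).filter fun j => uc j = 1).card := by
    refine Finset.card_le_card_of_injOn π ?_ ?_
    · intro i hi
      simp only [Finset.coe_filter, Finset.mem_range, Set.mem_ofPred_eq] at hi ⊢
      refine ⟨hπ.lt i hi.1, ?_⟩
      by_contra hu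
      exact (hc _ (hπ.lt i hi.1) hu).none (hno _ (hπ.lt i hi.1) hu) i hi (hπ.mem i hi.1)
    · intro i hi j hj hij
      simp only [Finset.coe_filter, Finset.mem_range, Set.mem_ofPred_eq] at hi hj
      exact hπ.inj i hi.1 j hj.1 hij
  have h2 := h.lt_card
  have h3 := h.card
  omega

/-- The false proposition `0 ≠ 0` exempts the new row `r` from feasibility: its slacks may be
negative until the first change of potentials. -/
theorem Matched.search (h : Matched K r W s p q) (hr : r < K)
    (hfeas : ∀ i < r, ∀ j < K, W i j → 0 ≤ s i j) (hur : ∀ i < K, ur i = 1 ↔ i = r)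
    (huc : ∀ j < K, uc j ≠ 1) : Search K r 0 (0 ≠ 0) W s p q way ur uc ord := by
  refine ⟨hr, h, fun i hi hg => hfeas i ?_, fun i hi => ?_, fun j hj hu => absurd hu (huc j hj), ?_,
    fun j hj hu => absurd hu (huc j hj)⟩
  · exact lt_of_le_of_ne hi fun h => hg h rfl
  · rw [hur i hi]
    exact ⟨Or.inl, fun h1 => h1.resolve_right fun h2 => huc _ (h.row i h2.1).1 h2.2⟩
  · rw [Finset.card_eq_zero, Finset.filter_eq_empty_iff]
    exact fun j hj => huc j (Finset.mem_range.1 hj)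

/-- The dual step. A visited row loses `δ` against unvisited columns only, which minimality of `δ`
allows, and an unvisited row gains `δ` against visited columns only. Matched pairs and tree pairs
lie on the same side, so they keep slack zero, and the pair that attains the minimum becomes tight.
-/
theorem Search.update {j₁ : ℕ} {δ : ℝ} (h : Search K r k (k ≠ 0) W s p q way ur uc ord)
    (hc : ∀ j < K, uc j ≠ 1 → ColMin (fun i => i < K ∧ ur i = 1) W s minv way fin j)
    (hj : j₁ < K) (huj : uc j₁ ≠ 1) (hfin : fin j₁ = 1)
    (hmin : ∀ j < K, uc j ≠ 1 → fin j = 1 → minv j₁ ≤ minv j) (hδ : δ = minv j₁)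
    (hs : ∀ i < K, ∀ j < K,
      s' i j = s i j - (if ur i = 1 then δ else 0) + (if uc j = 1 then δ else 0))
    (hm : ∀ j < K, uc j ≠ 1 → minv' j = minv j - δ) :
    Search K r k True W s' p q way ur uc ord ∧
      (∀ j < K, uc j ≠ 1 → ColMin (fun i => i < K ∧ ur i = 1) W s' minv' way fin j) ∧
      way j₁ ≤ r ∧ ur (way j₁) = 1 ∧ W (way j₁) j₁ ∧ s' (way j₁) j₁ = 0 := by
  have hlt := h.lt
  have hle : ∀ i < K, ur i = 1 → i ≤ r := by
    intro i hi hu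
    rcases (h.row_iff i hi).1 hu with h1 | h1 <;> omega
  obtain ⟨⟨hw1, hw2⟩, hw3, hw4, -⟩ := (hc j₁ hj huj).some hfin
  -- The first `δ` may be negative because row `r` is not yet feasible. The sign of `δ` matters only
  -- if some column is visited, and then row `r` is feasible.
  have hvis : ∀ j < K, uc j = 1 → k ≠ 0 := by
    intro j hj1 hu hk
    have h1 := h.card
    rw [hk, Finset.card_eq_zero] at h1
    have : j ∈ (Finset.range K).filter fun j => uc j = 1 := by simp [hj1, hu]
    rw [h1] at this
    simp at this
  have hs0 : ∀ i < K, ∀ j < K, (ur i = 1 ↔ uc j = 1) → s' i j = s i j := by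
    intro i hi j hj1 hiff
    rw [hs i hi j hj1]
    by_cases hu : uc j = 1
    · rw [if_pos (hiff.2 hu), if_pos hu]; ring
    · rw [if_neg (fun h => hu (hiff.1 h)), if_neg hu]; ring
  refine ⟨⟨hlt, ⟨?_, h.matched.col⟩, ?_, h.row_iff, h.col_matched, h.card, ?_⟩, ?_, hle _ hw1 hw2,
    hw2, hw3, ?_⟩
  · intro i hi
    obtain ⟨h1, h2, h3, h4⟩ := h.matched.row i hi
    refine ⟨h1, h2, ?_, h4⟩
    rw [hs0 i (by omega) _ h1, h3]
    rw [h.row_iff i (by omega)]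
    constructor
    · rintro (h5 | h5)
      · omega
      · exact h5.2
    · exact fun h5 => Or.inr ⟨hi, h5⟩
  · intro i hi _ j hj1 hW
    have hiK : i < K := by omega
    by_cases hi1 : ur i = 1
    · by_cases hu : uc j = 1
      · rw [hs0 i hiK j hj1 (by simp [hi1, hu])]
        exact h.feas i hi (fun _ => hvis j hj1 hu) j hj1 hW
      · rw [hs i hiK j hj1, if_pos hi1, if_neg hu]
        have hcj := hc j hj1 hu
        by_cases hf : fin j = 1
        · have h1 := (hcj.some hf).2.2.2 i ⟨hiK, hi1⟩ hW
          have h2 := hmin j hj1 hu hf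
          linarith
        · exact absurd hW (hcj.none hf i ⟨hiK, hi1⟩)
    · have hir : i ≠ r := fun h1 => hi1 ((h.row_iff i hiK).2 (Or.inl h1))
      have h1 := h.feas i hi (fun h1 => absurd h1 hir) j hj1 hW
      rw [hs i hiK j hj1, if_neg hi1]
      by_cases hu : uc j = 1
      · rw [if_pos hu]
        have h2 := h.feas _ (hle _ hw1 hw2) (fun _ => hvis j hj1 hu) j₁ hj hw3
        linarith
      · rw [if_neg hu]; linarith
  · intro j hj1 hu
    obtain ⟨h1, h2, h3, h4, h5⟩ := h.tree j hj1 hu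
    refine ⟨h1, h2, h3, ?_, h5⟩
    rw [hs0 _ (by omega) j hj1, h4]
    rw [h.row_iff _ (by omega)]
    constructor
    · exact fun _ => hu
    · intro _
      rcases lt_or_eq_of_le h2 with h6 | h6
      · exact Or.inr ⟨h6, (h5 h6).1⟩
      · exact Or.inl h6
  · intro j hj1 hu
    have hcj := hc j hj1 hu
    refine ⟨fun hf => ?_, hcj.none⟩
    obtain ⟨⟨h1, h2⟩, h3, h4, h5⟩ := hcj.some hf
    refine ⟨⟨h1, h2⟩, h3, ?_, ?_⟩
    · rw [hm j hj1 hu, hs _ h1 j hj1, if_pos h2, if_neg hu, h4]; ring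
    · intro i hi hW
      have := h5 i hi hW
      rw [hm j hj1 hu, hs _ hi.1 j hj1, if_pos hi.2, if_neg hu]
      linarith
  · rw [hs _ hw1 j₁ hj, if_pos hw2, if_neg huj, hδ, hw4]; ring

/-- The column `j₁` is matched, so it joins the tree together with its row, which was unvisited
because `j₁` was. The minimal slacks do not yet include the new row; the next relaxation adds it.
The visiting order `ord` exists only in the proof and shows that predecessor paths end. -/
theorem Search.advance {j₁ : ℕ} {ur' uc' ord' : ℕ → ℕ}
    (h : Search K r k True W s p q way ur uc ord)
    (hc : ∀ j < K, uc j ≠ 1 → ColMin (fun i => i < K ∧ ur i = 1) W s minv way fin j)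
    (hj : j₁ < K) (huj : uc j₁ ≠ 1) (hw1 : way j₁ ≤ r) (hw2 : ur (way j₁) = 1)
    (hw3 : W (way j₁) j₁) (hw4 : s (way j₁) j₁ = 0) (hp : p j₁ ≠ 0)
    (hur : ∀ i, ur' i = if i = p j₁ - 1 then 1 else ur i)
    (huc : ∀ j, uc' j = if j = j₁ then 1 else uc j)
    (hord : ∀ j, ord' j = if j = j₁ then k else ord j) :
    Search K r (k + 1) (k + 1 ≠ 0) W s p q way ur' uc' ord' ∧
      p j₁ - 1 < r ∧ ur' (p j₁ - 1) = 1 ∧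
      ∀ j < K, uc' j ≠ 1 →
        ColMin (fun i => i < K ∧ ur' i = 1 ∧ i ≠ p j₁ - 1) W s minv way fin j := by
  have hlt := h.lt
  obtain ⟨hi1, hi2⟩ := h.matched.col j₁ hj hp
  have huri : ur (p j₁ - 1) ≠ 1 := by
    rw [Ne, h.row_iff _ (by omega), hi2]
    rintro (h1 | h1)
    · omega
    · exact huj h1.2
  refine ⟨⟨hlt, h.matched, fun i hi _ => h.feas i hi fun _ => trivial, ?_, ?_, ?_, ?_⟩, hi1,
    by simp [hur], ?_⟩
  · intro i hi
    rw [hur, huc]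
    by_cases h1 : i = p j₁ - 1
    · rw [if_pos h1]
      simp only [true_iff]
      right
      rw [h1, hi2, if_pos rfl]
      exact ⟨hi1, rfl⟩
    · rw [if_neg h1, h.row_iff i hi]
      by_cases h2 : i < r
      · have : q i ≠ j₁ := fun h3 => h1 (h.matched.inj h2 hi1 (h3.trans hi2.symm))
        rw [if_neg this]
      · simp [h2]
  · intro j hj1 hu
    rw [huc] at hu
    by_cases h1 : j = j₁
    · rwa [h1]
    · rw [if_neg h1] at hu
      exact h.col_matched j hj1 hu
  · have : ((Finset.range K).filter fun j => uc' j = 1) =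
        insert j₁ ((Finset.range K).filter fun j => uc j = 1) := by
      ext j
      simp only [Finset.mem_filter, Finset.mem_range, Finset.mem_insert, huc]
      by_cases h1 : j = j₁
      · simp [h1, hj]
      · simp [h1]
    rw [this, Finset.card_insert_of_notMem (by simp [huj]), h.card]
  · intro j hj1 hu
    rw [huc] at hu
    by_cases h1 : j = j₁
    · rw [h1]
      refine ⟨by simp [hord], hw1, hw3, hw4, fun h2 => ?_⟩
      rcases (h.row_iff _ (by omega)).1 hw2 with h3 | h3
      · omega
      · have h4 : q (way j₁) ≠ j₁ := fun h4 => huj (h4 ▸ h3.2)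
        rw [huc, hord, hord, if_neg h4, if_neg h4, if_pos rfl]
        exact ⟨h3.2, (h.tree _ (h.matched.row _ h2).1 h3.2).1⟩
    · rw [if_neg h1] at hu
      obtain ⟨h2, h3, h4, h5, h6⟩ := h.tree j hj1 hu
      refine ⟨by rw [hord, if_neg h1]; omega, h3, h4, h5, fun h7 => ?_⟩
      obtain ⟨h8, h9⟩ := h6 h7
      have h4 : q (way j) ≠ j₁ := fun h4 => huj (h4 ▸ h8)
      rw [huc, hord, hord, if_neg h4, if_neg h4, if_neg h1]
      exact ⟨h8, h9⟩
  · intro j hj1 hu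
    rw [huc] at hu
    by_cases h1 : j = j₁
    · simp [h1] at hu
    · rw [if_neg h1] at hu
      have hcj := hc j hj1 hu
      have hR : ∀ i, (i < K ∧ ur' i = 1 ∧ i ≠ p j₁ - 1) ↔ (i < K ∧ ur i = 1) := by
        intro i
        rw [hur]
        by_cases h2 : i = p j₁ - 1
        · subst h2; simp [huri]
        · simp [h2]
      exact ⟨fun hf => by simpa only [hR] using hcj.some hf, fun hf => by simpa only [hR] using hcj.none hf⟩

/-- The state of the augmentation along the path to column `j`, which is free; `q₀` is the
matching before the augmentation, and `G` is the set of columns that lie in the search tree. -/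
structure Augment (K r : ℕ) (W : ℕ → ℕ → Prop) (s : ℕ → ℕ → ℝ) (p q q₀ way ord : ℕ → ℕ)
    (G : ℕ → Prop) (j : ℕ) : Prop where
  lt : r < K
  tree : ∀ c, G c → c < K ∧ way c ≤ r ∧ W (way c) c ∧ s (way c) c = 0 ∧
    (way c < r → G (q₀ (way c)) ∧ ord (q₀ (way c)) < ord c)
  mem : G j
  row : ∀ i < r, q i < K ∧ W i (q i) ∧ s i (q i) = 0 ∧ p (q i) = i + 1 ∧ q i ≠ j
  col : ∀ c < K, c ≠ j → p c ≠ 0 → p c - 1 < r ∧ q (p c - 1) = c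
  old : ∀ i < r, G (q₀ i) → ord (q₀ i) < ord j → q i = q₀ i

/-- The free column `j₁` enters the tree with order `k`, above all orders used so far; `p j₁ = 0`
means that no row is matched to it. -/
theorem Search.augment {j₁ : ℕ} (h : Search K r k True W s p q way ur uc ord)
    (hj : j₁ < K) (huj : uc j₁ ≠ 1) (hw1 : way j₁ ≤ r) (hw2 : ur (way j₁) = 1)
    (hw3 : W (way j₁) j₁) (hw4 : s (way j₁) j₁ = 0) (hp : p j₁ = 0) :
    Augment K r W s p q q way (fun j => if j = j₁ then k else ord j)
      (fun j => j = j₁ ∨ (j < K ∧ uc j = 1)) j₁ := by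
  have hlt := h.lt
  refine ⟨hlt, ?_, Or.inl rfl, ?_, fun c hc _ hpc => h.matched.col c hc hpc, fun _ _ _ _ => rfl⟩
  · rintro c (rfl | ⟨hc, hu⟩)
    · refine ⟨hj, hw1, hw3, hw4, fun h2 => ?_⟩
      rcases (h.row_iff _ (by omega)).1 hw2 with h3 | h3
      · omega
      · have h4 : q (way c) ≠ c := fun h4 => huj (h4 ▸ h3.2)
        have h5 := (h.matched.row _ h2).1
        refine ⟨Or.inr ⟨h5, h3.2⟩, ?_⟩
        simp only [if_neg h4, if_true]
        exact (h.tree _ h5 h3.2).1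
    · obtain ⟨h2, h3, h4, h5, h6⟩ := h.tree c hc hu
      refine ⟨hc, h3, h4, h5, fun h7 => ?_⟩
      obtain ⟨h8, h9⟩ := h6 h7
      refine ⟨Or.inr ⟨(h.matched.row _ h7).1, h8⟩, ?_⟩
      have h10 : q (way c) ≠ j₁ := fun h4 => huj (h4 ▸ h8)
      have h11 : c ≠ j₁ := fun h4 => huj (h4 ▸ hu)
      simpa [h10, h11] using h9
  · intro i hi
    obtain ⟨h1, h2, h3, h4⟩ := h.matched.row i hi
    refine ⟨h1, h2, h3, h4, fun h5 => ?_⟩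
    rw [h5, hp] at h4
    omega

/-- The path has arrived at the root row, which owns no column to give back, so no column is left
over. -/
theorem Augment.final {G : ℕ → Prop} {q₀ p' q' : ℕ → ℕ} {j : ℕ}
    (h : Augment K r W s p q q₀ way ord G j) (hw : way j = r)
    (hp : ∀ c, p' c = if c = j then way j + 1 else p c)
    (hq : ∀ i, q' i = if i = way j then j else q i) : Matched K (r + 1) W s p' q' := by
  obtain ⟨h1, h2, h3, h4, h5⟩ := h.tree j h.mem
  refine ⟨fun i hi => ?_, fun c hc hpc => ?_⟩
  · by_cases hir : i = way j
    · rw [hq, if_pos hir, hir]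
      exact ⟨h1, h3, h4, by simp [hp]⟩
    · obtain ⟨h6, h7, h8, h9, h10⟩ := h.row i (by omega)
      rw [hq, if_neg hir]
      exact ⟨h6, h7, h8, by simp [hp, h10, h9]⟩
  · rw [hp] at hpc ⊢
    by_cases hcj : c = j
    · rw [if_pos hcj, hq, if_pos (by omega)]
      exact ⟨by omega, hcj.symm⟩
    · rw [if_neg hcj] at hpc ⊢
      obtain ⟨h6, h7⟩ := h.col c hc hcj hpc
      rw [hq, if_neg (by omega)]
      exact ⟨by omega, h7⟩

/-- The row `way j` takes `j` and releases its old column, the next free one. Rows whose columns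
have smaller order are still matched as in `q₀`, so the tree recorded for `q₀` still describes the
rest of the path, and the order drops. -/
theorem Augment.step {G : ℕ → Prop} {q₀ p' q' : ℕ → ℕ} {j : ℕ}
    (h : Augment K r W s p q q₀ way ord G j) (hw : way j ≠ r)
    (hp : ∀ c, p' c = if c = j then way j + 1 else p c)
    (hq : ∀ i, q' i = if i = way j then j else q i) :
    Augment K r W s p' q' q₀ way ord G (q (way j)) ∧ ord (q (way j)) < ord j := by
  obtain ⟨h1, h2, h3, h4, h5⟩ := h.tree j h.mem
  have hlt : way j < r := lt_of_le_of_ne h2 hw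
  obtain ⟨h6, h7⟩ := h5 hlt
  have h8 : q (way j) = q₀ (way j) := h.old _ hlt h6 h7
  refine ⟨⟨h.lt, h.tree, h8 ▸ h6, ?_, ?_, ?_⟩, h8 ▸ h7⟩
  · intro i hi
    obtain ⟨h9, h10, h11, h12, h13⟩ := h.row i hi
    by_cases hir : i = way j
    · rw [hq, if_pos hir, hir]
      exact ⟨h1, h3, h4, by simp [hp], (h.row _ hlt).2.2.2.2.symm⟩
    · rw [hq, if_neg hir]
      refine ⟨h9, h10, h11, by simp [hp, h13, h12], fun h14 => hir ?_⟩
      have h15 := (h.row _ hlt).2.2.2.1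
      rw [← h14] at h15
      omega
  · intro c hc hcj hpc
    rw [hp] at hpc ⊢
    by_cases hcj' : c = j
    · rw [if_pos hcj', hq, if_pos (by omega)]
      exact ⟨by omega, hcj'.symm⟩
    · rw [if_neg hcj'] at hpc ⊢
      obtain ⟨h9, h10⟩ := h.col c hc hcj' hpc
      rw [hq, if_neg]
      · exact ⟨h9, h10⟩
      · intro h11
        rw [h11] at h10
        exact hcj h10.symm
  · intro i hi hG hord
    rw [h8] at hord
    rw [hq, if_neg]
    · exact h.old i hi hG (hord.trans h7)
    · rintro rfl
      exact lt_irrefl _ hord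

/-- One more row competes for the minimum. The flag `fin` replaces an infinite initial value, which
the machine lacks. -/
theorem ColMin.relax {i₀ j : ℕ} {R R' : ℕ → Prop} {way' fin' : ℕ → ℕ}
    (h : ColMin R W s minv way fin j) (hR : ∀ i, R' i ↔ R i ∨ i = i₀)
    (h1 : W i₀ j → (fin j = 1 → s i₀ j < minv j) →
      minv' j = s i₀ j ∧ way' j = i₀ ∧ fin' j = 1)
    (h2 : ¬ (W i₀ j ∧ (fin j = 1 → s i₀ j < minv j)) →
      minv' j = minv j ∧ way' j = way j ∧ fin' j = fin j) :
    ColMin R' W s minv' way' fin' j := by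
  by_cases hc : W i₀ j ∧ (fin j = 1 → s i₀ j < minv j)
  · obtain ⟨e1, e2, e3⟩ := h1 hc.1 hc.2
    refine ⟨fun _ => ⟨?_, ?_, ?_, ?_⟩, fun hf => absurd e3 hf⟩
    · rw [e2, hR]; exact Or.inr rfl
    · rw [e2]; exact hc.1
    · rw [e2, e1]
    · intro i hi hW
      rw [e1]
      rcases (hR i).1 hi with hi | rfl
      · by_cases hf : fin j = 1
        · exact (hc.2 hf).le.trans ((h.some hf).2.2.2 i hi hW)
        · exact absurd hW (h.none hf i hi)
      · exact le_rfl
  · obtain ⟨e1, e2, e3⟩ := h2 hc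
    rw [not_and] at hc
    refine ⟨fun hf => ?_, fun hf i hi hW => ?_⟩
    · rw [e3] at hf
      obtain ⟨h3, h4, h5, h6⟩ := h.some hf
      rw [e2, e1]
      refine ⟨(hR _).2 (Or.inl h3), h4, h5, fun i hi hW => ?_⟩
      rcases (hR i).1 hi with hi | rfl
      · exact h6 i hi hW
      · have := hc hW
        push Not at this
        exact this.2
    · rw [e3] at hf
      rcases (hR i).1 hi with hi | rfl
      · exact h.none hf i hi hW
      · exact hc hW fun h => absurd h hf

/-- Weak duality: the potentials have the same sum along every perfect matching, this sum bounds the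
cost from below, and zero slack along `q` attains it. The potentials need no sign, as all rows and
columns are matched. -/
theorem Matched.optimal {d : ℕ → ℕ → ℝ} {u v : ℕ → ℝ}
    (h : Matched K K W (fun i j => d i j - u i - v j) p q)
    (hfeas : ∀ i < K, ∀ j < K, W i j → 0 ≤ d i j - u i - v j) :
    IsPerfect K W q ∧ ∀ π, IsPerfect K W π →
      ∑ i ∈ Finset.range K, d i (q i) ≤ ∑ i ∈ Finset.range K, d i (π i) := by
  have hq : IsPerfect K W q := ⟨fun i hi => (h.row i hi).1, fun i hi j hj => h.inj hi hj,
    fun i hi => (h.row i hi).2.1⟩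
  have hsum : ∀ π, IsPerfect K W π → ∑ i ∈ Finset.range K, v (π i) = ∑ i ∈ Finset.range K, v i := by
    intro π hπ
    have h1 : (Finset.range K).image π = Finset.range K := by
      refine Finset.eq_of_subset_of_card_le (fun j hj => ?_) ?_
      · obtain ⟨i, hi, rfl⟩ := Finset.mem_image.1 hj
        exact Finset.mem_range.2 (hπ.lt i (Finset.mem_range.1 hi))
      · rw [Finset.card_image_of_injOn]
        intro i hi j hj hij
        exact hπ.inj i (by simpa using hi) j (by simpa using hj) hij
    conv_rhs => rw [← h1]
    rw [Finset.sum_image]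
    intro i hi j hj hij
    exact hπ.inj i (by simpa using hi) j (by simpa using hj) hij
  refine ⟨hq, fun π hπ => ?_⟩
  calc ∑ i ∈ Finset.range K, d i (q i) = ∑ i ∈ Finset.range K, (u i + v (q i)) := by
        refine Finset.sum_congr rfl fun i hi => ?_
        have := (h.row i (Finset.mem_range.1 hi)).2.2.1
        linarith
    _ = ∑ i ∈ Finset.range K, (u i + v (π i)) := by
        rw [Finset.sum_add_distrib, Finset.sum_add_distrib, hsum q hq, hsum π hπ]
    _ ≤ _ := by
        refine Finset.sum_le_sum fun i hi => ?_
        have hi := Finset.mem_range.1 hi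
        have := hfeas i hi (π i) (hπ.lt i hi) (hπ.mem i hi)
        linarith

end

/-! ### The Hungarian method: the program

The size of the problem is the variable `16`, the allowed pairs are marked in natural array `3`,
and the costs are in real array `1`. The result is in the natural arrays `4` (rows of the columns,
shifted by one) and `5` (columns of the rows). -/

namespace Hungarian

/-- Clear the marks of the rows and of the columns. -/
def clear : Prog :=
  .forLoop 13 (.var 16) (.seq (.setNat 7 (.const 0) (.var 13) (.const 0))
    (.seq (.setNat 8 (.const 0) (.var 13) (.const 0))
      (.setNat 9 (.const 0) (.var 13) (.const 0))))

/-- The slack of row `11` and column `13`. -/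
abbrev slackExp : RExp :=
  .sub (.sub (.load 1 (.var 11) (.var 13)) (.arr 2 (.var 11))) (.arr 3 (.var 13))

/-- Update the minimal slacks of the columns with row `11`. -/
def relax : Prog :=
  .forLoop 13 (.var 16)
    (.branch (.and (.not (.natEq (.arr 8 (.var 13)) (.const 1)))
        (.natEq (.load 3 (.var 11) (.var 13)) (.const 1)))
      (.branch (.and (.natEq (.arr 9 (.var 13)) (.const 1))
          (.not (.realLt slackExp (.arr 4 (.var 13)))))
        .skip
        (.seq (.setReal 4 (.const 0) (.var 13) slackExp)
          (.seq (.setNat 6 (.const 0) (.var 13) (.var 11))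
            (.setNat 9 (.const 0) (.var 13) (.const 1)))))
      .skip)

/-- Find the column `14` of minimal slack. -/
def findMin : Prog :=
  .seq (.assign 15 (.const 0)) (.forLoop 13 (.var 16)
    (.branch (.and (.and (.not (.natEq (.arr 8 (.var 13)) (.const 1)))
          (.natEq (.arr 9 (.var 13)) (.const 1)))
        (.not (.and (.natEq (.var 15) (.const 1))
          (.not (.realLt (.arr 4 (.var 13)) (.arr 4 (.var 14)))))))
      (.seq (.assign 14 (.var 13)) (.assign 15 (.const 1)))
      .skip))

/-- Change the potentials by the minimal slack. -/
def shift : Prog :=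
  .seq (.setReal 5 (.const 0) (.const 0) (.arr 4 (.var 14))) (.forLoop 13 (.var 16)
    (.seq
      (.branch (.natEq (.arr 7 (.var 13)) (.const 1))
        (.setReal 2 (.const 0) (.var 13) (.add (.arr 2 (.var 13)) (.arr 5 (.const 0)))) .skip)
      (.branch (.natEq (.arr 8 (.var 13)) (.const 1))
        (.setReal 3 (.const 0) (.var 13) (.sub (.arr 3 (.var 13)) (.arr 5 (.const 0))))
        (.setReal 4 (.const 0) (.var 13) (.sub (.arr 4 (.var 13)) (.arr 5 (.const 0)))))))

/-- Stop at column `14` if it is free, and visit it and its row otherwise. -/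
def visit : Prog :=
  .branch (.natEq (.arr 4 (.var 14)) (.const 0))
    (.assign 12 (.const 0))
    (.seq (.setNat 8 (.const 0) (.var 14) (.const 1))
      (.seq (.assign 11 (.sub (.arr 4 (.var 14)) (.const 1)))
        (.setNat 7 (.const 0) (.var 11) (.const 1))))

/-- Search an augmenting path from row `10`. -/
def search : Prog :=
  .seq (.assign 11 (.var 10)) (.seq (.setNat 7 (.const 0) (.var 11) (.const 1))
    (.seq (.assign 12 (.const 1)) (.loop (.natEq (.var 12) (.const 1))
      (.seq relax (.seq findMin (.seq shift visit))))))

/-- Augment the matching along the path that ends in column `14`. -/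
def augment : Prog :=
  .seq (.assign 12 (.const 1)) (.loop (.natEq (.var 12) (.const 1))
    (.seq (.assign 11 (.arr 6 (.var 14))) (.seq (.assign 17 (.arr 5 (.var 11)))
      (.seq (.setNat 4 (.const 0) (.var 14) (.add (.var 11) (.const 1)))
        (.seq (.setNat 5 (.const 0) (.var 11) (.var 14)) (.seq (.assign 14 (.var 17))
          (.branch (.natEq (.var 11) (.var 10)) (.assign 12 (.const 0)) .skip)))))))

/-- The Hungarian method. -/
def main : Prog := .forLoop 10 (.var 16) (.seq clear (.seq search augment))

/-! ### Correctness of the subroutines of the Hungarian method. -/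

/-- The allowed pairs. -/
abbrev allowed (m : Mem) (i j : ℕ) : Prop := m.nat 3 i j = 1

/-- The slack of a row and a column. -/
abbrev slack (m : Mem) (i j : ℕ) : ℝ := m.real 1 i j - m.real 2 0 i - m.real 3 0 j

theorem allowed_congr {m m' : Mem} (h : m'.nat 3 = m.nat 3) : allowed m' = allowed m := by
  funext i j
  rw [allowed, h]

theorem slack_congr {m m' : Mem} (h1 : m'.real 1 = m.real 1) (h2 : m'.real 2 = m.real 2)
    (h3 : m'.real 3 = m.real 3) : slack m' = slack m := by
  funext i j
  rw [slack, h1, h2, h3]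

@[simp] theorem allowed_setNat {m : Mem} {a i j x : ℕ} (h : 3 ≠ a) :
    allowed (m.setNat a i j x) = allowed m := allowed_congr (by funext; simp [h])

@[simp] theorem slack_setNat {m : Mem} {a i j x : ℕ} : slack (m.setNat a i j x) = slack m := rfl

variable {K B : ℕ} {m : Mem}

theorem clear_total (hB : B ≤ K) (hm : m.nat 16 0 0 = B) :
    Total K clear m fun m' => ∀ j < B, m'.nat 7 0 j = 0 ∧ m'.nat 8 0 j = 0 ∧ m'.nat 9 0 j = 0 := by
  refine Total.forLoop B
    (fun t m' => ∀ j < t, m'.nat 7 0 j = 0 ∧ m'.nat 8 0 j = 0 ∧ m'.nat 9 0 j = 0)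
    hB (by decide) (fun m' hf => ?_) ?_ (by simp) ?_ fun m' _ h => h
  · simp [hf.nat 16 (by decide), hm]
  · intro i x m' h j hj
    simpa using h j hj
  · intro i m' hi hf hk h
    refine Total.seq (Total.setNat (Total.seq (Total.setNat (Total.setNat ?_))))
    intro j hj
    by_cases hji : j = i
    · simp [hk, hji]
    · have := h j (by omega)
      simp [hk, hji, this]

theorem relax_total {R R' : ℕ → Prop} (hB : B ≤ K) (hm : m.nat 16 0 0 = B)
    (hR : ∀ i, R' i ↔ R i ∨ i = m.nat 11 0 0)
    (hc : ∀ j < B, m.nat 8 0 j ≠ 1 →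
      ColMin R (allowed m) (slack m) (m.real 4 0) (m.nat 6 0) (m.nat 9 0) j) :
    Total K relax m fun m' => (∀ j < B, m.nat 8 0 j = 1 → m'.nat 6 0 j = m.nat 6 0 j) ∧
      ∀ j < B, m.nat 8 0 j ≠ 1 →
        ColMin R' (allowed m) (slack m) (m'.real 4 0) (m'.nat 6 0) (m'.nat 9 0) j := by
  -- Columns below `t` are finished and the others still hold their original values, as
  -- `ColMin.relax` requires. In visited columns `way` must not change, because the tree is stored
  -- there.
  refine Total.forLoop B
    (fun t m' => (∀ j < B, m.nat 8 0 j = 1 → m'.nat 6 0 j = m.nat 6 0 j) ∧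
      ∀ j < B, m.nat 8 0 j ≠ 1 →
        (j < t → ColMin R' (allowed m) (slack m) (m'.real 4 0) (m'.nat 6 0) (m'.nat 9 0) j) ∧
        (t ≤ j → m'.real 4 0 j = m.real 4 0 j ∧ m'.nat 6 0 j = m.nat 6 0 j ∧
          m'.nat 9 0 j = m.nat 9 0 j))
    hB (by decide) (fun m' hf => ?_) ?_ ?_ ?_ ?_
  · simp [hf.nat 16 (by decide), hm]
  · intro i x m' h
    simp only [Mem.setNat_nat, Mem.setNat_real]
    refine ⟨fun j hj hu => by simpa using h.1 j hj hu, fun j hj hu => ?_⟩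
    obtain ⟨h1, h2⟩ := h.2 j hj hu
    exact ⟨fun h3 => ⟨fun h4 => by simpa using (h1 h3).some (by simpa using h4),
      fun h4 => (h1 h3).none (by simpa using h4)⟩, fun h3 => by simpa using h2 h3⟩
  · simp
  · intro t m' ht hf hk h
    have e1 := hf.real 1 (by decide)
    have e2 := hf.real 2 (by decide)
    have e3 := hf.real 3 (by decide)
    have e4 := hf.nat 3 (by decide)
    have e5 := hf.nat 8 (by decide)
    have e6 := hf.nat 11 (by decide)
    have hstep : ∀ m'' : Mem, (∀ j ≠ t, m''.real 4 0 j = m'.real 4 0 j ∧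
        m''.nat 6 0 j = m'.nat 6 0 j ∧ m''.nat 9 0 j = m'.nat 9 0 j) →
        (m.nat 8 0 t = 1 → m''.nat 6 0 t = m'.nat 6 0 t) →
        (m.nat 8 0 t ≠ 1 →
          ColMin R' (allowed m) (slack m) (m''.real 4 0) (m''.nat 6 0) (m''.nat 9 0) t) →
        (∀ j < B, m.nat 8 0 j = 1 → m''.nat 6 0 j = m.nat 6 0 j) ∧
        ∀ j < B, m.nat 8 0 j ≠ 1 →
        (j < t + 1 → ColMin R' (allowed m) (slack m) (m''.real 4 0) (m''.nat 6 0) (m''.nat 9 0) j) ∧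
        (t + 1 ≤ j → m''.real 4 0 j = m.real 4 0 j ∧ m''.nat 6 0 j = m.nat 6 0 j ∧
          m''.nat 9 0 j = m.nat 9 0 j) := by
      intro m'' h1 h2 h3
      refine ⟨fun j hj hu => ?_, fun j hj hu => ⟨fun hjt => ?_, fun hjt => ?_⟩⟩
      · by_cases hjt : j = t
        · subst hjt; rw [h2 hu, h.1 j hj hu]
        · rw [(h1 j hjt).2.1, h.1 j hj hu]
      · by_cases hjt' : j = t
        · subst hjt'; exact h3 hu
        · have h4 := (h.2 j hj hu).1 (by omega)
          obtain ⟨h5, h6, h7⟩ := h1 j hjt'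
          exact ⟨fun h8 => by rw [h5, h6]; exact h4.some (by rw [← h7]; exact h8),
            fun h8 => h4.none (by rw [← h7]; exact h8)⟩
      · have h4 := (h.2 j hj hu).2 (by omega)
        obtain ⟨h5, h6, h7⟩ := h1 j (by omega)
        rw [h5, h6, h7]; exact h4
    have hsame : (m.nat 8 0 t ≠ 1 → ¬ (allowed m (m.nat 11 0 0) t ∧ (m.nat 9 0 t = 1 →
        slack m (m.nat 11 0 0) t < m.real 4 0 t))) →
        Total K .skip m' fun m'' => (∀ j < B, m.nat 8 0 j = 1 → m''.nat 6 0 j = m.nat 6 0 j) ∧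
        ∀ j < B, m.nat 8 0 j ≠ 1 →
        (j < t + 1 → ColMin R' (allowed m) (slack m) (m''.real 4 0) (m''.nat 6 0) (m''.nat 9 0) j) ∧
        (t + 1 ≤ j → m''.real 4 0 j = m.real 4 0 j ∧ m''.nat 6 0 j = m.nat 6 0 j ∧
          m''.nat 9 0 j = m.nat 9 0 j) := by
      intro hno
      refine Total.skip (hstep m' (fun j _ => ⟨rfl, rfl, rfl⟩) (fun _ => rfl) fun hu => ?_)
      exact (hc t ht hu).relax hR (fun h1 h2 => absurd ⟨h1, h2⟩ (hno hu))
        fun _ => (h.2 t ht hu).2 le_rfl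
    refine Total.branch (fun hb => ?_) (fun hb => ?_)
    · simp only [BExp.Holds, NExp.eval, hk, e4, e5, e6] at hb
      have e7 := (h.2 t ht hb.1).2 le_rfl
      refine Total.branch (fun hb' => ?_) (fun hb' => ?_)
      · simp only [BExp.Holds, NExp.eval, RExp.eval, hk, e1, e2, e3, e6, e7] at hb'
        exact hsame fun _ h1 => hb'.2 (h1.2 hb'.1)
      · simp only [BExp.Holds, NExp.eval, RExp.eval, hk, e1, e2, e3, e6, e7] at hb'
        refine Total.seq (Total.setReal (Total.seq (Total.setNat (Total.setNat ?_))))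
        refine hstep _ (fun j hj => by simp [hk, hj]) (fun h1 => absurd h1 hb.1) fun hu => ?_
        refine (hc t ht hu).relax hR (fun h1 h2 => ?_) fun h1 => ?_
        · simp [hk, e1, e2, e3, e6]
        · refine absurd ⟨hb.2, fun h2 => ?_⟩ h1
          by_contra h3
          exact hb' ⟨h2, h3⟩
    · simp only [BExp.Holds, NExp.eval, hk, e4, e5, e6] at hb
      exact hsame fun hu h1 => hb ⟨hu, h1.1⟩
  · intro m' hf h
    exact ⟨h.1, fun j hj hu => (h.2 j hj hu).1 hj⟩

theorem findMin_total (hB : B ≤ K) (hm : m.nat 16 0 0 = B)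
    (hex : ∃ j < B, m.nat 8 0 j ≠ 1 ∧ m.nat 9 0 j = 1) :
    Total K findMin m fun m' => m'.nat 14 0 0 < B ∧ m.nat 8 0 (m'.nat 14 0 0) ≠ 1 ∧
      m.nat 9 0 (m'.nat 14 0 0) = 1 ∧ ∀ j < B, m.nat 8 0 j ≠ 1 → m.nat 9 0 j = 1 →
        m.real 4 0 (m'.nat 14 0 0) ≤ m.real 4 0 j := by
  refine Total.seq (Total.setNat ?_)
  -- Variable `15` tells whether variable `14` holds a candidate, since no value of `14` is reserved
  -- for this.
  refine Total.forLoop B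
    (fun t m' => (m'.nat 15 0 0 = 1 → m'.nat 14 0 0 < B ∧ m.nat 8 0 (m'.nat 14 0 0) ≠ 1 ∧
      m.nat 9 0 (m'.nat 14 0 0) = 1) ∧ ∀ j < t, m.nat 8 0 j ≠ 1 → m.nat 9 0 j = 1 →
        m'.nat 15 0 0 = 1 ∧ m.real 4 0 (m'.nat 14 0 0) ≤ m.real 4 0 j)
    hB (by decide) (fun m' hf => ?_) ?_ ?_ ?_ ?_
  · simp [hf.nat 16 (by decide), hm]
  · intro i x m' h
    simpa using h
  · simp
  · intro t m' ht hf hk h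
    have e1 := hf.real 4 (by decide)
    have e2 : m'.nat 8 0 = m.nat 8 0 := by rw [hf.nat 8 (by decide)]; funext; simp
    have e3 : m'.nat 9 0 = m.nat 9 0 := by rw [hf.nat 9 (by decide)]; funext; simp
    simp only [Mem.setNat_real] at e1
    refine Total.branch (fun hb => ?_) (fun hb => ?_)
    · simp only [BExp.Holds, NExp.eval, RExp.eval, hk, e1, e2, e3] at hb
      refine Total.seq (Total.setNat (Total.setNat ?_))
      simp [hk]
      refine ⟨⟨ht, hb.1⟩, fun j hj hu hfj => ?_⟩
      by_cases hjt : j = t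
      · rw [hjt]
      · obtain ⟨h1, h2⟩ := h.2 j (by omega) hu hfj
        have := hb.2
        push Not at this
        exact (this h1).le.trans h2
    · simp only [BExp.Holds, NExp.eval, RExp.eval, hk, e1, e2, e3] at hb
      refine Total.skip ⟨h.1, fun j hj hu hfj => ?_⟩
      by_cases hjt : j = t
      · subst hjt
        push Not at hb
        exact hb ⟨hu, hfj⟩
      · exact h.2 j (by omega) hu hfj
  · intro m' hf h
    obtain ⟨j, hj, hu, hfj⟩ := hex
    obtain ⟨h1, h2, h3⟩ := h.1 (h.2 j hj hu hfj).1
    exact ⟨h1, h2, h3, fun j hj hu hfj => (h.2 j hj hu hfj).2⟩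

theorem shift_total (hB : B ≤ K) (hm : m.nat 16 0 0 = B) :
    Total K shift m fun m' => (∀ i < B, m'.real 2 0 i =
        m.real 2 0 i + if m.nat 7 0 i = 1 then m.real 4 0 (m.nat 14 0 0) else 0) ∧
      (∀ j < B, m'.real 3 0 j =
        m.real 3 0 j - if m.nat 8 0 j = 1 then m.real 4 0 (m.nat 14 0 0) else 0) ∧
      ∀ j < B, m.nat 8 0 j ≠ 1 → m'.real 4 0 j = m.real 4 0 j - m.real 4 0 (m.nat 14 0 0) := by
  -- The shift is saved in real array `5` because the loop also changes the cell of array `4` it was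
  -- read from.
  refine Total.seq (Total.setReal ?_)
  refine Total.forLoop B
    (fun t m' => (∀ i, m'.real 2 0 i =
        m.real 2 0 i + if i < t ∧ m.nat 7 0 i = 1 then m.real 4 0 (m.nat 14 0 0) else 0) ∧
      (∀ j, m'.real 3 0 j =
        m.real 3 0 j - if j < t ∧ m.nat 8 0 j = 1 then m.real 4 0 (m.nat 14 0 0) else 0) ∧
      ∀ j, m'.real 4 0 j =
        m.real 4 0 j - if j < t ∧ m.nat 8 0 j ≠ 1 then m.real 4 0 (m.nat 14 0 0) else 0)
    hB (by decide) (fun m' hf => ?_) ?_ ?_ ?_ ?_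
  · simp [hf.nat 16 (by decide), hm]
  · intro i x m' h
    simpa using h
  · simp
  · intro t m' ht hf hk h
    have e1 := hf.real 5 (by decide)
    have e2 := hf.nat 7 (by decide)
    have e3 := hf.nat 8 (by decide)
    have e4 : m'.real 5 0 0 = m.real 4 0 (m.nat 14 0 0) := by rw [e1]; simp
    simp only [Mem.setReal_nat] at e2 e3
    obtain ⟨h1, h2, h3⟩ := h
    have g1 := fun i => h1 i
    refine Total.seq (Total.mono (Q := fun m1 => m1.nat = m'.nat ∧ m1.real 3 = m'.real 3 ∧
      m1.real 4 = m'.real 4 ∧ m1.real 5 = m'.real 5 ∧ ∀ i, m1.real 2 0 i = m.real 2 0 i +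
        if i < t + 1 ∧ m.nat 7 0 i = 1 then m.real 4 0 (m.nat 14 0 0) else 0) ?_ ?_)
    · refine Total.branch (fun hb => ?_) (fun hb => ?_)
      · simp only [BExp.Holds, NExp.eval, hk, e2] at hb
        refine Total.setReal ⟨rfl, rfl, rfl, rfl, fun i => ?_⟩
        by_cases hit : i = t
        · simp [hk, hit, e4, hb, h1]
        · have : i < t + 1 ↔ i < t := by omega
          simp [hk, hit, h1, this]
      · simp only [BExp.Holds, NExp.eval, hk, e2] at hb
        refine Total.skip ⟨rfl, rfl, rfl, rfl, fun i => ?_⟩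
        by_cases hit : i = t
        · simp [hit, hb, h1]
        · have : i < t + 1 ↔ i < t := by omega
          simp [h1, this]
    · rintro m1 - ⟨f1, f2, f3, f4, f5⟩
      refine Total.branch (fun hb => ?_) (fun hb => ?_)
      · simp only [BExp.Holds, NExp.eval, f1, hk, e3] at hb
        refine Total.setReal ⟨fun i => by simpa using f5 i, fun j => ?_, fun j => ?_⟩
        · by_cases hit : j = t
          · simp [f1, f2, f4, hk, hit, e4, hb, h2]
          · have : j < t + 1 ↔ j < t := by omega
            simp [f1, f2, hk, hit, h2, this]
        · by_cases hit : j = t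
          · simp [f3, hit, hb, h3]
          · have : j < t + 1 ↔ j < t := by omega
            simp [f3, h3, this]
      · simp only [BExp.Holds, NExp.eval, f1, hk, e3] at hb
        refine Total.setReal ⟨fun i => by simpa using f5 i, fun j => ?_, fun j => ?_⟩
        · by_cases hit : j = t
          · simp [f2, hit, hb, h2]
          · have : j < t + 1 ↔ j < t := by omega
            simp [f2, h2, this]
        · by_cases hit : j = t
          · simp [f1, f3, f4, hk, hit, e4, hb, h3]
          · have : j < t + 1 ↔ j < t := by omega
            simp [f1, f3, hk, hit, h3, this]
  · rintro m' hf ⟨h1, h2, h3⟩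
    refine ⟨fun i hi => by simpa [hi] using h1 i, fun j hj => by simpa [hj] using h2 j,
      fun j hj hu => by simpa [hj, hu] using h3 j⟩

end Hungarian

/-! ### Correctness of the search, the augmentation and the whole method. -/

namespace Hungarian

variable {K B : ℕ} {m : Mem}

/-- The state of the search after `k` rounds, described in terms of the memory. -/
abbrev SearchAt (B k : ℕ) (g : Prop) (m : Mem) (ord : ℕ → ℕ) : Prop :=
  Search B (m.nat 10 0 0) k g (allowed m) (slack m) (m.nat 4 0) (m.nat 5 0) (m.nat 6 0) (m.nat 7 0)
    (m.nat 8 0) ord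

/-- An augmenting path to the free column `14` has been found. -/
def Found (B : ℕ) (m : Mem) : Prop :=
  ∃ k ord, SearchAt B k True m ord ∧ m.nat 14 0 0 < B ∧ m.nat 8 0 (m.nat 14 0 0) ≠ 1 ∧
    m.nat 6 0 (m.nat 14 0 0) ≤ m.nat 10 0 0 ∧ m.nat 7 0 (m.nat 6 0 (m.nat 14 0 0)) = 1 ∧
    allowed m (m.nat 6 0 (m.nat 14 0 0)) (m.nat 14 0 0) ∧
    slack m (m.nat 6 0 (m.nat 14 0 0)) (m.nat 14 0 0) = 0 ∧ m.nat 4 0 (m.nat 14 0 0) = 0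

/-- The search goes on with row `11`. -/
def Searching (B k : ℕ) (m : Mem) : Prop :=
  ∃ ord, SearchAt B k (k ≠ 0) m ord ∧ m.nat 11 0 0 < B ∧ m.nat 7 0 (m.nat 11 0 0) = 1 ∧
    ∀ j < B, m.nat 8 0 j ≠ 1 → ColMin (fun i => i < B ∧ m.nat 7 0 i = 1 ∧ i ≠ m.nat 11 0 0)
      (allowed m) (slack m) (m.real 4 0) (m.nat 6 0) (m.nat 9 0) j

theorem round_total (hB : B ≤ K) (hm : m.nat 16 0 0 = B) (h12 : m.nat 12 0 0 = 1) {k : ℕ}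
    (h : Searching B k m) {π : ℕ → ℕ} (hπ : IsPerfect B (allowed m) π) :
    Total K (.seq relax (.seq findMin (.seq shift visit))) m fun m' =>
      (m'.nat 12 0 0 = 1 ∧ Searching B (k + 1) m') ∨ (m'.nat 12 0 0 = 0 ∧ Found B m') := by
  obtain ⟨ord, hs, h11, hu11, hc⟩ := h
  refine Total.seq ((relax_total (R' := fun i => i < B ∧ m.nat 7 0 i = 1) hB hm ?_ hc).mono ?_)
  · intro i
    constructor
    · rintro ⟨h1, h2⟩
      by_cases h3 : i = m.nat 11 0 0
      · exact Or.inr h3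
      · exact Or.inl ⟨h1, h2, h3⟩
    · rintro (⟨h1, h2, -⟩ | rfl)
      · exact ⟨h1, h2⟩
      · exact ⟨h11, hu11⟩
  rintro m1 hf1 ⟨hway, hc1⟩
  have e3 := hf1.nat 3 (by decide)
  have e4 := hf1.nat 4 (by decide)
  have e5 := hf1.nat 5 (by decide)
  have e7 := hf1.nat 7 (by decide)
  have e8 := hf1.nat 8 (by decide)
  have e10 := hf1.nat 10 (by decide)
  have e12 := hf1.nat 12 (by decide)
  have e16 := hf1.nat 16 (by decide)
  have r1 := hf1.real 1 (by decide)
  have r2 := hf1.real 2 (by decide)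
  have r3 := hf1.real 3 (by decide)
  -- Relaxation rewrites `way` in unvisited columns only, so the search tree survives.
  have hs1 : SearchAt B k (k ≠ 0) m1 ord := by
    simp only [SearchAt, allowed_congr e3, slack_congr r1 r2 r3, e4, e5, e7, e8, e10]
    refine ⟨hs.lt, hs.matched, hs.feas, hs.row_iff, hs.col_matched, hs.card, fun j hj hu => ?_⟩
    rw [hway j hj hu]
    exact hs.tree j hj hu
  have hc1' : ∀ j < B, m1.nat 8 0 j ≠ 1 → ColMin (fun i => i < B ∧ m1.nat 7 0 i = 1)
      (allowed m1) (slack m1) (m1.real 4 0) (m1.nat 6 0) (m1.nat 9 0) j := by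
    simpa only [allowed_congr e3, slack_congr r1 r2 r3, e7, e8] using hc1
  have hπ1 : IsPerfect B (allowed m1) π := by simpa only [allowed_congr e3] using hπ
  have h12' : m1.nat 12 0 0 = 1 := by rw [e12, h12]
  have hm1 : m1.nat 16 0 0 = B := by rw [e16, hm]
  clear e3 e4 e5 e7 e8 e10 e12 e16 r1 r2 r3 hc1 hway hf1 hπ hc hs
  refine Total.seq ((findMin_total hB hm1 (hs1.exists_col hc1' hπ1)).mono ?_)
  rintro m2 hf2 ⟨hj1, hj2, hj3, hj4⟩
  have e3 := hf2.nat 3 (by decide)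
  have e4 := hf2.nat 4 (by decide)
  have e5 := hf2.nat 5 (by decide)
  have e6 := hf2.nat 6 (by decide)
  have e7 := hf2.nat 7 (by decide)
  have e8 := hf2.nat 8 (by decide)
  have e9 := hf2.nat 9 (by decide)
  have e10 := hf2.nat 10 (by decide)
  have e12 := hf2.nat 12 (by decide)
  have e16 := hf2.nat 16 (by decide)
  have r1 := hf2.real 1 (by decide)
  have r2 := hf2.real 2 (by decide)
  have r3 := hf2.real 3 (by decide)
  have r4 := hf2.real 4 (by decide)
  refine Total.seq ((shift_total hB (by rw [e16, hm1])).mono ?_)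
  rintro m3 hf3 ⟨hu, hv, hmin⟩
  have g3 := hf3.nat 3 (by decide)
  have g4 := hf3.nat 4 (by decide)
  have g5 := hf3.nat 5 (by decide)
  have g6 := hf3.nat 6 (by decide)
  have g7 := hf3.nat 7 (by decide)
  have g8 := hf3.nat 8 (by decide)
  have g9 := hf3.nat 9 (by decide)
  have g10 := hf3.nat 10 (by decide)
  have g12 := hf3.nat 12 (by decide)
  have g14 := hf3.nat 14 (by decide)
  have q1 := hf3.real 1 (by decide)
  rw [e3] at g3
  rw [e4] at g4
  rw [e5] at g5
  rw [e6] at g6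
  rw [e7] at g7
  rw [e8] at g8
  rw [e9] at g9
  rw [e10] at g10
  rw [e12] at g12
  rw [r1] at q1
  simp only [e7, e8, r2, r3, r4] at hu hv hmin
  obtain ⟨hs3, hc3, hw1, hw2, hw3, hw4⟩ := hs1.update (s' := slack m3) (minv' := m3.real 4 0) hc1'
    hj1 hj2 hj3 hj4 rfl (fun i hi j hj => by simp only [slack, q1, hu i hi, hv j hj]; ring) hmin
  have hs3' : SearchAt B k True m3 ord := by
    simpa only [SearchAt, allowed_congr g3, g4, g5, g6, g7, g8, g10] using hs3
  rw [← g14] at hj1 hj2 hw1 hw2 hw3 hw4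
  rw [← g6] at hw1 hw2 hw3 hw4
  rw [← g7] at hw2
  rw [← g8] at hj2
  rw [← g10] at hw1
  have hw3' : allowed m3 (m3.nat 6 0 (m3.nat 14 0 0)) (m3.nat 14 0 0) := by
    simpa only [allowed, g3] using hw3
  have hc3' : ∀ j < B, m3.nat 8 0 j ≠ 1 → ColMin (fun i => i < B ∧ m3.nat 7 0 i = 1)
      (allowed m3) (slack m3) (m3.real 4 0) (m3.nat 6 0) (m3.nat 9 0) j := by
    simpa only [allowed_congr g3, g6, g7, g8, g9] using hc3
  refine Total.branch (fun hb => ?_) (fun hb => ?_)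
  · simp only [BExp.Holds, NExp.eval] at hb
    refine Total.setNat (Or.inr ⟨by simp, k, ord, ?_⟩)
    simpa [SearchAt] using ⟨hs3', hj1, hj2, hw1, hw2, hw3', hw4, hb⟩
  · simp only [BExp.Holds, NExp.eval] at hb
    refine Total.seq (Total.setNat (Total.seq (Total.setNat (Total.setNat (Or.inl ⟨?_, ?_⟩)))))
    · simp [g12, h12']
    · obtain ⟨h1, h2, h3, h4⟩ := hs3'.advance
        (ur' := fun i => if i = m3.nat 4 0 (m3.nat 14 0 0) - 1 then 1 else m3.nat 7 0 i)
        (uc' := fun j => if j = m3.nat 14 0 0 then 1 else m3.nat 8 0 j)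
        (ord' := fun j => if j = m3.nat 14 0 0 then k else ord j)
        hc3' hj1 hj2 hw1 hw2 hw3' hw4 hb (fun _ => rfl) (fun _ => rfl) (fun _ => rfl)
      refine ⟨fun j => if j = m3.nat 14 0 0 then k else ord j, ?_, ?_, ?_, ?_⟩
      · simpa [SearchAt] using h1
      · have := hs3'.lt
        simp
        omega
      · simp
      · simpa using h4

theorem search_total (hB : B ≤ K) (hm : m.nat 16 0 0 = B) (hr : m.nat 10 0 0 < B)
    (hM : Matched B (m.nat 10 0 0) (allowed m) (slack m) (m.nat 4 0) (m.nat 5 0))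
    (hfeas : ∀ i < m.nat 10 0 0, ∀ j < B, allowed m i j → 0 ≤ slack m i j)
    (hclear : ∀ j < B, m.nat 7 0 j = 0 ∧ m.nat 8 0 j = 0 ∧ m.nat 9 0 j = 0)
    {π : ℕ → ℕ} (hπ : IsPerfect B (allowed m) π) : Total K search m (Found B) := by
  refine Total.seq (Total.setNat (Total.seq (Total.setNat (Total.seq (Total.setNat ?_)))))
  -- The flag `12` decides between a running search and a path already found.
  refine Total.loop (fun k m' => (m'.nat 12 0 0 = 1 ∧ Searching B k m') ∨
    (m'.nat 12 0 0 = 0 ∧ Found B m')) (Or.inl ⟨by simp, fun _ => 0, ?_, ?_, ?_, ?_⟩) ?_ ?_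
  · have := hM.search (ur := fun i => if i = m.nat 10 0 0 then 1 else m.nat 7 0 i)
      (uc := m.nat 8 0) (way := m.nat 6 0) (ord := fun _ => 0) hr hfeas ?_ ?_
    · simpa [SearchAt] using this
    · intro i hi
      simp [(hclear i hi).1]
    · intro j hj
      simp [(hclear j hj).2.1]
  · simpa using hr
  · simp
  -- The only visited row is the current one, so no row has been relaxed yet and the cleared flags
  -- are right.
  · intro j hj _
    refine ⟨fun h => ?_, fun _ i hi => ?_⟩
    · simp [(hclear j hj).2.2] at h
    · by_cases h : i = m.nat 10 0 0
      · simp [h] at hi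
      · have h1 := hi.1
        simp [h, (hclear i h1).1] at hi
  · intro k m' hf h hb
    rcases h with ⟨h1, h2⟩ | ⟨h1, -⟩
    -- The round number is the number of visited columns, which `Search.lt_size` keeps below `B`.
    · refine ⟨lt_of_lt_of_le ?_ hB, round_total hB ?_ h1 h2 (π := π) ?_⟩
      · obtain ⟨ord, h3, -⟩ := h2
        exact h3.lt_size
      · simp [hf.nat 16 (by decide), hm]
      · have : allowed m' = allowed m := by
          funext i j
          simp [allowed, hf.nat 3 (by decide)]
        rw [this]; exact hπ
    · simp [h1] at hb
  · intro k m' hf h hb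
    rcases h with ⟨h1, -⟩ | ⟨-, h2⟩
    · simp [h1] at hb
    · exact h2

theorem augment_total (hB : B ≤ K) (h : Found B m) : Total K augment m fun m' =>
    Matched B (m.nat 10 0 0 + 1) (allowed m) (slack m) (m'.nat 4 0) (m'.nat 5 0) := by
  obtain ⟨k, ord, hs, h1, h2, h3, h4, h5, h6, h7⟩ := h
  have ha := hs.augment h1 h2 h3 h4 h5 h6 h7
  have hkB := hs.lt_size
  revert ha
  generalize hord' : (fun j => if j = m.nat 14 0 0 then k else ord j) = ord'
  generalize (fun j => j = m.nat 14 0 0 ∨ (j < B ∧ m.nat 8 0 j = 1)) = G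
  intro ha
  -- The order of the current column starts at `k` and drops in every round, so `t` plus this order
  -- stays at most `k`, which bounds the rounds.
  refine Total.seq (Total.setNat (Total.loop (fun t m' =>
    (m'.nat 12 0 0 = 1 ∧ t + ord' (m'.nat 14 0 0) ≤ k ∧ Augment B (m.nat 10 0 0) (allowed m)
      (slack m) (m'.nat 4 0) (m'.nat 5 0) (m.nat 5 0) (m.nat 6 0) ord' G (m'.nat 14 0 0)) ∨
    (m'.nat 12 0 0 = 0 ∧ Matched B (m.nat 10 0 0 + 1) (allowed m) (slack m) (m'.nat 4 0)
      (m'.nat 5 0))) (Or.inl ⟨by simp, ?_, ?_⟩) ?_ ?_))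
  · simp [← hord']
  · simpa using ha
  · intro t m' hf h hb
    rcases h with ⟨h8, h9, h10⟩ | ⟨h8, -⟩
    · refine ⟨by omega, ?_⟩
      have e6 : m'.nat 6 = m.nat 6 := by
        rw [hf.nat 6 (by decide)]
        funext
        simp
      have e10 : m'.nat 10 = m.nat 10 := by
        rw [hf.nat 10 (by decide)]
        funext
        simp
      refine Total.seq (Total.setNat (Total.seq (Total.setNat (Total.seq (Total.setNat
        (Total.seq (Total.setNat (Total.seq (Total.setNat (Total.branch (fun hc => ?_)
          (fun hc => ?_)))))))))))
      · simp [e6, e10] at hc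
        refine Total.setNat (Or.inr ⟨by simp, ?_⟩)
        exact h10.final hc (by simp [e6]) (by simp [e6])
      · simp [e6, e10] at hc
        obtain ⟨h11, h12⟩ := h10.step hc (p' := fun c => if c = m'.nat 14 0 0 then
            m.nat 6 0 (m'.nat 14 0 0) + 1 else m'.nat 4 0 c) (q' := fun i =>
            if i = m.nat 6 0 (m'.nat 14 0 0) then m'.nat 14 0 0 else m'.nat 5 0 i)
            (fun _ => rfl) (fun _ => rfl)
        refine Total.skip (Or.inl ⟨by simp [h8], ?_, ?_⟩)
        · simp [e6]
          omega
        · simpa [e6] using h11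
    · simp [h8] at hb
  · intro t m' hf h hb
    rcases h with ⟨h8, -⟩ | ⟨-, h8⟩
    · simp [h8] at hb
    · exact h8

/-- The Hungarian method finds a perfect matching along allowed pairs of minimal cost. -/
theorem main_total (hB : B ≤ K) (hm : m.nat 16 0 0 = B) (h4 : ∀ j < B, m.nat 4 0 j = 0)
    {π : ℕ → ℕ} (hπ : IsPerfect B (allowed m) π) : Total K main m fun m' =>
      IsPerfect B (allowed m) (m'.nat 5 0) ∧
      (∀ i < B, m'.nat 4 0 (m'.nat 5 0 i) = i + 1) ∧
      ∀ π, IsPerfect B (allowed m) π → ∑ i ∈ Finset.range B, m.real 1 i (m'.nat 5 0 i) ≤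
        ∑ i ∈ Finset.range B, m.real 1 i (π i) := by
  -- Only rows already inserted must be feasible, so the initial potentials may be arbitrary.
  refine Total.forLoop B (fun r m' => Matched B r (allowed m) (slack m') (m'.nat 4 0) (m'.nat 5 0) ∧
      ∀ i < r, ∀ j < B, allowed m i j → 0 ≤ slack m' i j)
    hB (by decide) (fun m' hf => ?_) ?_ ⟨⟨by simp, fun j hj h => absurd (h4 j hj) h⟩, by simp⟩ ?_ ?_
  · simp [hf.nat 16 (by decide), hm]
  · intro i x m' h
    simpa using h
  · rintro r m' hr hf hk ⟨hM, hfeas⟩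
    have e3 := hf.nat 3 (by decide)
    have e16 := hf.nat 16 (by decide)
    have ea : allowed m' = allowed m := allowed_congr e3
    refine Total.seq ((clear_total hB (by rw [e16, hm])).mono fun m1 hf1 hclear => ?_)
    have g3 := hf1.nat 3 (by decide)
    have g4 := hf1.nat 4 (by decide)
    have g5 := hf1.nat 5 (by decide)
    have g10 := hf1.nat 10 (by decide)
    have g16 := hf1.nat 16 (by decide)
    have r1 := hf1.real 1 (by decide)
    have r2 := hf1.real 2 (by decide)
    have r3 := hf1.real 3 (by decide)
    have es : slack m1 = slack m' := slack_congr r1 r2 r3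
    have ea1 : allowed m1 = allowed m := (allowed_congr g3).trans ea
    have hr1 : m1.nat 10 0 0 = r := by rw [g10, hk]
    refine Total.seq ((search_total hB (by rw [g16, e16, hm]) (by rw [hr1]; exact hr) ?_ ?_ hclear
      (π := π) ?_).mono ?_)
    · rw [hr1, ea1, es, g4, g5]; exact hM
    · rw [hr1, ea1, es]; exact hfeas
    · rw [ea1]; exact hπ
    · intro m2 hf2 hfound
      have k3 := hf2.nat 3 (by decide)
      have k10 := hf2.nat 10 (by decide)
      have ea2 : allowed m2 = allowed m := (allowed_congr k3).trans ea1
      refine (augment_total hB hfound).mono fun m3 hf3 h => ?_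
      obtain ⟨k, ord, hs, -⟩ := hfound
      have l1 := hf3.real 1 (by decide)
      have l2 := hf3.real 2 (by decide)
      have l3 := hf3.real 3 (by decide)
      have es3 : slack m3 = slack m2 := slack_congr l1 l2 l3
      have hr2 : m2.nat 10 0 0 = r := by rw [k10, hr1]
      rw [hr2, ea2, ← es3] at h
      refine ⟨h, fun i hi j hj hW => ?_⟩
      rw [es3]
      exact hs.feas i (by omega) (fun _ => trivial) j hj (by rw [ea2]; exact hW)
  · rintro m' hf ⟨hM, hfeas⟩
    have e1 := hf.real 1 (by decide)
    rw [← e1]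
    obtain ⟨h1, h2⟩ := hM.optimal hfeas
    exact ⟨h1, fun i hi => (hM.row i hi).2.2.2, h2⟩

end Hungarian

/-! ### Assignments as maps -/

theorem row_sum_eq_one_iff {r s : ℕ} (X : Pattern r s) :
    (∀ i, ∑ j, (X i j).toNat = 1) ↔ ∃ f : Fin r → Fin s, ∀ i j, X i j = true ↔ j = f i := by
  have key : ∀ i, ∑ j, (X i j).toNat = (Finset.univ.filter fun j => X i j = true).card := by
    intro i
    rw [Finset.card_filter]
    refine Finset.sum_congr rfl fun j _ => ?_
    cases X i j <;> simp
  simp only [key, Finset.card_eq_one]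
  constructor
  · intro h
    choose f hf using h
    refine ⟨f, fun i j => ?_⟩
    have := Finset.ext_iff.1 (hf i) j
    simpa using this
  · rintro ⟨f, hf⟩ i
    exact ⟨f i, by ext j; simp [hf]⟩

theorem totalCost_eq {r s : ℕ} (c : Matrix (Fin r) (Fin s) ℝ) {X : Pattern r s}
    {f : Fin r → Fin s} (hf : ∀ i j, X i j = true ↔ j = f i) :
    totalCost c X = ∑ i, c i (f i) := by
  refine Finset.sum_congr rfl fun i _ => ?_
  rw [Finset.sum_eq_single (f i)]
  · simp [(hf i (f i)).2 rfl]
  · intro j _ hj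
    have : X i j = false := by
      rw [← Bool.not_eq_true, hf]
      exact hj
    simp [this]
  · simp

/-- The row sums give a map, the column sums another one, and they are inverse to each other. -/
theorem lsapFeasible_iff {N : ℕ} (Z : Pattern N N) :
    LSAPFeasible Z ↔ ∃ σ : Equiv.Perm (Fin N), ∀ i j, Z i j = true ↔ j = σ i := by
  have hcol : (∀ j, ∑ i, (Z i j).toNat = 1) ↔ _ := row_sum_eq_one_iff (fun j i => Z i j)
  rw [LSAPFeasible, row_sum_eq_one_iff, hcol]
  constructor
  · rintro ⟨⟨f, hf⟩, g, hg⟩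
    refine ⟨⟨f, g, fun i => ?_, fun j => ?_⟩, hf⟩
    · exact ((hg _ _).1 ((hf _ _).2 rfl)).symm
    · exact ((hf _ _).1 ((hg _ _).2 rfl)).symm
  · rintro ⟨σ, hσ⟩
    refine ⟨⟨σ, hσ⟩, σ.symm, fun j i => ?_⟩
    rw [hσ, Equiv.eq_symm_apply, eq_comm]

/-- The assignment pattern of a map. -/
def ofMap {r s : ℕ} (f : Fin r → Fin s) : Pattern r s := fun i j => decide (j = f i)

theorem ofMap_eq_true {r s : ℕ} (f : Fin r → Fin s) (i : Fin r) (j : Fin s) :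
    ofMap f i j = true ↔ j = f i := by simp [ofMap]

/-! ### The assignment problem on the machine -/

/-- Declare all pairs allowed, and copy the costs. -/
def lsapInit : Prog :=
  .seq (.assign 16 (.var 0)) (.forLoop 20 (.var 16) (.forLoop 21 (.var 16)
    (.seq (.setNat 3 (.var 20) (.var 21) (.const 1))
      (.setReal 1 (.var 20) (.var 21) (.load 0 (.var 20) (.var 21))))))

/-- Write the assignment. -/
def lsapOutput : Prog :=
  .forLoop 20 (.var 16) (.setNat 2 (.var 20) (.arr 5 (.var 20)) (.const 1))

/-- The program for the assignment problem. -/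
def lsapProg : Prog := .seq lsapInit (.seq Hungarian.main lsapOutput)

theorem lsapInit_total {m : Mem} {N : ℕ} (hN : m.nat 0 0 0 = N) :
    Total N lsapInit m fun m' => m'.nat 16 0 0 = N ∧
      ∀ i < N, ∀ j < N, m'.nat 3 i j = 1 ∧ m'.real 1 i j = m.real 0 i j := by
  refine Total.seq (Total.setNat ?_)
  refine Total.forLoop N
    (fun t m' => ∀ i < t, ∀ j < N, m'.nat 3 i j = 1 ∧ m'.real 1 i j = m.real 0 i j)
    le_rfl (by decide) (fun m' hf => ?_) ?_ (by simp) ?_ ?_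
  · simp [hf.nat 16 (by decide), hN]
  · intro i x m' h
    simpa using h
  · intro t m' ht hf hk h
    refine Total.forLoop N (fun t' m' => ∀ i j, (i < t ∧ j < N) ∨ (i = t ∧ j < t') →
      m'.nat 3 i j = 1 ∧ m'.real 1 i j = m.real 0 i j)
      le_rfl (by decide) (fun m1 hf1 => ?_) ?_ ?_ ?_ ?_
    · simp [hf.nat 16 (by decide), hf1.nat 16 (by decide), hN]
    · intro i x m' h
      simpa using h
    · rintro i j (⟨h1, h2⟩ | h1)
      · exact h i h1 j h2
      · omega
    · intro t' m1 ht' hf1 hk1 h1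
      have e1 : m1.nat 20 0 0 = t := by rw [hf1.nat 20 (by decide), hk]
      have e2 : m1.real 0 = m.real 0 := by
        rw [hf1.real 0 (by decide), hf.real 0 (by decide)]; rfl
      refine Total.seq (Total.setNat (Total.setReal ?_))
      intro i j hij
      simp [e1, hk1, e2]
      by_cases h2 : i = t ∧ j = t'
      · simp [h2]
      · have := h1 i j (by omega)
        simp [h2, this]
    · intro m1 hf1 h1 i hi j hj
      exact h1 i j (by omega)
  · intro m' hf h
    exact ⟨by simp [hf.nat 16 (by decide), hN], h⟩

theorem lsapOutput_total {m : Mem} {N : ℕ} (hN : m.nat 16 0 0 = N)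
    (h2 : ∀ i < N, ∀ j < N, m.nat 2 i j = 0) :
    Total N lsapOutput m fun m' =>
      ∀ i < N, ∀ j < N, m'.nat 2 i j = if j = m.nat 5 0 i then 1 else 0 := by
  refine Total.forLoop N
    (fun t m' => ∀ i < N, ∀ j < N, m'.nat 2 i j = if i < t ∧ j = m.nat 5 0 i then 1 else 0)
    le_rfl (by decide) (fun m' hf => ?_) ?_ (by simpa using h2) ?_ ?_
  · simp [hf.nat 16 (by decide), hN]
  · intro i x m' h
    simpa using h
  · intro t m' ht hf hk h
    refine Total.setNat ?_
    intro i hi j hj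
    simp [hk, hf.nat 5 (by decide)]
    by_cases h1 : i = t
    · subst h1
      by_cases h3 : j = m.nat 5 0 i
      · simp [h3]
      · simp [h3, h i hi j hj]
    · have : i ≤ t ↔ i < t := by omega
      simp [h1, this, h i hi j hj]
  · intro m' hf h i hi j hj
    simpa [hi] using h i hi j hj

theorem lsapProg_total {N : ℕ} (d : Matrix (Fin N) (Fin N) ℝ) :
    Total N lsapProg (lsapInput d) fun m => ∃ Z : Pattern N N, Outputs m Z ∧ LSAPOptimal d Z := by
  refine Total.seq ((lsapInit_total (N := N) (by simp [lsapInput])).mono ?_)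
  rintro m1 hf1 ⟨h16, h1⟩
  -- All pairs are allowed, so every permutation competes, and the identity supplies the perfect
  -- matching that the method presupposes.
  have hperm : ∀ σ : Equiv.Perm (Fin N), IsPerfect N (Hungarian.allowed m1)
      (fun i => if h : i < N then σ ⟨i, h⟩ else 0) := by
    intro σ
    refine ⟨fun i hi => by simp [hi], fun i hi j hj hij => ?_, fun i hi => ?_⟩
    · simpa [hi, hj, Fin.val_inj] using hij
    · simpa [hi] using (h1 i hi _ (σ ⟨i, hi⟩).2).1
  refine Total.seq ((Hungarian.main_total le_rfl h16 ?_ (hperm 1)).mono ?_)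
  · intro j _
    rw [hf1.nat 4 (by decide)]
    simp [lsapInput]
  rintro m2 hf2 ⟨hq, -, hopt⟩
  have e2 : m2.nat 2 = fun _ _ => 0 := by
    rw [hf2.nat 2 (by decide), hf1.nat 2 (by decide)]
    simp [lsapInput]
  have e16 := hf2.nat 16 (by decide)
  refine (lsapOutput_total (by rw [e16, h16]) (by simp [e2])).mono ?_
  intro m3 hf3 h3
  let f : Fin N → Fin N := fun i => ⟨m2.nat 5 0 i, hq.lt i i.2⟩
  have hf : Function.Bijective f := by
    refine Finite.injective_iff_bijective.1 fun i j hij => ?_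
    simp only [f, Fin.mk.injEq] at hij
    exact Fin.ext (hq.inj i i.2 j j.2 hij)
  have hZ : ∀ i j, ofMap f i j = true ↔ j = Equiv.ofBijective f hf i := ofMap_eq_true f
  have hd : ∀ i j : Fin N, m1.real 1 i j = d i j := by
    intro i j
    rw [(h1 i i.2 j j.2).2]
    simp [lsapInput]
  refine ⟨ofMap f, fun i j => ?_, (lsapFeasible_iff _).2 ⟨_, hZ⟩, fun Z' hZ' => ?_⟩
  · rw [h3 i i.2 j j.2]
    have : (j : ℕ) = m2.nat 5 0 i ↔ j = f i := by rw [Fin.ext_iff]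
    by_cases h : j = f i
    · rw [if_pos (this.2 h), (ofMap_eq_true f i j).2 h]; rfl
    · rw [if_neg (fun h' => h (this.1 h'))]
      simp [ofMap, h]
  · obtain ⟨σ, hσ⟩ := (lsapFeasible_iff _).1 hZ'
    rw [totalCost_eq d hZ, totalCost_eq d hσ]
    have := hopt _ (hperm σ)
    rw [Finset.sum_range, Finset.sum_range] at this
    have hfd : ∀ i, d i (f i) = m1.real 1 i (m2.nat 5 0 i) := fun i => (hd i (f i)).symm
    simp only [Equiv.ofBijective_apply, hfd]
    simpa [hd] using this

theorem exists_lsap_program : ∃ (P : Prog) (C : ℕ), ∀ (N : ℕ) (d : Matrix (Fin N) (Fin N) ℝ),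
    ∃ (m : Mem) (t : ℕ) (Z : Pattern N N),
      Exec P (lsapInput d) m t ∧ t ≤ C * (N + 1) ^ 3 ∧ Outputs m Z ∧ LSAPOptimal d Z := by
  obtain ⟨C, hC⟩ := lsapProg.exists_bound_le
  refine ⟨lsapProg, C, fun N d => ?_⟩
  obtain ⟨m, t, he, ht, Z, hZ, hopt⟩ := lsapProg_total d
  -- The loop depth of `lsapProg` evaluates to `3`: rows, search rounds, columns.
  exact ⟨m, t, Z, he, ht.trans (hC N), hZ, hopt⟩

/-! ### Sufficient conditions for structural observability -/

/-- The rank is the distance to `S`. It is used to send every cycle of a permutation towards a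
measured cycle. -/
theorem exists_rank {α : Type*} (R : α → α → Prop) (S : α → Prop)
    (h : ∀ x, ∃ y, Relation.ReflTransGen R x y ∧ S y) :
    ∃ ρ : α → ℕ, (∀ x, ρ x = 0 → S x) ∧ ∀ x t, ρ x = t + 1 → ∃ y, R x y ∧ ρ y = t := by
  classical
  -- `D t x` means that a walk of exactly `t` steps leads from `x` into `S`.
  obtain ⟨D, hD0, hDs⟩ : ∃ D : ℕ → α → Prop, (∀ x, D 0 x ↔ S x) ∧
      ∀ t x, D (t + 1) x ↔ ∃ y, R x y ∧ D t y :=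
    ⟨fun t => Nat.rec (motive := fun _ => α → Prop) S (fun _ D x => ∃ y, R x y ∧ D y) t,
      fun _ => Iff.rfl, fun _ _ => Iff.rfl⟩
  have hD : ∀ x, ∃ t, D t x := by
    intro x
    obtain ⟨y, hxy, hy⟩ := h x
    induction hxy using Relation.ReflTransGen.head_induction_on with
    | refl => exact ⟨0, (hD0 _).2 hy⟩
    | head hab _ ih =>
      obtain ⟨t, ht⟩ := ih
      exact ⟨t + 1, (hDs _ _).2 ⟨_, hab, ht⟩⟩
  refine ⟨fun x => Nat.find (hD x), fun x (hx : Nat.find (hD x) = 0) => ?_,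
    fun x t (hx : Nat.find (hD x) = t + 1) => ?_⟩
  · have := Nat.find_spec (hD x)
    rwa [hx, hD0] at this
  · have h1 := Nat.find_spec (hD x)
    rw [hx, hDs] at h1
    obtain ⟨y, hxy, hy⟩ := h1
    refine ⟨y, hxy, le_antisymm (Nat.find_min' _ hy) ?_⟩
    by_contra! hlt
    have h2 : D (Nat.find (hD y) + 1) x := (hDs _ _).2 ⟨y, hxy, Nat.find_spec (hD y)⟩
    have h3 := Nat.find_min' (hD x) h2
    omega

/-! ### Eigenvectors of weighted cycles joined by single edges. -/

section Cactus

variable {ι : Type*} [Fintype ι] {σ : Equiv.Perm ι} {k : ι → ℝ} {x : ι → ℂ} {μ : ℂ}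

/-- Take moduli in the eigenvector equation and sum over the cycle: `σ` permutes the cycle, so both
sides contain the same positive sum. -/
theorem norm_eq_of_cycle {c : ι} (hk0 : ∀ j, 0 < k j) (hk : ∀ j, σ.SameCycle c j → k j = k c)
    (hx : ∀ j, σ.SameCycle c j → μ * x (σ j) = k j * x j) (hc : x c ≠ 0) : ‖μ‖ = k c := by
  classical
  have h1 : ∑ j with σ.SameCycle c j, ‖x (σ j)‖ = ∑ j with σ.SameCycle c j, ‖x j‖ :=
    Finset.sum_equiv σ (by simp) (by simp)
  have h2 : ‖μ‖ * ∑ j with σ.SameCycle c j, ‖x j‖ = k c * ∑ j with σ.SameCycle c j, ‖x j‖ := by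
    rw [← h1, Finset.mul_sum, h1, Finset.mul_sum]
    refine Finset.sum_congr rfl fun j hj => ?_
    have hj : σ.SameCycle c j := by simpa using hj
    rw [← norm_mul, hx j hj, norm_mul, hk j hj, Complex.norm_real, Real.norm_of_nonneg (hk0 c).le]
  refine mul_right_cancel₀ ?_ h2
  have h3 : 0 < ∑ j with σ.SameCycle c j, ‖x j‖ :=
    Finset.sum_pos' (fun _ _ => norm_nonneg _)
      ⟨c, by simp [Equiv.Perm.SameCycle.refl], norm_pos_iff.2 hc⟩
  exact h3.ne'

/-- A nonzero value travels once around the cycle from `w`; the equation at `w` itself, where an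
edge may enter, is not needed. -/
theorem ne_zero_of_cycle {w : ι} (hk0 : ∀ j, 0 < k j)
    (hx : ∀ j, σ.SameCycle w j → σ j ≠ w → μ * x (σ j) = k j * x j) (hw : x w ≠ 0) {j : ι}
    (hj : σ.SameCycle w j) : x j ≠ 0 := by
  obtain ⟨t, -, -, rfl⟩ := hj.exists_pow_eq''
  clear hj
  induction t with
  | zero => simpa using hw
  | succ t ih =>
    by_cases h : (σ ^ (t + 1)) w = w
    · rwa [h]
    · have h1 : (σ ^ (t + 1)) w = σ ((σ ^ t) w) := by rw [pow_succ', Equiv.Perm.mul_apply]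
      rw [h1] at h ⊢
      have h2 := hx _ (Equiv.Perm.SameCycle.refl σ w).pow_right h
      intro h3
      rw [h3, mul_zero] at h2
      have h4 : (k ((σ ^ t) w) : ℂ) ≠ 0 := by exact_mod_cast (hk0 _).ne'
      exact (mul_ne_zero h4 ih) h2.symm

theorem eq_zero_of_cycle {w : ι} (hμ : μ ≠ 0)
    (hx : ∀ j, σ.SameCycle w j → σ j ≠ w → μ * x (σ j) = k j * x j) (hw : x w = 0) {j : ι}
    (hj : σ.SameCycle w j) : x j = 0 := by
  obtain ⟨t, -, -, rfl⟩ := hj.exists_pow_eq''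
  clear hj
  induction t with
  | zero => simpa using hw
  | succ t ih =>
    by_cases h : (σ ^ (t + 1)) w = w
    · rwa [h]
    · have h1 : (σ ^ (t + 1)) w = σ ((σ ^ t) w) := by rw [pow_succ', Equiv.Perm.mul_apply]
      rw [h1] at h ⊢
      have h2 := hx _ (Equiv.Perm.SameCycle.refl σ w).pow_right h
      rw [ih, mul_zero] at h2
      exact (mul_eq_zero.1 h2).resolve_left hμ

open Classical in
/-- The weighted cycles of `σ`, where `E` links every cycle by one edge to a cycle of lower rank,
have no eigenvector that has a zero on every cycle of rank zero. -/
theorem eq_zero_of_cactus {ρ : ι → ℕ} {E : ι → ι → Prop} (hk0 : ∀ j, 0 < k j)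
    (hk : ∀ i j, k i = k j ↔ σ.SameCycle i j) (hρ : ∀ i j, σ.SameCycle i j → ρ i = ρ j)
    (hE1 : ∀ u w, E u w → ρ u = ρ w + 1)
    (hE2 : ∀ u w u' w', E u w → E u' w' → σ.SameCycle u u' → u = u' ∧ w = w')
    (hE3 : ∀ u, ρ u ≠ 0 → ∃ u' w, σ.SameCycle u u' ∧ E u' w)
    (hx : ∀ j, μ * x (σ j) = k j * x j + ∑ u, if E u (σ j) then x u else 0)
    (h0 : ∀ j, ρ j = 0 → ∃ u, σ.SameCycle j u ∧ x u = 0) : x = 0 := by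
  by_contra hne
  obtain ⟨i, hi⟩ := Function.ne_iff.1 hne
  -- Edges descend in rank, so cycles of the maximal rank in the support receive nothing from
  -- outside.
  obtain ⟨c, hc, hmax⟩ := Finset.exists_max_image (Finset.univ.filter fun j => x j ≠ 0) ρ
    ⟨i, by simpa using hi⟩
  have hc : x c ≠ 0 := by simpa using hc
  have hmax : ∀ j, x j ≠ 0 → ρ j ≤ ρ c := fun j hj => hmax j (by simpa using hj)
  have hσ : ∀ j, ρ (σ j) = ρ j := fun j => (hρ _ _ (Equiv.Perm.SameCycle.refl σ j).apply_right).symm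
  have htop : ∀ j, ρ j = ρ c → μ * x (σ j) = k j * x j := by
    intro j hj
    rw [hx, Finset.sum_eq_zero, add_zero]
    intro u _
    split_ifs with hu
    · by_contra hxu
      have h1 := hmax u hxu
      have h2 := hE1 _ _ hu
      rw [hσ] at h2
      omega
    · rfl
  have hnorm : ‖μ‖ = k c := norm_eq_of_cycle hk0 (fun j hj => ((hk _ _).2 hj).symm)
    (fun j hj => htop j (hρ _ _ hj).symm) hc
  have hμ : μ ≠ 0 := by
    rintro rfl
    rw [norm_zero] at hnorm
    exact (hk0 c).ne hnorm
  -- Cycles have distinct weights, so a second cycle without input cannot have the same `‖μ‖`.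
  have hother : ∀ w, ¬ σ.SameCycle c w → (∀ j, σ.SameCycle w j → μ * x (σ j) = k j * x j) →
      x w = 0 := by
    intro w hcw hw
    by_contra hxw
    have := norm_eq_of_cycle hk0 (fun j hj => ((hk _ _).2 hj).symm) hw hxw
    rw [hnorm, hk] at this
    exact hcw this
  -- At every rank from `ρ c` downwards the support is exactly one whole cycle. At rank zero this
  -- contradicts the zero prescribed there.
  have main : ∀ t ≤ ρ c, ∃ b, ρ b = ρ c - t ∧
      ∀ j, ρ j = ρ c - t → (x j ≠ 0 ↔ σ.SameCycle b j) := by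
    intro t
    induction t with
    | zero =>
      refine fun _ => ⟨c, by simp, fun j hj => ⟨fun h => ?_, fun h => ?_⟩⟩
      · by_contra hcj
        refine h (hother j hcj fun i hi => htop i ?_)
        rw [← hρ _ _ hi]
        simpa using hj
      · exact ne_zero_of_cycle hk0 (fun j hj _ => htop j (hρ _ _ hj).symm) hc h
    | succ t ih =>
      intro ht
      obtain ⟨b, hb, hbj⟩ := ih (by omega)
      obtain ⟨u, w, hbu, huw⟩ := hE3 b (by omega)
      have hxu : x u ≠ 0 := (hbj u (by rw [← hρ _ _ hbu, hb])).2 hbu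
      have hρw : ρ w = ρ c - (t + 1) := by
        have h1 := hE1 _ _ huw
        have h2 := hρ _ _ hbu
        omega
      have hin : ∀ j, ρ j = ρ c - (t + 1) → σ j ≠ w → μ * x (σ j) = k j * x j := by
        intro j hj hjw
        rw [hx, Finset.sum_eq_zero, add_zero]
        intro u' _
        split_ifs with hu'
        · by_contra hxu'
          have h1 := hE1 _ _ hu'
          rw [hσ, hj] at h1
          have h2 := (hbj u' (by omega)).1 hxu'
          exact hjw (hE2 _ _ _ _ hu' huw (h2.symm.trans hbu)).2
        · rfl
      have hrank : ∀ v j, ρ v = ρ c - (t + 1) → σ.SameCycle v j → ρ j = ρ c - (t + 1) :=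
        fun v j hv hvj => by rw [← hρ _ _ hvj, hv]
      refine ⟨w, hρw, fun j hj => ⟨fun h => ?_, fun h => ?_⟩⟩
      · by_contra hwj
        refine h (hother j (fun h1 => ?_) fun i hi => hin i (hrank j i hj hi) fun h1 => hwj ?_)
        · have := hρ _ _ h1
          omega
        · rw [← h1, Equiv.Perm.sameCycle_apply_left]
          exact hi.symm
      · have hw : ∀ j, σ.SameCycle w j → σ j ≠ w → μ * x (σ j) = k j * x j :=
          fun j hj => hin j (hrank w j hρw hj)
        refine ne_zero_of_cycle hk0 hw (fun hxw => ?_) h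
        -- A zero at the entry `w` would spread to its predecessor on the cycle, and the equation at
        -- `w` would leave only the input `x u`, which is nonzero.
        have h1 : x (σ.symm w) = 0 := eq_zero_of_cycle hμ hw hxw
          (Equiv.Perm.SameCycle.refl σ w).symm_apply_right
        have h2 := hx (σ.symm w)
        rw [Equiv.apply_symm_apply, hxw, h1, mul_zero, mul_zero, zero_add,
          Finset.sum_eq_single u, if_pos huw] at h2
        · exact hxu h2.symm
        · intro u' _ hu'
          split_ifs with h3
          · by_contra hxu'
            have h4 := hE1 _ _ h3
            have h5 := (hbj u' (by omega)).1 hxu'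
            exact hu' (hE2 _ _ _ _ h3 huw (h5.symm.trans hbu)).1
          · rfl
        · simp
  obtain ⟨b, hb, hbj⟩ := main (ρ c) le_rfl
  obtain ⟨u, hbu, hu⟩ := h0 b (by omega)
  exact (hbj u (by rw [← hρ _ _ hbu, hb])).2 hbu hu

end Cactus

/-! ### Eigenvector test, Gramian and perturbation of zero entries. -/

/-- The Popov–Belevitch–Hautus test. -/
theorem observable_of_eigenvectors {n N : ℕ} (A : Matrix (Fin n) (Fin n) ℝ)
    (H : Matrix (Fin N) (Fin n) ℝ)
    (h : ∀ (μ : ℂ) (x : Fin n → ℂ), (A.map Complex.ofRealHom).mulVec x = μ • x →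
      (H.map Complex.ofRealHom).mulVec x = 0 → x = 0) : Observable A H := by
  intro x hx
  by_contra hne
  have hn : n ≠ 0 := by
    rintro rfl
    exact hne (Subsingleton.elim _ _)
  -- Cayley–Hamilton: every power of `A` is a combination of the powers below `n`.
  have hall : ∀ k, (H * A ^ k).mulVec x = 0 := by
    intro k
    have hdeg : (Polynomial.X ^ k %ₘ A.charpoly).natDegree < n := by
      have h1 := Polynomial.natDegree_modByMonic_lt (Polynomial.X ^ k) A.charpoly_monic
        (fun h2 => by
          have h3 := A.charpoly_natDegree_eq_dim
          rw [h2, Polynomial.natDegree_one, Fintype.card_fin] at h3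
          exact hn h3.symm)
      rwa [A.charpoly_natDegree_eq_dim, Fintype.card_fin] at h1
    rw [Matrix.pow_eq_aeval_mod_charpoly, Polynomial.aeval_eq_sum_range' hdeg, Matrix.mul_sum,
      Matrix.sum_mulVec]
    refine Finset.sum_eq_zero fun i hi => ?_
    rw [Matrix.mul_smul, Matrix.smul_mulVec, hx i (Finset.mem_range.1 hi), smul_zero]
  let A' := A.map Complex.ofRealHom
  let H' := H.map Complex.ofRealHom
  -- The complex unobservable subspace is nonzero and invariant, hence contains an eigenvector.
  let U : Submodule ℂ (Fin n → ℂ) := ⨅ k : ℕ, LinearMap.ker (H' * A' ^ k).mulVecLin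
  have hU : ∀ y, y ∈ U ↔ ∀ k, (H' * A' ^ k).mulVec y = 0 := by
    intro y
    simp [U, Submodule.mem_iInf]
  let y : Fin n → ℂ := Complex.ofRealHom ∘ x
  have hy : y ∈ U := by
    rw [hU]
    intro k
    have h1 : H' * A' ^ k = (H * A ^ k).map Complex.ofRealHom := by
      simp only [H', A', Matrix.map_mul]
      congr 1
      exact (map_pow (Complex.ofRealHom.mapMatrix) A k).symm
    funext i
    rw [h1, ← RingHom.map_mulVec, hall k]
    simp
  have hy0 : y ≠ 0 := by
    intro h1
    apply hne
    funext i
    have := congrFun h1 i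
    simpa [y] using this
  have hAU : ∀ z ∈ U, A'.mulVecLin z ∈ U := by
    intro z hz
    rw [hU] at hz ⊢
    intro k
    rw [Matrix.mulVecLin_apply, Matrix.mulVec_mulVec, Matrix.mul_assoc, ← pow_succ]
    exact hz (k + 1)
  have : Nontrivial U := ⟨⟨⟨y, hy⟩, 0, fun h1 => hy0 (by simpa using congrArg Subtype.val h1)⟩⟩
  obtain ⟨μ, hμ⟩ := Module.End.exists_eigenvalue (A'.mulVecLin.restrict hAU)
  obtain ⟨z, hz⟩ := hμ.exists_hasEigenvector
  have h1 := hz.apply_eq_smul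
  have h2 : A'.mulVec z = μ • (z : Fin n → ℂ) := by
    simpa using congrArg Subtype.val h1
  have h3 := (hU z).1 z.2 0
  rw [pow_zero, Matrix.mul_one] at h3
  exact hz.2 (Subtype.ext (h μ z h2 h3))

/-- The observability Gramian. -/
def gramian {n N : ℕ} (A : Matrix (Fin n) (Fin n) ℝ) (H : Matrix (Fin N) (Fin n) ℝ) :
    Matrix (Fin n) (Fin n) ℝ :=
  ∑ k ∈ Finset.range n, (H * A ^ k).transpose * (H * A ^ k)

/-- The quadratic form of the Gramian is the sum of the squared outputs. This turns observability
into the nonvanishing of a continuous function of the entries. -/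
theorem observable_iff_det_gramian {n N : ℕ} (A : Matrix (Fin n) (Fin n) ℝ)
    (H : Matrix (Fin N) (Fin n) ℝ) : Observable A H ↔ (gramian A H).det ≠ 0 := by
  have hG : ∀ x, (gramian A H).mulVec x = 0 ↔ ∀ k < n, (H * A ^ k).mulVec x = 0 := by
    intro x
    constructor
    · intro h
      have h1 : ∑ k ∈ Finset.range n, (H * A ^ k).mulVec x ⬝ᵥ (H * A ^ k).mulVec x = 0 := by
        have h2 : x ⬝ᵥ (gramian A H).mulVec x = 0 := by rw [h, dotProduct_zero]
        rw [gramian, Matrix.sum_mulVec, dotProduct_sum] at h2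
        rw [← h2]
        refine Finset.sum_congr rfl fun k _ => ?_
        generalize H * A ^ k = B
        rw [← Matrix.mulVec_mulVec, Matrix.dotProduct_mulVec x, Matrix.vecMul_transpose]
      rw [Finset.sum_eq_zero_iff_of_nonneg] at h1
      · exact fun k hk => dotProduct_self_eq_zero.1 (h1 k (Finset.mem_range.2 hk))
      · exact fun k _ => Finset.sum_nonneg fun i _ => mul_self_nonneg _
    · intro h
      rw [gramian, Matrix.sum_mulVec]
      refine Finset.sum_eq_zero fun k hk => ?_
      rw [← Matrix.mulVec_mulVec, h k (Finset.mem_range.1 hk), Matrix.mulVec_zero]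
  rw [Ne, ← Matrix.exists_mulVec_eq_zero_iff]
  constructor
  · rintro h ⟨x, hx, hx0⟩
    exact hx (h x ((hG x).1 hx0))
  · intro h x hx
    by_contra hne
    exact h ⟨x, hne, (hG x).2 hx⟩

/-- A realization that leaves some permitted entries zero suffices: adding a small `ε ≠ 0` to all
permitted entries makes them nonzero and keeps the Gramian determinant nonzero. -/
theorem structurallyObservable_of_observable {n N : ℕ} {A : Pattern n n} {H : Pattern N n}
    {A' : Matrix (Fin n) (Fin n) ℝ} {H' : Matrix (Fin N) (Fin n) ℝ}
    (hA : ∀ i j, A' i j ≠ 0 → A i j = true) (hH : HasPattern H' H) (h : Observable A' H') :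
    StructurallyObservable A H := by
  let D : Matrix (Fin n) (Fin n) ℝ := Matrix.of fun i j => if A i j = true then 1 else 0
  have hcont : Continuous fun ε : ℝ => (gramian (A' + ε • D) H').det := by
    refine Continuous.matrix_det ?_
    unfold gramian
    fun_prop
  have h1 : ∀ᶠ ε in nhdsWithin (0 : ℝ) {0}ᶜ, (gramian (A' + ε • D) H').det ≠ 0 := by
    refine (hcont.continuousAt.eventually_ne ?_).filter_mono nhdsWithin_le_nhds
    simpa using (observable_iff_det_gramian A' H').1 h
  have h2 : ∀ i j, ∀ᶠ ε in nhdsWithin (0 : ℝ) {0}ᶜ, A i j = true → A' i j + ε ≠ 0 := by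
    intro i j
    by_cases h0 : A' i j = 0
    · filter_upwards [self_mem_nhdsWithin] with ε hε _
      simpa [h0] using hε
    · have : ContinuousAt (fun ε : ℝ => A' i j + ε) 0 := by fun_prop
      filter_upwards [(this.eventually_ne (by simpa using h0)).filter_mono nhdsWithin_le_nhds]
        with ε hε _ using hε
  have h3 : ∀ᶠ ε in nhdsWithin (0 : ℝ) {0}ᶜ, ∀ i j, A i j = true → A' i j + ε ≠ 0 :=
    Filter.eventually_all.2 fun i => Filter.eventually_all.2 fun j => h2 i j
  obtain ⟨ε, hε1, hε2⟩ := (h1.and h3).exists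
  refine ⟨A' + ε • D, H', fun i j => ?_, hH, (observable_iff_det_gramian _ _).2 hε1⟩
  simp only [Matrix.add_apply, Matrix.smul_apply, D, smul_eq_mul, Matrix.of_apply]
  by_cases h4 : A i j = true
  · simpa [h4] using hε2 i j h4
  · have h5 : A' i j = 0 := by
      by_contra h5
      exact h4 (hA i j h5)
    simp [h4, h5]

/-- A system is structurally observable if every state has a path to a measured state, and the
states can be assigned to different successors or agents that measure them. -/
theorem structurallyObservable_of_injective {n N : ℕ} {A : Pattern n n} {H : Pattern N n}
    {s : Fin N → Fin n} (hs : ∀ a l, H a l = true ↔ l = s a) {f : Fin n → Fin n ⊕ Fin N}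
    (hf : Function.Injective f) (hfA : ∀ j i, f j = Sum.inl i → Edge A j i)
    (hfH : ∀ j a, f j = Sum.inr a → s a = j) (hreach : ∀ v, ∃ a, Reach A v (s a)) :
    StructurallyObservable A H := by
  classical
  let p : Fin n → Prop := fun j => ∃ i, f j = Sum.inl i
  let g : {j // p j} → Fin n := fun j => j.2.choose
  have hg : ∀ j : {j // p j}, f j = Sum.inl (g j) := fun j => j.2.choose_spec
  have hginj : Function.Injective g := fun j j' h =>
    Subtype.ext (hf ((hg j).trans ((congrArg Sum.inl h).trans (hg j').symm)))
  -- Complete the partial successor map to a permutation. The added pairs need not be links; they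
  -- receive no cycle weight in `A'`.
  let σ : Equiv.Perm (Fin n) :=
    Equiv.extendSubtype (q := fun x => x ∈ Set.range g) (Equiv.ofInjective g hginj)
  have hσ : ∀ j i, f j = Sum.inl i → σ j = i := by
    intro j i hji
    have hp : p j := ⟨i, hji⟩
    have h1 : σ j = g ⟨j, hp⟩ := Equiv.extendSubtype_apply_of_mem _ j hp
    rw [h1]
    exact Sum.inl_injective ((hg ⟨j, hp⟩).symm.trans hji)
  let S : Setoid (Fin n) := Equiv.Perm.SameCycle.setoid σ
  let π : Fin n → Quotient S := Quotient.mk S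
  have hπ : ∀ i j, π i = π j ↔ σ.SameCycle i j := fun i j => Quotient.eq (r := S)
  -- Distance, counted in cycles of `σ`, to a cycle that contains a measured state; one exit link
  -- per remaining cycle is then selected.
  obtain ⟨ρ, hρ0, hρ1⟩ := exists_rank (fun q q' => ∃ u w, π u = q ∧ π w = q' ∧ Edge A u w)
    (fun q => ∃ a, π (s a) = q) (by
      intro q
      obtain ⟨v, rfl⟩ := Quotient.exists_rep q
      obtain ⟨a, ha⟩ := hreach v
      exact ⟨π (s a), ha.lift π fun u w huw => ⟨u, w, rfl, rfl, huw⟩, a, rfl⟩)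
  have hexit : ∀ q, ∃ u w, ρ q ≠ 0 → π u = q ∧ Edge A u w ∧ ρ q = ρ (π w) + 1 := by
    intro q
    by_cases hq : ρ q = 0
    · obtain ⟨v, -⟩ := Quotient.exists_rep q
      exact ⟨v, v, fun h => absurd hq h⟩
    · obtain ⟨t, ht⟩ := Nat.exists_eq_succ_of_ne_zero hq
      obtain ⟨q', ⟨u, w, h1, h2, h3⟩, h4⟩ := hρ1 q t ht
      exact ⟨u, w, fun _ => ⟨h1, h3, by rw [h2, h4, ht]⟩⟩
  choose U V hUV using hexit
  let E : Fin n → Fin n → Prop := fun u w => ρ (π u) ≠ 0 ∧ u = U (π u) ∧ w = V (π u)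
  -- Numbering the cycles makes the weights distinct, and the added one makes them positive.
  let k : Fin n → ℝ := fun j => ((Fintype.equivFin (Quotient S) (π j) : ℕ) : ℝ) + 1
  have hk0 : ∀ j, 0 < k j := fun j => by positivity
  have hk : ∀ i j, k i = k j ↔ σ.SameCycle i j := by
    intro i j
    rw [← hπ]
    simp [k, Fin.val_inj]
  have hE : ∀ u w, E u w → Edge A u w ∧ ρ (π u) = ρ (π w) + 1 := by
    rintro u w ⟨h1, h2, h3⟩
    obtain ⟨h4, h5, h6⟩ := hUV (π u) h1
    rw [← h2, ← h3] at h5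
    rw [← h3] at h6
    exact ⟨h5, h6⟩
  let A' : Matrix (Fin n) (Fin n) ℝ := Matrix.of fun i j =>
    (if f j = Sum.inl i then k j else 0) + if E j i then 1 else 0
  let H' : Matrix (Fin N) (Fin n) ℝ := Matrix.of fun a l => if l = s a then 1 else 0
  refine structurallyObservable_of_observable (A' := A') (H' := H') ?_ ?_ ?_
  · intro i j hij
    by_cases h1 : f j = Sum.inl i
    · exact hfA j i h1
    · by_cases h2 : E j i
      · exact (hE j i h2).1
      · simp [A', h1, h2] at hij
  · intro a l
    rw [hs]
    by_cases h : l = s a <;> simp [H', h]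
  refine observable_of_eigenvectors A' H' fun μ x hAx hHx => ?_
  have hxs : ∀ a, x (s a) = 0 := by
    intro a
    have h1 := congrFun hHx a
    simpa [Matrix.mulVec, dotProduct, H', apply_ite Complex.ofReal] using h1
  refine eq_zero_of_cactus (σ := σ) (k := k) (μ := μ) (ρ := fun j => ρ (π j)) (E := E) hk0 hk
    (fun i j hij => congrArg ρ ((hπ i j).2 hij)) (fun u w h => (hE u w h).2) ?_ ?_ ?_ ?_
  · rintro u w u' w' ⟨-, h1, h2⟩ ⟨-, h3, h4⟩ h5
    rw [(hπ u u').2 h5] at h1 h2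
    exact ⟨h1.trans h3.symm, h2.trans h4.symm⟩
  · intro u hu
    obtain ⟨h1, h2, h3⟩ := hUV _ hu
    exact ⟨U (π u), V (π u), (hπ _ _).1 h1.symm, by rw [h1]; exact hu, by rw [h1], by rw [h1]⟩
  · intro j
    have h1 := congrFun hAx (σ j)
    rw [Pi.smul_apply, smul_eq_mul] at h1
    rw [← h1]
    simp only [Matrix.mulVec, dotProduct, Matrix.map_apply, A', Matrix.of_apply, map_add, add_mul,
      Finset.sum_add_distrib]
    congr 1
    · rw [Finset.sum_eq_single j]
      · by_cases h2 : p j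
        · obtain ⟨i, hi⟩ := h2
          rw [hσ j i hi, if_pos hi]
          simp
        · rcases h3 : f j with i | a
          · exact absurd ⟨i, h3⟩ h2
          -- A state sent to an agent is measured, so its missing cycle term would vanish anyway.
          · have h4 : x j = 0 := by rw [← hfH j a h3, hxs]
            simp [h4]
      · intro l _ hl
        rw [if_neg]
        · simp
        · intro h2
          exact hl (σ.injective (hσ l _ h2))
      · simp
    · refine Finset.sum_congr rfl fun l _ => ?_
      split_ifs <;> simp
  · intro j hj
    obtain ⟨a, ha⟩ := hρ0 _ hj
    exact ⟨s a, ((hπ _ _).1 ha).symm, hxs a⟩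

/-! ### Alternating paths and Hall's theorem -/

theorem mem_contraction {n : ℕ} {A : Pattern n n} {M : Finset (Fin n × Fin n)} {v k : Fin n} :
    k ∈ contraction A M v ↔ Relation.ReflTransGen (AltStep A M) v k := by
  simp [contraction]

/-- A path that starts in a set and ends outside of it has a step that leaves the set. -/
theorem exists_exit {α : Type*} {R : α → α → Prop} {a b : α} (h : Relation.ReflTransGen R a b)
    {Y : α → Prop} (ha : Y a) (hb : ¬ Y b) :
    ∃ x y, Relation.ReflTransGen R a x ∧ R x y ∧ Y x ∧ ¬ Y y := by
  induction h with
  | refl => exact absurd ha hb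
  | @tail x y hx hxy ih =>
    by_cases hYx : Y x
    · exact ⟨x, y, hx, hxy, hYx, hb⟩
    · exact ih hYx

/-- The nodes of a set `X` can be assigned injectively to neighbours, if every node of `X` left
unmatched by `M` has an alternating path to a private neighbour that `M` does not use, where the
contractions of these nodes are disjoint. -/
theorem exists_injective_of_alternating {n : ℕ} {β : Type*} [Finite β] {A : Pattern n n}
    {M : Finset (Fin n × Fin n)} (hM : IsMatching A M) {X : Fin n → Prop}
    {t : Fin n → Fin n ⊕ β → Prop} (ht : ∀ j i, Edge A j i → t j (Sum.inl i))
    {k : Fin n → Fin n} {e : Fin n → Fin n ⊕ β}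
    (hk : ∀ v, X v → (∀ p ∈ M, p.2 ≠ v) → k v ∈ contraction A M v ∧ t (k v) (e v) ∧
      ∀ p ∈ M, e v ≠ Sum.inl p.1)
    (he : ∀ v w, X v → X w → (∀ p ∈ M, p.2 ≠ v) → (∀ p ∈ M, p.2 ≠ w) → v ≠ w →
      e v ≠ e w ∧ Disjoint (contraction A M v) (contraction A M w)) :
    ∃ f : {j // X j} → Fin n ⊕ β, Function.Injective f ∧ ∀ j : {j // X j}, t j (f j) := by
  classical
  cases nonempty_fintype β
  have hall := (Finset.all_card_le_biUnion_card_iff_exists_injective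
    (fun j : {j // X j} => Finset.univ.filter fun z => t j z)).1 ?_
  · obtain ⟨f, hf, hft⟩ := hall
    exact ⟨f, hf, fun j => by simpa using hft j⟩
  intro Y
  let Y' : Fin n → Prop := fun j => ∃ h : X j, (⟨j, h⟩ : {j // X j}) ∈ Y
  -- For Hall's condition, inject `Y` into its neighbours. A matched node takes its partner. An
  -- unmatched one follows its alternating path: either the path leaves `Y`, and the partner of an
  -- outside node is free to take, or its end `k j` is in `Y` and the private neighbour is
  -- available.
  have hφ : ∀ j : {j // X j}, ∃ z, j ∈ Y → (∃ l, Y' l ∧ t l z) ∧ ((∃ i, z = Sum.inl i ∧ (i, (j : Fin n)) ∈ M) ∨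
      ((∀ p ∈ M, p.2 ≠ (j : Fin n)) ∧ (z = e j ∨ ∃ i k, z = Sum.inl i ∧ (i, k) ∈ M ∧ ¬ Y' k ∧
        k ∈ contraction A M j))) := by
    rintro ⟨j, hj⟩
    by_cases hjY : (⟨j, hj⟩ : {j // X j}) ∈ Y
    swap
    · exact ⟨Sum.inl j, fun h => absurd h hjY⟩
    by_cases hm : ∀ p ∈ M, p.2 ≠ j
    · obtain ⟨h1, h2, h3⟩ := hk j hj hm
      by_cases hkY : Y' (k j)
      · exact ⟨e j, fun _ => ⟨⟨k j, hkY, h2⟩, Or.inr ⟨hm, Or.inl rfl⟩⟩⟩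
      · obtain ⟨x, y, hx, ⟨i, hi1, hi2, hi3⟩, hYx, hYy⟩ :=
          exists_exit (Y := Y') (mem_contraction.1 h1) ⟨hj, hjY⟩ hkY
        exact ⟨Sum.inl i, fun _ => ⟨⟨x, hYx, ht _ _ hi1⟩, Or.inr ⟨hm, Or.inr ⟨i, y, rfl, hi3, hYy,
          mem_contraction.2 (hx.tail ⟨i, hi1, hi2, hi3⟩)⟩⟩⟩⟩
    · push Not at hm
      obtain ⟨⟨i, j'⟩, hp, rfl⟩ := hm
      exact ⟨Sum.inl i, fun _ => ⟨⟨j', ⟨hj, hjY⟩, ht _ _ (hM.1 _ hp)⟩, Or.inl ⟨i, rfl, hp⟩⟩⟩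
  choose φ hφ using hφ
  refine Finset.card_le_card_of_injOn φ ?_ ?_
  · intro j hj
    obtain ⟨⟨l, ⟨hl, hlY⟩, hlt⟩, -⟩ := hφ j hj
    simp only [Finset.coe_biUnion, Set.mem_iUnion, Finset.coe_filter]
    exact ⟨⟨l, hl⟩, hlY, by simpa using hlt⟩
  · intro a ha b hb hab
    obtain ⟨-, h1⟩ := hφ a ha
    obtain ⟨-, h2⟩ := hφ b hb
    have hYa : Y' a := ⟨a.2, ha⟩
    have hYb : Y' b := ⟨b.2, hb⟩
    rw [← hab] at h2
    rcases h1 with ⟨i, hi, hiM⟩ | ⟨hua, h1⟩ <;> rcases h2 with ⟨i', hi', hiM'⟩ | ⟨hub, h2⟩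
    · rw [hi] at hi'
      obtain rfl := Sum.inl_injective hi'
      have := hM.2 _ hiM _ hiM' (Or.inl rfl)
      exact Subtype.ext (congrArg Prod.snd this)
    · rcases h2 with h2 | ⟨i', k', h3, h4, h5, -⟩
      · exact absurd (h2.symm.trans hi) ((hk b b.2 hub).2.2 _ hiM)
      · rw [hi] at h3
        obtain rfl := Sum.inl_injective h3
        have := congrArg Prod.snd (hM.2 _ hiM _ h4 (Or.inl rfl))
        exact absurd (show Y' k' from (show (a : Fin n) = k' from this) ▸ hYa) h5
    · rcases h1 with h2 | ⟨i, k', h3, h4, h5, -⟩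
      · exact absurd (h2.symm.trans hi') ((hk a a.2 hua).2.2 _ hiM')
      · rw [hi'] at h3
        obtain rfl := Sum.inl_injective h3
        have := congrArg Prod.snd (hM.2 _ hiM' _ h4 (Or.inl rfl))
        exact absurd (show Y' k' from (show (b : Fin n) = k' from this) ▸ hYb) h5
    -- Two unmatched nodes could share a value only through a common node of their contractions or
    -- equal private neighbours.
    · by_contra hne
      obtain ⟨h3, h4⟩ := he a b a.2 b.2 hua hub fun h => hne (Subtype.ext h)
      rcases h1 with h1 | ⟨i, x, hi, hiM, -, hx⟩ <;> rcases h2 with h2 | ⟨i', y, hi', hiM', -, hy⟩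
      · exact h3 (h1.symm.trans h2)
      · exact (hk a a.2 hua).2.2 _ hiM' (h1.symm.trans hi')
      · exact (hk b b.2 hub).2.2 _ hiM (h2.symm.trans hi)
      · rw [hi] at hi'
        obtain rfl := Sum.inl_injective hi'
        obtain rfl : x = y := congrArg Prod.snd (hM.2 _ hiM _ hiM' (Or.inl rfl))
        exact Finset.disjoint_left.1 h4 hx hy

theorem IsMatching.card_image_snd {n : ℕ} {A : Pattern n n} {M : Finset (Fin n × Fin n)}
    (hM : IsMatching A M) : (M.image Prod.snd).card = M.card :=
  Finset.card_image_of_injOn fun p hp q hq h => hM.2 p hp q hq (Or.inr h)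

/-- Distinct successors of the nodes of a set form a matching. -/
theorem IsMaximumMatching.card_le {n : ℕ} {A : Pattern n n} {M : Finset (Fin n × Fin n)}
    (hM : IsMaximumMatching A M) {X : Finset (Fin n)} {g : Fin n → Fin n}
    (hg : Set.InjOn g X) (hE : ∀ j ∈ X, Edge A j (g j)) : X.card ≤ M.card := by
  have h1 : (X.image fun j => (g j, j)).card = X.card :=
    Finset.card_image_of_injective _ fun i j h => congrArg Prod.snd h
  rw [← h1]
  refine hM.2 _ ⟨fun p hp => ?_, fun p hp q hq h => ?_⟩
  · obtain ⟨j, hj, rfl⟩ := Finset.mem_image.1 hp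
    exact hE j hj
  · obtain ⟨j, hj, rfl⟩ := Finset.mem_image.1 hp
    obtain ⟨l, hl, rfl⟩ := Finset.mem_image.1 hq
    have : j = l := h.elim (fun h => hg hj hl h) id
    rw [this]

/-- There is no augmenting path for a maximum matching. -/
theorem IsMaximumMatching.exists_mem {n : ℕ} {A : Pattern n n} {M : Finset (Fin n × Fin n)}
    (hM : IsMaximumMatching A M) {v j i : Fin n} (hv : ∀ p ∈ M, p.2 ≠ v)
    (hj : j ∈ contraction A M v) (hji : Edge A j i) :
    ∃ k ∈ contraction A M v, k ≠ v ∧ (i, k) ∈ M := by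
  classical
  by_cases hk : ∃ k, (i, k) ∈ M
  · obtain ⟨k, hk⟩ := hk
    by_cases hij : (i, j) ∈ M
    · exact ⟨j, hj, fun h => hv _ hij h, hij⟩
    · exact ⟨k, mem_contraction.2 ((mem_contraction.1 hj).tail ⟨i, hji, hij, hk⟩), hv _ hk, hk⟩
  -- If `M` does not use `i`, Hall's theorem applies to `v` and all matched nodes, with `i` as the
  -- private neighbour of `v`, and gives a larger matching.
  · exfalso
    have huniq : ∀ w, (w = v ∨ ∃ p ∈ M, p.2 = w) → (∀ p ∈ M, p.2 ≠ w) → w = v := by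
      rintro w (h | ⟨p, hp, h⟩) hw
      · exact h
      · exact absurd h (hw p hp)
    obtain ⟨f, hf, hfE⟩ := exists_injective_of_alternating (β := Empty) hM.1
      (X := fun w => w = v ∨ ∃ p ∈ M, p.2 = w)
      (t := fun j z => Sum.elim (fun i => Edge A j i) (fun _ => False) z) (fun _ _ h => h)
      (k := fun _ => j) (e := fun _ => Sum.inl i)
      (by
        intro w hw hu
        rw [huniq w hw hu]
        refine ⟨hj, hji, fun p hp h => hk ⟨p.2, ?_⟩⟩
        rw [Sum.inl_injective h]
        exact hp)
      (fun w w' hw hw' hu hu' hne => absurd ((huniq w hw hu).trans (huniq w' hw' hu').symm) hne)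
    have hg : ∀ j, ∃ i, ∀ h : (j = v ∨ ∃ p ∈ M, p.2 = j), f ⟨j, h⟩ = Sum.inl i := by
      intro j
      by_cases h : j = v ∨ ∃ p ∈ M, p.2 = j
      · rcases h1 : f ⟨j, h⟩ with i | a
        · exact ⟨i, fun _ => h1⟩
        · exact a.elim
      · exact ⟨j, fun h' => absurd h' h⟩
    choose g hg using hg
    have hX : ∀ j ∈ insert v (M.image Prod.snd), j = v ∨ ∃ p ∈ M, p.2 = j := by
      intro j hj
      simpa using hj
    have h1 := hM.card_le (X := insert v (M.image Prod.snd)) (g := g)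
      (fun a ha b hb hab => by
        have := hf ((hg a (hX a ha)).trans ((congrArg Sum.inl hab).trans (hg b (hX b hb)).symm))
        exact congrArg Subtype.val this)
      (fun j hj => by
        have := hfE ⟨(j : Fin n), hX j hj⟩
        rw [hg j (hX j hj)] at this
        exact this)
    rw [Finset.card_insert_of_notMem, hM.1.card_image_snd] at h1
    · omega
    · intro h2
      obtain ⟨p, hp, h3⟩ := Finset.mem_image.1 h2
      exact hv p hp h3

/-! ### Necessary conditions for structural observability -/

/-- No link leaves a parent SCC, so a unit vector in it evolves inside it and stays invisible if no
agent measures there. -/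
theorem exists_measured_of_parentSCC {n N : ℕ} {A : Pattern n n} {H : Pattern N n}
    (h : StructurallyObservable A H) (S : ParentSCC A) : ∃ a, ∃ l ∈ S.1, H a l = true := by
  classical
  by_contra! hno
  obtain ⟨A', H', hA, hH, hobs⟩ := h
  obtain ⟨v, hv⟩ := S.nonempty
  have key : ∀ k, ∀ i ∉ S.1, (A' ^ k).mulVec (Pi.single v 1) i = 0 := by
    intro k
    induction k with
    | zero =>
      intro i hi
      have : i ≠ v := fun h => hi (h ▸ hv)
      simp [this]
    | succ k ih =>
      intro i hi
      rw [pow_succ', ← Matrix.mulVec_mulVec, Matrix.mulVec, dotProduct]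
      refine Finset.sum_eq_zero fun j _ => ?_
      by_cases hj : j ∈ S.1
      · have : A' i j = 0 := by
          by_contra h1
          exact hi (S.2.2 j hj i ((hA i j).1 h1))
        rw [this, zero_mul]
      · rw [ih j hj, mul_zero]
  have h1 := hobs (Pi.single v 1) fun k _ => by
    rw [← Matrix.mulVec_mulVec]
    funext a
    rw [Matrix.mulVec, dotProduct]
    refine Finset.sum_eq_zero fun j _ => ?_
    by_cases hj : j ∈ S.1
    · have : H' a j = 0 := by
        by_contra h1
        exact hno a j hj ((hH a j).1 h1)
      rw [this, zero_mul]
    · rw [key k j hj, mul_zero]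
  simpa using congrFun h1 v

/-- By `IsMaximumMatching.exists_mem`, every link out of the contraction ends at the `M`-partner of
a node of the contraction other than `v`. So its columns live in one row fewer than their number,
and a kernel vector exists; unmeasured, it would be unobservable. -/
theorem exists_measured_of_unmatched {n N : ℕ} {A : Pattern n n} {H : Pattern N n}
    {M : Finset (Fin n × Fin n)} (hM : IsMaximumMatching A M)
    (h : StructurallyObservable A H) (v : Unmatched M) :
    ∃ a, ∃ l ∈ contraction A M v.1, H a l = true := by
  classical
  by_contra! hno
  obtain ⟨A', H', hA, hH, hobs⟩ := h
  have hvC : v.1 ∈ contraction A M v.1 := mem_contraction.2 Relation.ReflTransGen.refl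
  have hrow : ∀ k : Fin n, ∃ i, (k ∈ contraction A M v.1 ∧ k ≠ v.1) → (i, k) ∈ M := by
    intro k
    by_cases hk : ∃ p ∈ M, p.2 = k
    · obtain ⟨p, hp, rfl⟩ := hk
      exact ⟨p.1, fun _ => hp⟩
    · push Not at hk
      refine ⟨k, ?_⟩
      rintro ⟨h1, h2⟩
      -- A nontrivial alternating path ends with an edge of `M`, so its end is matched.
      rcases (mem_contraction.1 h1).cases_tail with h3 | ⟨x, -, i, -, -, h3⟩
      · exact absurd h3 h2
      · exact absurd rfl (hk _ h3)
  choose row hrow using hrow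
  let B : Matrix {k // k ∈ (contraction A M v.1).erase v.1} {k // k ∈ contraction A M v.1} ℝ :=
    Matrix.of fun k j => A' (row k) j
  have hker : LinearMap.ker B.mulVecLin ≠ ⊥ := by
    refine LinearMap.ker_ne_bot_of_finrank_lt ?_
    simp only [Module.finrank_fintype_fun_eq_card, Fintype.card_coe]
    exact Finset.card_erase_lt_of_mem hvC
  obtain ⟨y, hy, hy0⟩ := (Submodule.ne_bot_iff _).1 hker
  let x : Fin n → ℝ := fun j => if h : j ∈ contraction A M v.1 then y ⟨j, h⟩ else 0
  have hx : ∀ (F : Fin n → ℝ), ∑ j, F j * x j =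
      ∑ j : {k // k ∈ contraction A M v.1}, F j * y j := by
    intro F
    rw [← Finset.sum_subset (Finset.subset_univ (contraction A M v.1)), ← Finset.sum_coe_sort]
    · refine Finset.sum_congr rfl fun j _ => ?_
      simp [x]
    · intro j _ hj
      simp [x, hj]
  have hAx : A'.mulVec x = 0 := by
    funext i
    rw [Matrix.mulVec, dotProduct, hx]
    by_cases hi : ∃ k ∈ contraction A M v.1, k ≠ v.1 ∧ (i, k) ∈ M
    · obtain ⟨k, hk1, hk2, hk3⟩ := hi
      have h1 : row k = i :=
        congrArg Prod.fst (hM.1.2 _ (hrow k ⟨hk1, hk2⟩) _ hk3 (Or.inr rfl))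
      have h2 := congrFun (LinearMap.mem_ker.1 hy) ⟨k, Finset.mem_erase.2 ⟨hk2, hk1⟩⟩
      rw [← h1]
      exact h2
    · refine Finset.sum_eq_zero fun j _ => ?_
      have : A' i j = 0 := by
        by_contra h1
        exact hi (hM.exists_mem v.2 j.2 ((hA _ _).1 h1))
      rw [this, zero_mul]
  have hHx : H'.mulVec x = 0 := by
    funext a
    rw [Matrix.mulVec, dotProduct, hx]
    refine Finset.sum_eq_zero fun j _ => ?_
    have : H' a j = 0 := by
      by_contra h1
      exact hno a j j.2 ((hH _ _).1 h1)
    rw [this, zero_mul]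
  have h1 := hobs x fun k _ => by
    cases k with
    | zero => simpa using hHx
    | succ k => rw [← Matrix.mulVec_mulVec, pow_succ, ← Matrix.mulVec_mulVec, hAx,
        Matrix.mulVec_zero, Matrix.mulVec_zero]
  apply hy0
  funext j
  have := congrFun h1 j
  simpa [x] using this

/-! ### Feasible measurement structures -/

/-- Among the states reachable from `v`, one with the fewest reachable states can be reached back
from each of them. -/
theorem exists_reach_parentSCC {n : ℕ} (A : Pattern n n) (v : Fin n) :
    ∃ S : ParentSCC A, ∀ w ∈ S.1, Reach A v w := by
  classical
  let R : Fin n → Finset (Fin n) := fun u => Finset.univ.filter fun w => Reach A u w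
  have hR : ∀ u w, w ∈ R u ↔ Reach A u w := fun u w => by simp [R]
  obtain ⟨u, hu, hmin⟩ := Finset.exists_min_image (R v) (fun u => (R u).card)
    ⟨v, (hR v v).2 Relation.ReflTransGen.refl⟩
  rw [hR] at hu
  have hback : ∀ w, Reach A u w → Reach A w u := by
    intro w hw
    have h1 : R w ⊆ R u := fun z hz => (hR u z).2 (hw.trans ((hR w z).1 hz))
    have h2 := Finset.eq_of_subset_of_card_le h1 (hmin w ((hR v w).2 (hu.trans hw)))
    rw [← hR, h2, hR]
    exact Relation.ReflTransGen.refl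
  refine ⟨⟨R u, ⟨u, fun w => ?_⟩, fun w hw z hwz => ?_⟩, fun w hw => hu.trans ((hR u w).1 hw)⟩
  · rw [hR]
    exact ⟨fun h => ⟨h, hback w h⟩, fun h => h.1⟩
  · rw [hR] at hw ⊢
    exact hw.tail hwz

theorem ParentSCC.reach_iff {n : ℕ} {A : Pattern n n} (S : ParentSCC A) {v : Fin n} (hv : v ∈ S.1)
    (w : Fin n) : w ∈ S.1 ↔ Reach A v w := by
  obtain ⟨u, hu⟩ := S.2.1
  constructor
  · exact fun hw => ((hu v).1 hv).2.trans ((hu w).1 hw).1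
  · intro h
    induction h with
    | refl => exact hv
    | tail _ h ih => exact S.2.2 _ ih _ h

theorem ParentSCC.disjoint {n : ℕ} {A : Pattern n n} {S T : ParentSCC A} (h : S ≠ T) :
    Disjoint S.1 T.1 := by
  rw [Finset.disjoint_left]
  intro v hS hT
  refine h (Subtype.ext (Finset.ext fun w => ?_))
  rw [S.reach_iff hS, T.reach_iff hT]

section

variable {n N : ℕ} {A : Pattern n n} {M : Finset (Fin n × Fin n)}

/-- Each unmatched node uses the agent that measures in its contraction as private neighbour in
Hall's theorem. The last clause keeps all other agents free; the encoding needs them for the parent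
SCCs. -/
theorem exists_successors (hM : IsMaximumMatching A M)
    (hdisj : Pairwise fun s t => Disjoint (component A M s) (component A M t)) {s : Fin N → Fin n}
    {α : Unmatched M → Fin N} (hα : ∀ v, s (α v) ∈ contraction A M v.1) :
    ∃ f : Fin n → Fin n ⊕ Fin N, Function.Injective f ∧
      (∀ j i, f j = Sum.inl i → Edge A j i) ∧
      ∀ j a, f j = Sum.inr a → s a = j ∧ ∃ v, α v = a := by
  classical
  have hdisj' : ∀ v w : Unmatched M, v ≠ w →
      Disjoint (contraction A M v.1) (contraction A M w.1) := fun v w h =>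
    hdisj (fun h' => h (Sum.inr_injective h') : (Sum.inr v : ParentSCC A ⊕ Unmatched M) ≠ Sum.inr w)
  by_cases hN : Nonempty (Fin N)
  · let a₀ : Fin N := Classical.choice hN
    let β : Fin n → Fin N := fun v => if h : ∀ p ∈ M, p.2 ≠ v then α ⟨v, h⟩ else a₀
    have hβ : ∀ v (h : ∀ p ∈ M, p.2 ≠ v), β v = α ⟨v, h⟩ := fun v h => dif_pos h
    obtain ⟨f, hf, hft⟩ := exists_injective_of_alternating (β := Fin N) hM.1 (X := fun _ => True)
      (t := fun j z => Sum.elim (fun i => Edge A j i) (fun a => s a = j ∧ ∃ v, α v = a) z)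
      (fun _ _ h => h) (k := fun v => s (β v)) (e := fun v => Sum.inr (β v))
      (fun v _ hv => by
        rw [hβ v hv]
        exact ⟨hα ⟨v, hv⟩, ⟨rfl, _, rfl⟩, fun p _ h => by cases h⟩)
      (fun v w _ _ hv hw hne => by
        have h1 := hdisj' ⟨v, hv⟩ ⟨w, hw⟩ fun h => hne (congrArg Subtype.val h)
        refine ⟨fun h2 => ?_, h1⟩
        have h3 := Sum.inr_injective h2
        rw [hβ v hv, hβ w hw] at h3
        have h4 := hα ⟨v, hv⟩
        rw [h3] at h4
        exact Finset.disjoint_left.1 h1 h4 (hα ⟨w, hw⟩))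
    refine ⟨fun j => f ⟨j, trivial⟩, fun i j h => congrArg Subtype.val (hf h),
      fun j i (h : f ⟨j, trivial⟩ = _) => ?_, fun j a (h : f ⟨j, trivial⟩ = _) => ?_⟩
    · have := hft ⟨j, trivial⟩
      rw [h] at this
      exact this
    · have := hft ⟨j, trivial⟩
      rw [h] at this
      exact this
  -- Without agents there is no unmatched node, and `M` itself gives the successors.
  · have hU : ∀ v : Fin n, ¬ ∀ p ∈ M, p.2 ≠ v := fun v hv => hN ⟨α ⟨v, hv⟩⟩
    have : ∀ v : Fin n, ∃ p ∈ M, p.2 = v := fun v => by simpa using hU v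
    choose g hgM hg using this
    refine ⟨fun j => Sum.inl (g j).1, fun i j h => ?_, fun j i h => ?_, fun j a h => by cases h⟩
    · have := hM.1.2 _ (hgM i) _ (hgM j) (Or.inl (Sum.inl_injective h))
      rw [← hg i, ← hg j, this]
    · rw [← Sum.inl_injective h]
      have := hM.1.1 _ (hgM j)
      rwa [hg] at this

/-- Every component needs an agent, disjointness makes these agents distinct, and the numbers agree,
so the choice is a bijection. Conversely, the contractions provide distinct successors and the
parent SCCs provide reachability. -/
theorem sensingFeasible_iff (hM : IsMaximumMatching A M)
    (hdisj : Pairwise fun s t => Disjoint (component A M s) (component A M t))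
    (e : Fin N ≃ ParentSCC A ⊕ Unmatched M) (H : Pattern N n) :
    SensingFeasible A H ↔ ∃ (s : Fin N → Fin n) (σ : Equiv.Perm (Fin N)),
      (∀ a l, H a l = true ↔ l = s a) ∧ ∀ a, s a ∈ component A M (e (σ a)) := by
  rw [SensingFeasible, row_sum_eq_one_iff]
  constructor
  · rintro ⟨hobs, s, hs⟩
    have hg : ∀ t, ∃ a, s a ∈ component A M t := by
      rintro (S | v)
      · obtain ⟨a, l, hl, hal⟩ := exists_measured_of_parentSCC hobs S
        exact ⟨a, (hs a l).1 hal ▸ hl⟩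
      · obtain ⟨a, l, hl, hal⟩ := exists_measured_of_unmatched hM hobs v
        exact ⟨a, (hs a l).1 hal ▸ hl⟩
    choose g hg using hg
    have hinj : Function.Injective (g ∘ e) := by
      intro i j hij
      by_contra hne
      have h1 := hg (e i)
      rw [show g (e i) = g (e j) from hij] at h1
      exact Finset.disjoint_left.1 (hdisj fun h => hne (e.injective h)) h1 (hg (e j))
    let τ := Equiv.ofBijective _ (Finite.injective_iff_bijective.1 hinj)
    refine ⟨s, τ.symm, hs, fun a => ?_⟩
    have h1 := hg (e (τ.symm a))
    rwa [show g (e (τ.symm a)) = a from τ.apply_symm_apply a] at h1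
  · rintro ⟨s, σ, hs, hσ⟩
    refine ⟨?_, s, hs⟩
    have hα : ∀ t, s (σ.symm (e.symm t)) ∈ component A M t := fun t => by
      simpa using hσ (σ.symm (e.symm t))
    obtain ⟨f, hf, hfA, hfH⟩ := exists_successors hM hdisj
      (α := fun v => σ.symm (e.symm (Sum.inr v))) fun v => hα (Sum.inr v)
    refine structurallyObservable_of_injective hs hf hfA (fun j a h => (hfH j a h).1) fun v => ?_
    obtain ⟨S, hS⟩ := exists_reach_parentSCC A v
    exact ⟨_, hS _ (hα (Sum.inl S))⟩

/-! ### Reduction to the assignment problem -/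

theorem reducesToLSAP_of_feasible_iff {T : Fin N → Finset (Fin n)} (hT : ∀ j, (T j).Nonempty)
    (c : Matrix (Fin N) (Fin n) ℝ) (hdisj : Pairwise fun i j => Disjoint (T i) (T j))
    (hfeas : ∀ H : Pattern N n, SensingFeasible A H ↔ ∃ (s : Fin N → Fin n)
      (σ : Equiv.Perm (Fin N)), (∀ a l, H a l = true ↔ l = s a) ∧ ∀ a, s a ∈ T (σ a)) :
    ReducesToLSAP A c T hT := by
  classical
  have hle : ∀ i j l, l ∈ T j → reducedCost c T hT i j ≤ c i l := fun i j l hl =>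
    Finset.inf'_le _ hl
  have hpick : ∀ i j, ∃ l ∈ T j, reducedCost c T hT i j = c i l := fun i j =>
    Finset.exists_mem_eq_inf' (hT j) (c i)
  choose pick hpickT hpick using hpick
  have hlower : ∀ (H : Pattern N n) (s : Fin N → Fin n) (σ : Equiv.Perm (Fin N)), (∀ a l, H a l = true ↔ l = s a) →
      (∀ a, s a ∈ T (σ a)) → totalCost (reducedCost c T hT) (ofMap σ) ≤ totalCost c H := by
    intro H s σ hs hσ
    rw [totalCost_eq _ (ofMap_eq_true _), totalCost_eq _ hs]
    exact Finset.sum_le_sum fun i _ => hle i _ _ (hσ i)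
  have hofMap : ∀ σ : Equiv.Perm (Fin N), LSAPFeasible (ofMap σ) := fun σ =>
    (lsapFeasible_iff _).2 ⟨σ, ofMap_eq_true _⟩
  have hreal : ∀ Z H, LSAPFeasible Z → Realizes c T Z H →
      SensingFeasible A H ∧ totalCost c H = totalCost (reducedCost c T hT) Z := by
    intro Z H hZ hR
    obtain ⟨σ, hσ⟩ := (lsapFeasible_iff Z).1 hZ
    have h1 : ∀ i, ∃ l ∈ T (σ i), (∀ l' ∈ T (σ i), c i l ≤ c i l') ∧
        ∀ l', H i l' = true ↔ l' = l := by
      intro i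
      obtain ⟨j, hj, h⟩ := hR i
      rwa [(hσ i j).1 hj] at h
    choose s hs1 hs2 hs3 using h1
    refine ⟨(hfeas H).2 ⟨s, σ, hs3, hs1⟩, ?_⟩
    rw [totalCost_eq _ hs3, totalCost_eq _ hσ]
    refine Finset.sum_congr rfl fun i _ => le_antisymm ?_ (hle i _ _ (hs1 i))
    rw [hpick]
    exact hs2 i _ (hpickT i _)
  have hexreal : ∀ Z, LSAPFeasible Z → ∃ H, Realizes c T Z H := by
    intro Z hZ
    obtain ⟨σ, hσ⟩ := (lsapFeasible_iff Z).1 hZ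
    refine ⟨ofMap fun i => pick i (σ i), fun i => ⟨σ i, (hσ _ _).2 rfl, _, hpickT i _,
      fun l' hl' => ?_, ofMap_eq_true _ i⟩⟩
    rw [← hpick]
    exact hle _ _ _ hl'
  have hiff : ∀ H : Pattern N n, SensingOptimal A c H ↔
      ∃ Z, LSAPOptimal (reducedCost c T hT) Z ∧ Realizes c T Z H := by
    intro H
    constructor
    · rintro ⟨hH, hopt⟩
      obtain ⟨s, σ, hs, hσ⟩ := (hfeas H).1 hH
      have hbound : ∀ Z', LSAPFeasible Z' →
          totalCost c H ≤ totalCost (reducedCost c T hT) Z' := by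
        intro Z' hZ'
        obtain ⟨H', hH'⟩ := hexreal Z' hZ'
        obtain ⟨h1, h2⟩ := hreal Z' H' hZ' hH'
        rw [← h2]
        exact hopt H' h1
      refine ⟨ofMap σ, ⟨hofMap σ, fun Z' hZ' => (hlower H s σ hs hσ).trans (hbound Z' hZ')⟩, ?_⟩
      -- Equal sums of termwise ordered costs agree term by term, so every agent measures a cheapest
      -- state of its component.
      have heq := le_antisymm (hlower H s σ hs hσ) (hbound _ (hofMap σ))
      rw [totalCost_eq _ (ofMap_eq_true _), totalCost_eq _ hs,
        Finset.sum_eq_sum_iff_of_le fun i _ => hle i _ _ (hσ i)] at heq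
      refine fun i => ⟨σ i, (ofMap_eq_true _ _ _).2 rfl, s i, hσ i, fun l' hl' => ?_, hs i⟩
      rw [← heq i (Finset.mem_univ i)]
      exact hle _ _ _ hl'
    · rintro ⟨Z, hZ, hR⟩
      obtain ⟨h1, h2⟩ := hreal Z H hZ.1 hR
      refine ⟨h1, fun H' hH' => ?_⟩
      obtain ⟨s, σ, hs, hσ⟩ := (hfeas H').1 hH'
      rw [h2]
      exact (hZ.2 _ (hofMap σ)).trans (hlower H' s σ hs hσ)
  refine ⟨fun H hH l => ?_, hiff, fun Z hZ => hexreal Z hZ.1, ?_, ?_⟩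
  · obtain ⟨s, σ, hs, hσ⟩ := (hfeas H).1 hH
    have hsinj : Function.Injective s := by
      intro i j hij
      by_contra hne
      refine Finset.disjoint_left.1 (hdisj fun h => hne (σ.injective h)) (hσ i) ?_
      rw [hij]
      exact hσ j
    by_cases hl : ∃ a, s a = l
    · obtain ⟨a, rfl⟩ := hl
      rw [Finset.sum_eq_single a]
      · exact Bool.toNat_le _
      · intro b _ hb
        have : H b (s a) = false := by
          rw [← Bool.not_eq_true, hs]
          exact fun h => hb (hsinj h).symm
        simp [this]
      · simp
    · rw [Finset.sum_eq_zero]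
      · exact Nat.zero_le _
      · intro a _
        have : H a l = false := by
          rw [← Bool.not_eq_true, hs]
          exact fun h => hl ⟨a, h.symm⟩
        simp [this]
  · obtain ⟨σ, -, hσ⟩ := Finset.exists_min_image (Finset.univ : Finset (Equiv.Perm (Fin N)))
      (fun σ => totalCost (reducedCost c T hT) (ofMap σ)) ⟨1, Finset.mem_univ _⟩
    refine ⟨ofMap σ, hofMap σ, fun Z' hZ' => ?_⟩
    obtain ⟨τ, hτ⟩ := (lsapFeasible_iff Z').1 hZ'
    have := hσ τ (Finset.mem_univ _)
    rwa [totalCost_eq _ hτ, ← totalCost_eq _ (ofMap_eq_true τ)]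
  · intro H Z hH hZ
    obtain ⟨Z', hZ', hR⟩ := (hiff H).1 hH
    rw [(hreal Z' H hZ'.1 hR).2]
    exact le_antisymm (hZ'.2 _ hZ.1) (hZ.2 _ hZ'.1)

theorem reducesToLSAP_component (hM : IsMaximumMatching A M) (c : Matrix (Fin N) (Fin n) ℝ)
    (hdisj : Pairwise fun s t => Disjoint (component A M s) (component A M t))
    (e : Fin N ≃ ParentSCC A ⊕ Unmatched M) :
    ReducesToLSAP A c (fun j => component A M (e j)) fun j => component_nonempty A M (e j) :=
  reducesToLSAP_of_feasible_iff _ c (fun _ _ h => hdisj fun h' => h (e.injective h'))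
    (sensingFeasible_iff hM hdisj e)

/-- A matched digraph has a maximum matching without unmatched nodes. -/
theorem IsMatched.exists_matching (h : IsMatched A) : ∃ M, IsMaximumMatching A M ∧
    IsEmpty (Unmatched M) ∧ Pairwise fun s t => Disjoint (component A M s) (component A M t) := by
  obtain ⟨σ, hσ⟩ := h
  have hempty : IsEmpty (Unmatched (Finset.univ.image fun j => (σ j, j))) :=
    ⟨fun v => v.2 (σ v, v) (Finset.mem_image_of_mem (fun j => (σ j, j)) (Finset.mem_univ v.1)) rfl⟩
  refine ⟨Finset.univ.image fun j => (σ j, j), ⟨⟨fun p hp => ?_, fun p hp q hq h => ?_⟩,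
    fun M' hM' => ?_⟩, hempty, ?_⟩
  · obtain ⟨j, -, rfl⟩ := Finset.mem_image.1 hp
    exact hσ j
  · obtain ⟨j, -, rfl⟩ := Finset.mem_image.1 hp
    obtain ⟨l, -, rfl⟩ := Finset.mem_image.1 hq
    have : j = l := h.elim (fun h => σ.injective h) id
    rw [this]
  · rw [Finset.card_image_of_injective _ fun i j h => congrArg Prod.snd h, ← hM'.card_image_snd]
    exact Finset.card_le_univ _
  · rintro (S | v) (T | w) hne
    · exact ParentSCC.disjoint fun h => hne (congrArg Sum.inl h)
    · exact (hempty.false w).elim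
    · exact (hempty.false v).elim
    · exact (hempty.false v).elim

theorem reducesToLSAP_parentSCC (h : IsMatched A) (c : Matrix (Fin N) (Fin n) ℝ)
    (e : Fin N ≃ ParentSCC A) : ReducesToLSAP A c (fun j => (e j).1) fun j => (e j).nonempty := by
  obtain ⟨M, hM, hempty, hdisj⟩ := h.exists_matching
  exact reducesToLSAP_component hM c hdisj (e.trans (Equiv.sumEmpty _ _).symm)

end

/-! ### The sensing problem as an assignment problem with forbidden pairs -/

/-- The least state of a parent SCC. -/
def IsLeader {n : ℕ} (A : Pattern n n) (l : Fin n) : Prop :=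
  ∀ u, Reach A l u → Reach A u l ∧ l ≤ u

theorem ParentSCC.exists_leader {n : ℕ} {A : Pattern n n} (S : ParentSCC A) :
    ∃ l ∈ S.1, IsLeader A l := by
  obtain ⟨l, hl, hmin⟩ := Finset.exists_min_image S.1 id S.nonempty
  refine ⟨l, hl, fun u hu => ?_⟩
  have h1 := (S.reach_iff hl u).2 hu
  exact ⟨(S.reach_iff h1 l).1 hl, hmin u h1⟩

theorem IsLeader.exists_parentSCC {n : ℕ} {A : Pattern n n} {l : Fin n} (h : IsLeader A l) :
    ∃ S : ParentSCC A, l ∈ S.1 := by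
  classical
  refine ⟨⟨Finset.univ.filter fun u => Reach A l u, ⟨l, fun u => ?_⟩, fun u hu w huw => ?_⟩, ?_⟩
  · simp only [Finset.mem_filter, Finset.mem_univ, true_and]
    exact ⟨fun hu => ⟨hu, (h u hu).1⟩, fun hu => hu.1⟩
  · simp only [Finset.mem_filter, Finset.mem_univ, true_and] at hu ⊢
    exact hu.tail huw
  · simp only [Finset.mem_filter, Finset.mem_univ, true_and]
    exact Relation.ReflTransGen.refl

theorem IsLeader.eq {n : ℕ} {A : Pattern n n} {l l' : Fin n} (h : IsLeader A l)
    (h' : IsLeader A l') {S : ParentSCC A} (hl : l ∈ S.1) (hl' : l' ∈ S.1) : l = l' :=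
  le_antisymm (h l' ((S.reach_iff hl l').1 hl')).2 (h' l ((S.reach_iff hl' l).1 hl)).2

/-- The rows and the columns of the assignment problem. The rows are the states of `V⁺`, one slot
for every state, and `N` dummies; the columns are the states of `V⁻`, `n` dummies, and the
agents. -/
abbrev Node (n N : ℕ) := (Fin n ⊕ Fin n) ⊕ Fin N

/-- The allowed pairs. -/
def NodeAllowed {n N : ℕ} (A : Pattern n n) : Node n N → Node n N → Prop
  | .inl (.inl l), .inl (.inl i) => Edge A l i
  | .inl (.inl _), .inl (.inr _) => False
  | .inl (.inl _), .inr _ => True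
  | .inl (.inr _), .inl (.inl _) => False
  | .inl (.inr l), .inl (.inr _) => ¬ IsLeader A l
  | .inl (.inr l), .inr _ => IsLeader A l
  | .inr _, .inl _ => True
  | .inr _, .inr _ => False

/-- The costs. -/
def nodeCost {n N : ℕ} (c : Matrix (Fin N) (Fin n) ℝ) (best : Fin N → Fin n → Fin n) :
    Node n N → Node n N → ℝ
  | .inl (.inl l), .inr a => c a l
  | .inl (.inr l), .inr a => c a (best a l)
  | .inr _, .inr _ => 0
  | _, .inl _ => 0

/-- `best a l` is a state of minimal cost for agent `a` among the states reachable from `l`. -/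
def IsBest {n N : ℕ} (A : Pattern n n) (c : Matrix (Fin N) (Fin n) ℝ)
    (best : Fin N → Fin n → Fin n) : Prop :=
  ∀ a l, Reach A l (best a l) ∧ ∀ u, Reach A l u → c a (best a l) ≤ c a u

section

variable {n N : ℕ} {A : Pattern n n} {c : Matrix (Fin N) (Fin n) ℝ} {best : Fin N → Fin n → Fin n}

/-- Only the agent columns carry a cost, so the sum is taken over columns. -/
theorem sum_nodeCost (τ : Equiv.Perm (Node n N)) :
    ∑ y, nodeCost c best y (τ y) = ∑ a, nodeCost c best (τ.symm (Sum.inr a)) (Sum.inr a) := by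
  rw [← Equiv.sum_comp τ.symm]
  simp only [Equiv.apply_symm_apply]
  rw [Fintype.sum_sum_type, Finset.sum_eq_zero, zero_add]
  intro y _
  rcases τ.symm (Sum.inl y) with (l | l) | a <;> rfl

/-- An assignment yields a feasible measurement structure of the same cost. -/
theorem decode_assignment (hbest : IsBest A c best) {τ : Equiv.Perm (Node n N)}
    (hτ : ∀ y, NodeAllowed A y (τ y)) {s : Fin N → Fin n}
    (hs : ∀ a, (∃ l, τ (.inl (.inl l)) = .inr a ∧ s a = l) ∨
      ∃ l, τ (.inl (.inr l)) = .inr a ∧ s a = best a l) :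
    SensingFeasible A (ofMap s) ∧ totalCost c (ofMap s) = ∑ y, nodeCost c best y (τ y) := by
  refine ⟨⟨?_, (row_sum_eq_one_iff _).2 ⟨s, ofMap_eq_true s⟩⟩, ?_⟩
  · have hf : ∀ l, ∃ z : Fin n ⊕ Fin N, τ (.inl (.inl l)) = Sum.map Sum.inl id z ∧
        ∀ i, z = Sum.inl i → Edge A l i := by
      intro l
      have h1 := hτ (.inl (.inl l))
      rcases h2 : τ (.inl (.inl l)) with (i | i) | a
      · rw [h2] at h1
        refine ⟨.inl i, rfl, fun i' hi' => ?_⟩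
        rw [← Sum.inl_injective hi']
        exact h1
      · rw [h2] at h1
        exact h1.elim
      · exact ⟨.inr a, rfl, fun i hi => by cases hi⟩
    choose f hf hfE using hf
    have hfinj : Function.Injective f := by
      intro i j hij
      have : τ (.inl (.inl i)) = τ (.inl (.inl j)) := by rw [hf, hf, hij]
      exact Sum.inl_injective (Sum.inl_injective (τ.injective this))
    refine structurallyObservable_of_injective (ofMap_eq_true s) hfinj hfE (fun j a h => ?_)
      fun v => ?_
    · have h1 := hf j
      rw [h] at h1
      have h1 : τ (.inl (.inl j)) = .inr a := h1
      rcases hs a with ⟨l, h2, h3⟩ | ⟨l, h2, h3⟩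
      · rw [h3]
        exact Sum.inl_injective (Sum.inl_injective (τ.injective (h2.trans h1.symm)))
      · have := τ.injective (h2.trans h1.symm)
        cases this
    · obtain ⟨S, hS⟩ := exists_reach_parentSCC A v
      obtain ⟨l, hlS, hl⟩ := S.exists_leader
      -- The slot of a leader may only go to an agent, and this agent measures a state reachable
      -- from the leader.
      have h1 := hτ (.inl (.inr l))
      rcases h2 : τ (.inl (.inr l)) with (i | i) | a
      · rw [h2] at h1
        exact h1.elim
      · rw [h2] at h1
        exact (h1 hl).elim
      · refine ⟨a, ?_⟩
        rcases hs a with ⟨l', h3, h4⟩ | ⟨l', h3, h4⟩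
        · have := τ.injective (h3.trans h2.symm)
          cases this
        · have := τ.injective (h3.trans h2.symm)
          cases this
          rw [h4]
          exact (hS l hlS).trans (hbest a l).1
  · rw [totalCost_eq c (ofMap_eq_true s), sum_nodeCost]
    refine Finset.sum_congr rfl fun a _ => ?_
    rcases hs a with ⟨l, h1, h2⟩ | ⟨l, h1, h2⟩
    · rw [← h1, Equiv.symm_apply_apply, h1, h2]
      rfl
    · rw [← h1, Equiv.symm_apply_apply, h1, h2]
      rfl

/-- The dummy rows in `β` fill whatever columns `h` leaves over. -/
theorem exists_perm_of_injective {α β : Type*} [Finite α] [Finite β] {h : α → α ⊕ β}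
    (hh : Function.Injective h) : ∃ τ : Equiv.Perm (α ⊕ β), ∀ x, τ (.inl x) = h x := by
  classical
  cases nonempty_fintype α
  cases nonempty_fintype β
  let e : {y : α ⊕ β // y ∈ Set.range Sum.inl} ≃ {y // y ∈ Set.range h} :=
    (Equiv.ofInjective (Sum.inl : α → α ⊕ β) Sum.inl_injective).symm.trans (Equiv.ofInjective h hh)
  refine ⟨e.extendSubtype, fun x => ?_⟩
  rw [Equiv.extendSubtype_apply_of_mem e _ ⟨x, rfl⟩]
  have h1 : (Equiv.ofInjective (Sum.inl : α → α ⊕ β) Sum.inl_injective).symm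
      ⟨.inl x, ⟨x, rfl⟩⟩ = x := by
    rw [Equiv.symm_apply_eq]
    rfl
  simp only [e, Equiv.trans_apply, h1]
  rfl

/-- A feasible measurement structure yields an assignment of at most the same cost. -/
theorem encode_assignment {M : Finset (Fin n × Fin n)} (hM : IsMaximumMatching A M)
    (hdisj : Pairwise fun s t => Disjoint (component A M s) (component A M t))
    (e : Fin N ≃ ParentSCC A ⊕ Unmatched M) (hbest : IsBest A c best) {H : Pattern N n}
    (hH : SensingFeasible A H) : ∃ τ : Equiv.Perm (Node n N), (∀ y, NodeAllowed A y (τ y)) ∧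
      ∑ y, nodeCost c best y (τ y) ≤ totalCost c H := by
  classical
  obtain ⟨s, σ, hs, hσ⟩ := (sensingFeasible_iff hM hdisj e H).1 hH
  let g : ParentSCC A ⊕ Unmatched M ≃ Fin N := e.symm.trans σ.symm
  have hg : ∀ t, s (g t) ∈ component A M t := fun t => by
    have := hσ (g t)
    simpa [g] using this
  obtain ⟨f, hf, hfA, hfH⟩ := exists_successors hM hdisj (α := fun v => g (.inr v))
    fun v => hg (.inr v)
  -- States not sent to agents have distinct successors, so there are at most `|M|` of them. Hence
  -- at least as many states go to agents as there are unmatched nodes, and every contraction agent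
  -- is used.
  have hused : ∀ v : Unmatched M, ∃ l, f l = .inr (g (.inr v)) := by
    have hψ : ∀ l : {l // ∃ a, f l = .inr a}, ∃ v : Unmatched M, f l = .inr (g (.inr v)) := by
      rintro ⟨l, a, ha⟩
      obtain ⟨-, v, rfl⟩ := hfH l a ha
      exact ⟨v, ha⟩
    choose ψ hψ using hψ
    have hψinj : Function.Injective ψ := fun i j hij =>
      Subtype.ext (hf (by rw [hψ i, hψ j, hij]))
    have hφ : ∀ l, ∃ i, (¬ ∃ a, f l = .inr a) → f l = .inl i := by
      intro l
      rcases h : f l with i | a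
      · exact ⟨i, fun _ => rfl⟩
      · exact ⟨l, fun h' => absurd ⟨a, rfl⟩ h'⟩
    choose φ hφ using hφ
    have h1 := hM.card_le (X := (Finset.univ.filter fun l => ∃ a, f l = .inr a)ᶜ) (g := φ)
      (fun a ha b hb hab => by
        simp only [Finset.coe_compl, Finset.coe_filter, Finset.mem_univ, true_and,
          Set.mem_compl_iff, Set.mem_ofPred_eq] at ha hb
        exact hf ((hφ a ha).trans ((congrArg Sum.inl hab).trans (hφ b hb).symm)))
      (fun l hl => by
        simp only [Finset.mem_compl, Finset.mem_filter, Finset.mem_univ, true_and] at hl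
        exact hfA l _ (hφ l hl))
    have h2 : Fintype.card (Unmatched M) = (M.image Prod.snd)ᶜ.card := by
      refine Fintype.card_of_subtype _ fun v => ?_
      simp only [Finset.mem_compl, Finset.mem_image, not_exists, not_and]
    have h3 : Fintype.card {l // ∃ a, f l = .inr a} =
        (Finset.univ.filter fun l => ∃ a, f l = .inr a).card :=
      Fintype.card_of_subtype _ fun l => by simp
    have h4 : Nat.card (Unmatched M) ≤ Nat.card {l // ∃ a, f l = .inr a} := by
      rw [Nat.card_eq_fintype_card, Nat.card_eq_fintype_card, h2, h3]
      rw [Finset.card_compl] at h1 ⊢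
      rw [hM.1.card_image_snd]
      have := Finset.card_le_univ (Finset.univ.filter fun l => ∃ a, f l = .inr a)
      omega
    intro v
    obtain ⟨l, rfl⟩ := (hψinj.bijective_of_nat_card_le h4).2 v
    exact ⟨l, hψ l⟩
  have hcl : ∀ l, ∃ S : ParentSCC A, IsLeader A l → l ∈ S.1 := by
    intro l
    by_cases hl : IsLeader A l
    · obtain ⟨S, hS⟩ := hl.exists_parentSCC
      exact ⟨S, fun _ => hS⟩
    · obtain ⟨S, -⟩ := exists_reach_parentSCC A l
      exact ⟨S, fun h => absurd h hl⟩
  choose S hS using hcl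
  have hSeq : ∀ l (T : ParentSCC A), IsLeader A l → l ∈ T.1 → S l = T := by
    intro l T hl hT
    by_contra hne
    exact Finset.disjoint_left.1 (ParentSCC.disjoint hne) (hS l hl) hT
  -- States follow `f`, the slot of a leader goes to the agent of its parent SCC, and any other slot
  -- to its own dummy column.
  let h : Fin n ⊕ Fin n → Node n N := Sum.elim (fun l => Sum.map Sum.inl id (f l))
    fun l => if IsLeader A l then .inr (g (.inl (S l))) else .inl (.inr l)
  have hl1 : ∀ l i, f l = .inl i → h (.inl l) = .inl (.inl i) := fun l i hl => by simp [h, hl]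
  have hl2 : ∀ l a, f l = .inr a → h (.inl l) = .inr a := fun l i hl => by simp [h, hl]
  have hl3 : ∀ l, IsLeader A l → h (.inr l) = .inr (g (.inl (S l))) := fun l hl => by simp [h, hl]
  have hl4 : ∀ l, ¬ IsLeader A l → h (.inr l) = .inl (.inr l) := fun l hl => by simp [h, hl]
  have hmix : ∀ l l', h (.inl l) ≠ h (.inr l') := by
    intro l l' heq
    rcases hfl : f l with i | a
    · rw [hl1 l i hfl] at heq
      by_cases hl' : IsLeader A l'
      · rw [hl3 l' hl'] at heq
        cases heq
      · rw [hl4 l' hl'] at heq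
        cases heq
    · rw [hl2 l a hfl] at heq
      by_cases hl' : IsLeader A l'
      · rw [hl3 l' hl'] at heq
        obtain ⟨-, v, hv⟩ := hfH l a hfl
        have := g.injective (hv.trans (Sum.inr_injective heq))
        cases this
      · rw [hl4 l' hl'] at heq
        cases heq
  have hinj : Function.Injective h := by
    rintro (l | l) (l' | l') heq
    · have h1 : Function.Injective (Sum.map Sum.inl id : Fin n ⊕ Fin N → Node n N) :=
        Sum.inl_injective.sumMap Function.injective_id
      rw [hf (h1 heq)]
    · exact absurd heq (hmix l l')
    · exact absurd heq.symm (hmix l' l)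
    · by_cases hl : IsLeader A l <;> by_cases hl' : IsLeader A l'
      · rw [hl3 l hl, hl3 l' hl'] at heq
        have h1 : S l = S l' := Sum.inl_injective (g.injective (Sum.inr_injective heq))
        rw [hl.eq hl' (hS l hl) (h1 ▸ hS l' hl')]
      · rw [hl3 l hl, hl4 l' hl'] at heq
        cases heq
      · rw [hl4 l hl, hl3 l' hl'] at heq
        cases heq
      · rw [hl4 l hl, hl4 l' hl'] at heq
        rw [Sum.inr_injective (Sum.inl_injective heq)]
  obtain ⟨τ, hτ⟩ := exists_perm_of_injective hinj
  have hagent : ∀ a, (∃ l, τ (.inl (.inl l)) = .inr a ∧ s a = l) ∨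
      ∃ l, τ (.inl (.inr l)) = .inr a ∧ Reach A l (s a) := by
    intro a
    obtain ⟨T | v, rfl⟩ := g.surjective a
    · obtain ⟨l, hlT, hl⟩ := T.exists_leader
      refine Or.inr ⟨l, ?_, (T.reach_iff hlT _).1 (hg (.inl T))⟩
      rw [hτ, hl3 l hl, hSeq l T hl hlT]
    · obtain ⟨l, hl⟩ := hused v
      exact Or.inl ⟨l, by rw [hτ, hl2 l _ hl], (hfH l _ hl).1⟩
  refine ⟨τ, ?_, ?_⟩
  · rintro ((l | l) | b)
    · rw [hτ]
      rcases hfl : f l with i | a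
      · rw [hl1 l i hfl]
        exact hfA l i hfl
      · rw [hl2 l a hfl]
        trivial
    · rw [hτ]
      by_cases hl : IsLeader A l
      · rw [hl3 l hl]
        exact hl
      · rw [hl4 l hl]
        exact hl
    -- All agent columns are already taken by states and slots, so dummy rows land in allowed
    -- columns.
    · rcases h1 : τ (.inr b) with x | a
      · trivial
      · rcases hagent a with ⟨l, h2, -⟩ | ⟨l, h2, -⟩
        · cases τ.injective (h1.trans h2.symm)
        · cases τ.injective (h1.trans h2.symm)
  · rw [sum_nodeCost, totalCost_eq c hs]
    refine Finset.sum_le_sum fun a _ => ?_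
    rcases hagent a with ⟨l, h1, h2⟩ | ⟨l, h1, h2⟩
    · rw [← h1, Equiv.symm_apply_apply, h1, h2]
      exact le_rfl
    · rw [← h1, Equiv.symm_apply_apply, h1]
      exact (hbest a l).2 _ h2

end

/-! ### Numbering of the rows and columns -/

/-- The numbering of the rows and of the columns. -/
def nodeEquiv (n N : ℕ) : Node n N ≃ Fin (n + n + N) :=
  (Equiv.sumCongr finSumFinEquiv (Equiv.refl _)).trans finSumFinEquiv

@[simp] theorem nodeEquiv_state {n N : ℕ} (l : Fin n) :
    (nodeEquiv n N (.inl (.inl l)) : ℕ) = l := by simp [nodeEquiv]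

@[simp] theorem nodeEquiv_slot {n N : ℕ} (l : Fin n) :
    (nodeEquiv n N (.inl (.inr l)) : ℕ) = n + l := by simp [nodeEquiv, add_comm]

@[simp] theorem nodeEquiv_agent {n N : ℕ} (a : Fin N) :
    (nodeEquiv n N (.inr a) : ℕ) = n + n + a := by simp [nodeEquiv]

section

variable {α : Type*} {K : ℕ} {W : ℕ → ℕ → Prop}

theorem isPerfect_of_perm (E : α ≃ Fin K) {τ : Equiv.Perm α} (hτ : ∀ y, W (E y) (E (τ y))) :
    ∃ π, IsPerfect K W π ∧ ∀ y, π (E y) = E (τ y) := by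
  refine ⟨fun i => if h : i < K then E (τ (E.symm ⟨i, h⟩)) else 0, ⟨fun i hi => ?_,
    fun i hi j hj hij => ?_, fun i hi => ?_⟩, fun y => by simp⟩
  · simp [hi]
  · simpa [hi, hj, Fin.val_inj] using hij
  · simpa [hi] using hτ (E.symm ⟨i, hi⟩)

theorem IsPerfect.exists_perm [Finite α] (E : α ≃ Fin K) {π : ℕ → ℕ} (h : IsPerfect K W π) :
    ∃ τ : Equiv.Perm α, (∀ y, π (E y) = E (τ y)) ∧ ∀ y, W (E y) (E (τ y)) := by
  let f : α → α := fun y => E.symm ⟨π (E y), h.lt _ (E y).2⟩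
  have hf : Function.Injective f := by
    intro x y hxy
    have := E.symm.injective hxy
    simp only [Fin.mk.injEq] at this
    exact E.injective (Fin.ext (h.inj _ (E x).2 _ (E y).2 this))
  have hfE : ∀ y, (E (f y) : ℕ) = π (E y) := fun y => by simp [f]
  refine ⟨Equiv.ofBijective f (Finite.injective_iff_bijective.1 hf), fun y => (hfE y).symm,
    fun y => ?_⟩
  rw [Equiv.ofBijective_apply, hfE]
  exact h.mem _ (E y).2

theorem sum_range_eq_sum [Fintype α] (E : α ≃ Fin K) {D : ℕ → ℕ → ℝ} {π : ℕ → ℕ} {τ : Equiv.Perm α}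
    (hπ : ∀ y, π (E y) = E (τ y)) :
    ∑ i ∈ Finset.range K, D i (π i) = ∑ y, D (E y) (E (τ y)) := by
  rw [Finset.sum_range, ← Equiv.sum_comp E]
  exact Finset.sum_congr rfl fun y _ => by rw [hπ]

end

/-- The allowed pairs, on numbers: `1` for an allowed pair. -/
def maskVal (n : ℕ) (adj : ℕ → ℕ → ℕ) (ld : ℕ → ℕ) (i j : ℕ) : ℕ :=
  if i < n then (if j < n then adj j i else if j < n + n then 0 else 1)
  else if i < n + n then
    (if j < n then 0 else if j < n + n then (if ld (i - n) = 1 then 0 else 1)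
      else if ld (i - n) = 1 then 1 else 0)
  else if j < n + n then 1 else 0

/-- The costs, on numbers. -/
def costVal (n : ℕ) (c : ℕ → ℕ → ℝ) (best : ℕ → ℕ → ℕ) (i j : ℕ) : ℝ :=
  if j < n + n then 0
  else if i < n then c (j - (n + n)) i
  else if i < n + n then c (j - (n + n)) (best (j - (n + n)) (i - n)) else 0

theorem maskVal_eq_one_iff {n N : ℕ} {A : Pattern n n} {adj : ℕ → ℕ → ℕ} {ld : ℕ → ℕ}
    (hadj : ∀ i j : Fin n, adj i j = (A i j).toNat) (hld : ∀ l : Fin n, ld l = 1 ↔ IsLeader A l)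
    (y z : Node n N) :
    maskVal n adj ld (nodeEquiv n N y) (nodeEquiv n N z) = 1 ↔ NodeAllowed A y z := by
  have h1 : ∀ l : Fin n, (l : ℕ) < n + n := fun l => by omega
  have h2 : ∀ a : ℕ, ¬ n + n + a < n := fun a => by omega
  rcases y with (y | y) | y <;> rcases z with (z | z) | z <;>
    simp [maskVal, NodeAllowed, hadj, hld, Edge, h1, h2]

theorem costVal_eq {n N : ℕ} {c : Matrix (Fin N) (Fin n) ℝ} {best : Fin N → Fin n → Fin n}
    {c' : ℕ → ℕ → ℝ} {best' : ℕ → ℕ → ℕ} (hc : ∀ (a : Fin N) (l : Fin n), c' a l = c a l)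
    (hbest : ∀ (a : Fin N) (l : Fin n), best' a l = best a l) (y z : Node n N) :
    costVal n c' best' (nodeEquiv n N y) (nodeEquiv n N z) = nodeCost c best y z := by
  have h1 : ∀ l : Fin n, (l : ℕ) < n + n := fun l => by omega
  have h2 : ∀ a : ℕ, ¬ n + n + a < n := fun a => by omega
  rcases y with (y | y) | y <;> rcases z with (z | z) | z <;>
    simp [costVal, nodeCost, hc, hbest, h1, h2]

/-! ### Nested loops -/

/-- The rule for two nested loops that treat the pairs `(i, j)` one by one. -/
theorem Total.forLoop₂ {K a b : ℕ} {e f : NExp} {P : Prog} {m : Mem} {Q : Mem → Prop} (B B' : ℕ)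
    (D T : ℕ → ℕ → Mem → Prop) (hB : B ≤ K) (hB' : B' ≤ K) (ha : a ∉ P.natW) (hb : b ∉ P.natW)
    (hab : a ≠ b)
    (he : ∀ m', Frame (Prog.forLoop a e (Prog.forLoop b f P)) m m' → e.eval m' = B)
    (hf : ∀ m', Frame (Prog.forLoop a e (Prog.forLoop b f P)) m m' → f.eval m' = B')
    (hD : ∀ x i j m', D i j m' → D i j (m'.setNat a 0 0 x) ∧ D i j (m'.setNat b 0 0 x))
    (hT : ∀ x i j m', T i j m' → T i j (m'.setNat a 0 0 x) ∧ T i j (m'.setNat b 0 0 x))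
    (h0 : ∀ i < B, ∀ j < B', T i j m)
    (hstep : ∀ i m', i < B → ∀ j < B', Frame (Prog.forLoop a e (Prog.forLoop b f P)) m m' →
      m'.nat a 0 0 = i → m'.nat b 0 0 = j →
      (∀ i' < B, ∀ j' < B', ((i' < i ∨ (i' = i ∧ j' < j)) → D i' j' m') ∧
        (¬ (i' < i ∨ (i' = i ∧ j' < j)) → T i' j' m')) →
      Total K P m' fun m'' => D i j m'' ∧ ∀ i' < B, ∀ j' < B', ¬ (i' = i ∧ j' = j) →
        (D i' j' m' → D i' j' m'') ∧ (T i' j' m' → T i' j' m''))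
    (hpost : ∀ m', Frame (Prog.forLoop a e (Prog.forLoop b f P)) m m' →
      (∀ i < B, ∀ j < B', D i j m') → Q m') :
    Total K (Prog.forLoop a e (Prog.forLoop b f P)) m Q := by
  -- `D` is what treating a pair achieves, `T` what must still hold of a pair before its turn; the
  -- order is lexicographic.
  refine Total.forLoop B (fun i m' => ∀ i' < B, ∀ j' < B', (i' < i → D i' j' m') ∧
    (¬ i' < i → T i' j' m')) hB ?_ he ?_ ?_ ?_ ?_
  · simp [Prog.forLoop, Prog.natW, ha, hab]
  · exact fun i x m' h i' hi' j' hj' => ⟨fun h1 => (hD _ _ _ _ ((h i' hi' j' hj').1 h1)).1,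
      fun h1 => (hT _ _ _ _ ((h i' hi' j' hj').2 h1)).1⟩
  · exact fun i' hi' j' hj' => ⟨fun h => absurd h (Nat.not_lt_zero _), fun _ => h0 i' hi' j' hj'⟩
  · intro i m' hi hfr hai h
    have hfr' : ∀ m'', Frame (Prog.forLoop b f P) m' m'' →
        Frame (Prog.forLoop a e (Prog.forLoop b f P)) m m'' := by
      refine fun m'' h => hfr.trans ⟨fun c hc => h.nat c fun h' => hc ?_,
        fun c hc => h.real c fun h' => hc ?_⟩
      · simp only [Prog.forLoop, Prog.natW, List.mem_append] at h' ⊢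
        tauto
      · simp only [Prog.forLoop, Prog.realW, List.mem_append] at h' ⊢
        tauto
    refine Total.forLoop B' (fun j m' => ∀ i' < B, ∀ j' < B',
      ((i' < i ∨ (i' = i ∧ j' < j)) → D i' j' m') ∧
        (¬ (i' < i ∨ (i' = i ∧ j' < j)) → T i' j' m')) hB' hb (fun m'' h => hf m'' (hfr' m'' h))
      ?_ ?_ ?_ ?_
    · exact fun j x m' h i' hi' j' hj' => ⟨fun h1 => (hD _ _ _ _ ((h i' hi' j' hj').1 h1)).2,
        fun h1 => (hT _ _ _ _ ((h i' hi' j' hj').2 h1)).2⟩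
    · intro i' hi' j' hj'
      obtain ⟨h1, h2⟩ := h i' hi' j' hj'
      exact ⟨fun h3 => h1 (by omega), fun h3 => h2 (by omega)⟩
    · intro j m1 hj hfr1 hbj h1
      have ha1 : m1.nat a 0 0 = i := by
        rw [hfr1.nat a, hai]
        simp [Prog.forLoop, Prog.natW, ha, hab]
      refine (hstep i m1 hi j hj (hfr' m1 hfr1) ha1 hbj h1).mono fun m2 _ h2 i' hi' j' hj' => ?_
      by_cases heq : i' = i ∧ j' = j
      · obtain ⟨rfl, rfl⟩ := heq
        exact ⟨fun _ => h2.1, fun h3 => absurd (Or.inr ⟨rfl, Nat.lt_succ_self _⟩) h3⟩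
      · obtain ⟨h3, h4⟩ := h2.2 i' hi' j' hj' heq
        obtain ⟨h5, h6⟩ := h1 i' hi' j' hj'
        exact ⟨fun h7 => h3 (h5 (by omega)), fun h7 => h4 (h6 (by omega))⟩
    · intro m1 _ h1 i' hi' j' hj'
      obtain ⟨h2, h3⟩ := h1 i' hi' j' hj'
      exact ⟨fun h4 => h2 (by omega), fun h4 => h3 (by omega)⟩
  · intro m' hfr h
    exact hpost m' hfr fun i hi j hj => (h i hi j hj).1 hi

/-! ### Reachability, leaders and best states on the machine -/

/-- Initialize the reachability table: equal or adjacent states. -/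
def reachInit : Prog :=
  .forLoop 20 (.var 22) (.forLoop 21 (.var 22)
    (.branch (.and (.not (.natEq (.load 1 (.var 21) (.var 20)) (.const 1)))
        (.not (.natEq (.var 20) (.var 21))))
      (.setNat 25 (.var 20) (.var 21) (.const 0))
      (.setNat 25 (.var 20) (.var 21) (.const 1))))

/-- Close the reachability table under paths through the state `28`. -/
def warshallRound : Prog :=
  .forLoop 20 (.var 22) (.forLoop 21 (.var 22)
    (.branch (.and (.natEq (.load 25 (.var 20) (.var 28)) (.const 1))
        (.natEq (.load 25 (.var 28) (.var 21)) (.const 1)))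
      (.setNat 25 (.var 20) (.var 21) (.const 1)) .skip))

/-- Warshall's algorithm. -/
def warshall : Prog := .forLoop 28 (.var 22) warshallRound

/-- Mark the leaders. -/
def leaders : Prog :=
  .forLoop 20 (.var 22) (.seq (.setNat 24 (.const 0) (.var 20) (.const 1))
    (.forLoop 21 (.var 22)
      (.branch (.and (.natEq (.load 25 (.var 20) (.var 21)) (.const 1))
          (.not (.and (.natEq (.load 25 (.var 21) (.var 20)) (.const 1))
            (.not (.natLt (.var 21) (.var 20))))))
        (.setNat 24 (.const 0) (.var 20) (.const 0)) .skip)))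

/-- Find a cheapest reachable state, for every agent and every state. -/
def bestStates : Prog :=
  .forLoop 20 (.var 27) (.forLoop 21 (.var 22)
    (.seq (.setNat 26 (.var 20) (.var 21) (.var 21))
      (.forLoop 28 (.var 22)
        (.branch (.and (.natEq (.load 25 (.var 21) (.var 28)) (.const 1))
            (.realLt (.load 0 (.var 20) (.var 28)) (.load 0 (.var 20) (.load 26 (.var 20) (.var 21)))))
          (.setNat 26 (.var 20) (.var 21) (.var 28)) .skip))))

section

variable {K n N : ℕ} {m : Mem}

theorem reachInit_total (hK : n ≤ K) (hn : m.nat 22 0 0 = n) :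
    Total K reachInit m fun m' => ∀ i < n, ∀ j < n,
      (m'.nat 25 i j = 1 ↔ m.nat 1 j i = 1 ∨ i = j) := by
  refine Total.forLoop₂ n n (fun i j m' => (m'.nat 25 i j = 1 ↔ m.nat 1 j i = 1 ∨ i = j))
    (fun _ _ _ => True) hK hK (by decide) (by decide) (by decide) (fun m' hf => ?_)
    (fun m' hf => ?_) ?_ ?_ (by simp) ?_ (fun m' hf h => h)
  · simp [hf.nat 22 (by decide), hn]
  · simp [hf.nat 22 (by decide), hn]
  · intro x i j m' h
    simpa using h
  · simp
  · intro i m' hi j hj hf h20 h21 _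
    have e1 := hf.nat 1 (by decide)
    refine Total.branch (fun hb => Total.setNat ?_) (fun hb => Total.setNat ?_)
    · simp [h20, h21, e1] at hb
      refine ⟨by simp [h20, h21, hb], fun i' hi' j' hj' hne => ⟨fun h => ?_, id⟩⟩
      simpa [h20, h21, hne] using h
    · refine ⟨?_, fun i' hi' j' hj' hne => ⟨fun h => ?_, id⟩⟩
      · simp [h20, h21, e1] at hb
        simp [h20, h21]
        tauto
      · simpa [h20, h21, hne] using h

/-- Updating in place is harmless, because the round does not change which entries of row `k` and
column `k` are set. -/
theorem warshallRound_total (hK : n ≤ K) (hn : m.nat 22 0 0 = n) {k : ℕ} (hk : k < n)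
    (h28 : m.nat 28 0 0 = k) :
    Total K warshallRound m fun m' => ∀ i < n, ∀ j < n,
      (m'.nat 25 i j = 1 ↔ m.nat 25 i j = 1 ∨ (m.nat 25 i k = 1 ∧ m.nat 25 k j = 1)) := by
  refine Total.forLoop₂ n n (fun i j m' => (m'.nat 25 i j = 1 ↔
      m.nat 25 i j = 1 ∨ (m.nat 25 i k = 1 ∧ m.nat 25 k j = 1)))
    (fun i j m' => (m'.nat 25 i j = 1 ↔ m.nat 25 i j = 1)) hK hK (by decide) (by decide) (by decide)
    (fun m' hf => ?_) (fun m' hf => ?_) ?_ ?_ (by simp) ?_ (fun m' hf h => h)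
  · simp [hf.nat 22 (by decide), hn]
  · simp [hf.nat 22 (by decide), hn]
  · intro x i j m' h
    simpa using h
  · intro x i j m' h
    simpa using h
  · intro i m' hi j hj hf h20 h21 h
    have e28 : m'.nat 28 0 0 = k := by rw [hf.nat 28 (by decide), h28]
    have h1 : m'.nat 25 i k = 1 ↔ m.nat 25 i k = 1 := by
      have := h i hi k hk
      tauto
    have h2 : m'.nat 25 k j = 1 ↔ m.nat 25 k j = 1 := by
      have := h k hk j hj
      tauto
    have h3 : m'.nat 25 i j = 1 ↔ m.nat 25 i j = 1 := by
      refine (h i hi j hj).2 ?_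
      omega
    refine Total.branch (fun hb => Total.setNat ?_) (fun hb => Total.skip ?_)
    · simp [h20, h21, e28, h1, h2] at hb
      refine ⟨by simp [h20, h21, hb], fun i' hi' j' hj' hne => ?_⟩
      simp [h20, h21, hne]
    · simp only [BExp.Holds, NExp.eval, h20, h21, e28, h1, h2] at hb
      refine ⟨by tauto, fun i' hi' j' hj' hne => ⟨id, id⟩⟩

/-- A transitive relation `G` bounds the table from above, while after `t` rounds the table is
closed under composition through states below `t`. -/
theorem warshall_total (hK : n ≤ K) (hn : m.nat 22 0 0 = n) {G : ℕ → ℕ → Prop}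
    (hG : ∀ i < n, ∀ j < n, m.nat 25 i j = 1 → G i j)
    (hGt : ∀ i < n, ∀ j < n, ∀ k < n, G i k → G k j → G i j) :
    Total K warshall m fun m' => (∀ i < n, ∀ j < n, m'.nat 25 i j = 1 → G i j) ∧
      (∀ i < n, ∀ j < n, m.nat 25 i j = 1 → m'.nat 25 i j = 1) ∧
      ∀ i < n, ∀ j < n, ∀ k < n, m'.nat 25 i k = 1 → m'.nat 25 k j = 1 → m'.nat 25 i j = 1 := by
  refine Total.forLoop n (fun t m' => (∀ i < n, ∀ j < n, m'.nat 25 i j = 1 → G i j) ∧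
      (∀ i < n, ∀ j < n, m.nat 25 i j = 1 → m'.nat 25 i j = 1) ∧
      ∀ i < n, ∀ j < n, ∀ k < t, m'.nat 25 i k = 1 → m'.nat 25 k j = 1 → m'.nat 25 i j = 1)
    hK (by decide) (fun m' hf => ?_) ?_ ?_ ?_ (fun m' hf h => h)
  · simp [hf.nat 22 (by decide), hn]
  · intro i x m' h
    simpa using h
  · exact ⟨hG, fun _ _ _ _ h => h, fun _ _ _ _ k hk => absurd hk (Nat.not_lt_zero _)⟩
  · rintro t m' ht hf h28 ⟨h1, h2, h3⟩
    refine (warshallRound_total hK (by rw [hf.nat 22 (by decide), hn]) ht h28).mono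
      fun m'' _ h => ⟨fun i hi j hj hij => ?_, fun i hi j hj hij => ?_,
        fun i hi j hj k hk hik hkj => ?_⟩
    · rcases (h i hi j hj).1 hij with h' | h'
      · exact h1 i hi j hj h'
      · exact hGt i hi j hj t ht (h1 i hi t ht h'.1) (h1 t ht j hj h'.2)
    · exact (h i hi j hj).2 (Or.inl (h2 i hi j hj hij))
    · have hkn : k < n := by omega
      rw [h i hi k hkn] at hik
      rw [h k hkn j hj] at hkj
      rw [h i hi j hj]
      rcases Nat.lt_succ_iff_lt_or_eq.1 hk with hk' | rfl
      · have a1 := h3 i hi j hj k hk'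
        have a2 := h3 i hi t ht k hk'
        have a3 := h3 t ht j hj k hk'
        tauto
      · tauto

theorem leaders_total (hK : n ≤ K) (hn : m.nat 22 0 0 = n) :
    Total K leaders m fun m' => ∀ i < n, (m'.nat 24 0 i = 1 ↔
      ∀ j < n, m.nat 25 i j = 1 → m.nat 25 j i = 1 ∧ i ≤ j) := by
  refine Total.forLoop n (fun t m' => ∀ i < t, (m'.nat 24 0 i = 1 ↔
      ∀ j < n, m.nat 25 i j = 1 → m.nat 25 j i = 1 ∧ i ≤ j))
    hK (by decide) (fun m' hf => ?_) ?_ (by simp) ?_ (fun m' hf h => h)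
  · simp [hf.nat 22 (by decide), hn]
  · intro i x m' h
    simpa using h
  · intro t m' ht hf h20 h
    refine Total.seq (Total.setNat ?_)
    refine Total.forLoop n (fun t' m' => (∀ i < t, (m'.nat 24 0 i = 1 ↔
        ∀ j < n, m.nat 25 i j = 1 → m.nat 25 j i = 1 ∧ i ≤ j)) ∧
      (m'.nat 24 0 t = 1 ↔ ∀ j < t', m.nat 25 t j = 1 → m.nat 25 j t = 1 ∧ t ≤ j))
      hK (by decide) (fun m1 hf1 => ?_) ?_ ?_ ?_ ?_
    · simp [hf1.nat 22 (by decide), hf.nat 22 (by decide), hn]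
    · intro i x m' h
      simpa using h
    · refine ⟨fun i hi => ?_, by simp [h20]⟩
      simpa [h20, hi.ne] using h i hi
    · rintro t' m1 ht' hf1 h21 ⟨h1, h2⟩
      have e20 : m1.nat 20 0 0 = t := by
        rw [hf1.nat 20 (by decide)]
        simp [h20]
      have e25 : m1.nat 25 = m.nat 25 := by
        rw [hf1.nat 25 (by decide), ← hf.nat 25 (by decide)]
        funext i j
        simp
      refine Total.branch (fun hb => Total.setNat ?_) (fun hb => Total.skip ?_)
      · simp only [BExp.Holds, NExp.eval, e20, h21, e25] at hb
        refine ⟨fun i hi => ?_, ?_⟩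
        · simpa [e20, hi.ne] using h1 i hi
        · simp only [NExp.eval, e20, Mem.setNat_nat, and_self, if_true, Nat.zero_ne_one, false_iff]
          intro h3
          have := h3 t' (Nat.lt_succ_self _) hb.1
          exact hb.2 ⟨this.1, by omega⟩
      · simp only [BExp.Holds, NExp.eval, e20, h21, e25] at hb
        refine ⟨h1, h2.trans ⟨fun h3 j hj => ?_, fun h3 j hj => h3 j (by omega)⟩⟩
        rcases Nat.lt_succ_iff_lt_or_eq.1 hj with hj' | rfl
        · exact h3 j hj'
        · intro h4
          by_contra h5
          exact hb ⟨h4, fun h6 => h5 ⟨h6.1, by omega⟩⟩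
    · intro m1 hf1 h1 i hi
      rcases Nat.lt_succ_iff_lt_or_eq.1 hi with hi' | rfl
      · exact h1.1 i hi'
      · exact h1.2

theorem bestStates_total (hnK : n ≤ K) (hNK : N ≤ K) (hn : m.nat 22 0 0 = n)
    (hN : m.nat 27 0 0 = N) (hrefl : ∀ l < n, m.nat 25 l l = 1) :
    Total K bestStates m fun m' => ∀ a < N, ∀ l < n, m'.nat 26 a l < n ∧
      m.nat 25 l (m'.nat 26 a l) = 1 ∧
      ∀ u < n, m.nat 25 l u = 1 → m.real 0 a (m'.nat 26 a l) ≤ m.real 0 a u := by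
  refine Total.forLoop₂ N n (fun a l m' => m'.nat 26 a l < n ∧
      m.nat 25 l (m'.nat 26 a l) = 1 ∧
      ∀ u < n, m.nat 25 l u = 1 → m.real 0 a (m'.nat 26 a l) ≤ m.real 0 a u)
    (fun _ _ _ => True) hNK hnK (by decide) (by decide) (by decide) (fun m' hf => ?_)
    (fun m' hf => ?_) ?_ ?_ (by simp) ?_ (fun m' hf h => h)
  · simp [hf.nat 27 (by decide), hN]
  · simp [hf.nat 22 (by decide), hn]
  · intro x i j m' h
    simpa using h
  · simp
  · intro a m' ha l hl hf h20 h21 _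
    refine Total.seq (Total.setNat ?_)
    refine Total.forLoop n (fun t m1 => (m1.nat 26 a l < n ∧ m.nat 25 l (m1.nat 26 a l) = 1 ∧
        ∀ u < t, m.nat 25 l u = 1 → m.real 0 a (m1.nat 26 a l) ≤ m.real 0 a u) ∧
      ∀ i j, ¬ (i = a ∧ j = l) → m1.nat 26 i j = m'.nat 26 i j)
      hnK (by decide) (fun m1 hf1 => ?_) ?_ ?_ ?_ ?_
    · simp [hf1.nat 22 (by decide), hf.nat 22 (by decide), hn]
    · intro i x m' h
      simpa using h
    -- The state itself is the initial candidate, which is why the table must be reflexive.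
    · refine ⟨by simp [h20, h21, hl, hrefl], fun i j hij => ?_⟩
      simp [h20, h21, hij]
    · rintro t m1 ht hf1 h28 ⟨⟨h1, h2, h3⟩, h4⟩
      have e20 : m1.nat 20 0 0 = a := by
        rw [hf1.nat 20 (by decide)]
        simp [h20]
      have e21 : m1.nat 21 0 0 = l := by
        rw [hf1.nat 21 (by decide)]
        simp [h21]
      have e25 : m1.nat 25 = m.nat 25 := by
        rw [hf1.nat 25 (by decide), ← hf.nat 25 (by decide)]
        funext i j
        simp
      have e0 : m1.real 0 = m.real 0 := by
        rw [hf1.real 0 (by decide), ← hf.real 0 (by decide)]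
        simp
      refine Total.branch (fun hb => Total.setNat ?_) (fun hb => Total.skip ?_)
      · simp only [BExp.Holds, NExp.eval, RExp.eval, e20, e21, e25, e0, h28] at hb
        refine ⟨?_, fun i j hij => ?_⟩
        · simp only [NExp.eval, e20, e21, h28, Mem.setNat_nat, and_self, if_true]
          refine ⟨ht, hb.1, fun u hu hlu => ?_⟩
          rcases Nat.lt_succ_iff_lt_or_eq.1 hu with hu' | rfl
          · exact hb.2.le.trans (h3 u hu' hlu)
          · exact le_rfl
        · simpa [e20, e21, hij] using h4 i j hij
      · simp only [BExp.Holds, NExp.eval, RExp.eval, e20, e21, e25, e0, h28] at hb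
        refine ⟨⟨h1, h2, fun u hu hlu => ?_⟩, h4⟩
        rcases Nat.lt_succ_iff_lt_or_eq.1 hu with hu' | rfl
        · exact h3 u hu' hlu
        · exact not_lt.1 fun h5 => hb ⟨hlu, h5⟩
    · intro m1 hf1 h1
      refine ⟨h1.1, fun i hi j hj hij => ⟨fun h => ?_, id⟩⟩
      rw [h1.2 i j hij]
      exact h

end

/-! ### The table of the assignment problem on the machine -/

/-- Mark the allowed pairs. -/
def maskCell : Prog :=
  .branch (.natLt (.var 20) (.var 22))
    (.branch (.natLt (.var 21) (.var 22))
      (.setNat 3 (.var 20) (.var 21) (.load 1 (.var 21) (.var 20)))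
      (.branch (.natLt (.var 21) (.var 23)) (.setNat 3 (.var 20) (.var 21) (.const 0))
        (.setNat 3 (.var 20) (.var 21) (.const 1))))
    (.branch (.natLt (.var 20) (.var 23))
      (.branch (.natLt (.var 21) (.var 22)) (.setNat 3 (.var 20) (.var 21) (.const 0))
        (.branch (.natLt (.var 21) (.var 23))
          (.branch (.natEq (.arr 24 (.sub (.var 20) (.var 22))) (.const 1))
            (.setNat 3 (.var 20) (.var 21) (.const 0)) (.setNat 3 (.var 20) (.var 21) (.const 1)))
          (.branch (.natEq (.arr 24 (.sub (.var 20) (.var 22))) (.const 1))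
            (.setNat 3 (.var 20) (.var 21) (.const 1)) (.setNat 3 (.var 20) (.var 21) (.const 0)))))
      (.branch (.natLt (.var 21) (.var 23)) (.setNat 3 (.var 20) (.var 21) (.const 1))
        (.setNat 3 (.var 20) (.var 21) (.const 0))))

/-- Write a cost. -/
def costCell : Prog :=
  .branch (.natLt (.var 21) (.var 23)) (.setReal 1 (.var 20) (.var 21) .zero)
    (.branch (.natLt (.var 20) (.var 22))
      (.setReal 1 (.var 20) (.var 21) (.load 0 (.sub (.var 21) (.var 23)) (.var 20)))
      (.branch (.natLt (.var 20) (.var 23))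
        (.setReal 1 (.var 20) (.var 21) (.load 0 (.sub (.var 21) (.var 23))
          (.load 26 (.sub (.var 21) (.var 23)) (.sub (.var 20) (.var 22)))))
        (.setReal 1 (.var 20) (.var 21) .zero)))

/-- Fill in the table of the assignment problem. -/
def fillTable : Prog :=
  .forLoop 20 (.var 16) (.forLoop 21 (.var 16) (.seq maskCell costCell))

/-- Read the measured states off the assignment. -/
def readStates : Prog :=
  .forLoop 20 (.var 27) (.seq
    (.assign 29 (.sub (.arr 4 (.add (.var 23) (.var 20))) (.const 1)))
    (.branch (.natLt (.var 29) (.var 22)) (.setNat 2 (.var 20) (.var 29) (.const 1))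
      (.setNat 2 (.var 20) (.load 26 (.var 20) (.sub (.var 29) (.var 22))) (.const 1))))

section

variable {K n N : ℕ} {m : Mem}

theorem maskCell_total (hn : m.nat 22 0 0 = n) (hnn : m.nat 23 0 0 = n + n) :
    Total K maskCell m fun m' => m' = m.setNat 3 (m.nat 20 0 0) (m.nat 21 0 0)
      (maskVal n (m.nat 1) (m.nat 24 0) (m.nat 20 0 0) (m.nat 21 0 0)) := by
  unfold maskCell
  repeat' first
    | refine Total.branch (fun hb => ?_) (fun hb => ?_)
    | refine Total.setNat ?_
  all_goals
    simp only [BExp.Holds, NExp.eval, hn, hnn] at *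
    simp [maskVal, *]

theorem costCell_total (hn : m.nat 22 0 0 = n) (hnn : m.nat 23 0 0 = n + n) :
    Total K costCell m fun m' => m' = m.setReal 1 (m.nat 20 0 0) (m.nat 21 0 0)
      (costVal n (m.real 0) (m.nat 26) (m.nat 20 0 0) (m.nat 21 0 0)) := by
  unfold costCell
  repeat' first
    | refine Total.branch (fun hb => ?_) (fun hb => ?_)
    | refine Total.setReal ?_
  all_goals
    simp only [BExp.Holds, NExp.eval, RExp.eval, hn, hnn] at *
    simp [costVal, *]

theorem fillTable_total {B : ℕ} (hB : B ≤ K) (hn : m.nat 22 0 0 = n) (hnn : m.nat 23 0 0 = n + n)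
    (h16 : m.nat 16 0 0 = B) :
    Total K fillTable m fun m' => ∀ i < B, ∀ j < B,
      m'.nat 3 i j = maskVal n (m.nat 1) (m.nat 24 0) i j ∧
        m'.real 1 i j = costVal n (m.real 0) (m.nat 26) i j := by
  refine Total.forLoop₂ B B (fun i j m' => m'.nat 3 i j = maskVal n (m.nat 1) (m.nat 24 0) i j ∧
        m'.real 1 i j = costVal n (m.real 0) (m.nat 26) i j)
    (fun _ _ _ => True) hB hB (by decide) (by decide) (by decide) (fun m' hf => ?_)
    (fun m' hf => ?_) ?_ ?_ (by simp) ?_ (fun m' hf h => h)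
  · simp [hf.nat 16 (by decide), h16]
  · simp [hf.nat 16 (by decide), h16]
  · intro x i j m' h
    simpa using h
  · simp
  · intro i m' hi j hj hf h20 h21 _
    have e22 : m'.nat 22 0 0 = n := by rw [hf.nat 22 (by decide), hn]
    have e23 : m'.nat 23 0 0 = n + n := by rw [hf.nat 23 (by decide), hnn]
    have e1 := hf.nat 1 (by decide)
    have e24 := hf.nat 24 (by decide)
    have e26 := hf.nat 26 (by decide)
    have e0 := hf.real 0 (by decide)
    refine Total.seq ((maskCell_total e22 e23).mono ?_)
    rintro _ - rfl
    refine (costCell_total (n := n) (by simp [e22]) (by simp [e23])).mono ?_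
    rintro _ - rfl
    have e26' : ∀ x, (m'.setNat 3 i j x).nat 26 = m.nat 26 := by
      intro x
      funext i' j'
      simp [e26]
    refine ⟨by simp [h20, h21, e1, e24, e26', e0], fun i' hi' j' hj' hne => ⟨fun h => ?_, id⟩⟩
    simpa [h20, h21, hne] using h

/-- Array `4` stores rows shifted by one. A row below `n` is the measured state itself; otherwise
`n` is subtracted and the best state is looked up. -/
theorem readStates_total (hN : m.nat 27 0 0 = N) (hNK : N ≤ K) (hn : m.nat 22 0 0 = n)
    (hnn : m.nat 23 0 0 = n + n) (h2 : ∀ a < N, ∀ l < n, m.nat 2 a l = 0) {s : ℕ → ℕ}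
    (hs : ∀ a < N, s a = if m.nat 4 0 (n + n + a) - 1 < n then m.nat 4 0 (n + n + a) - 1
      else m.nat 26 a (m.nat 4 0 (n + n + a) - 1 - n)) :
    Total K readStates m fun m' =>
      ∀ a < N, ∀ l < n, m'.nat 2 a l = if l = s a then 1 else 0 := by
  refine Total.forLoop N
    (fun t m' => ∀ a < N, ∀ l < n, m'.nat 2 a l = if a < t ∧ l = s a then 1 else 0)
    hNK (by decide) (fun m' hf => ?_) ?_ (by simpa using h2) ?_ ?_
  · simp [hf.nat 27 (by decide), hN]
  · intro i x m' h
    simpa using h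
  · intro t m' ht hf hk h
    have e22 : m'.nat 22 0 0 = n := by rw [hf.nat 22 (by decide), hn]
    have e23 : m'.nat 23 0 0 = n + n := by rw [hf.nat 23 (by decide), hnn]
    have e4 := hf.nat 4 (by decide)
    have e26 := hf.nat 26 (by decide)
    have key : ∀ m1 : Mem, m1.nat 2 = (m'.setNat 2 t (s t) 1).nat 2 →
        ∀ a < N, ∀ l < n, m1.nat 2 a l = if a < t + 1 ∧ l = s a then 1 else 0 := by
      intro m1 h1 a ha l hl
      rw [h1]
      simp only [Mem.setNat_nat, true_and]
      by_cases hat : a = t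
      · subst hat
        by_cases h3 : l = s a
        · simp [h3]
        · simp [h3, h a ha l hl]
      · have : a < t + 1 ↔ a < t := by omega
        simp [hat, this, h a ha l hl]
    have hst := hs t ht
    refine Total.seq (Total.setNat (Total.branch (fun hb => Total.setNat (key _ ?_))
      (fun hb => Total.setNat (key _ ?_))))
    · simp [hk, e22, e23, e4] at hb
      rw [if_pos hb] at hst
      funext a l
      simp [hk, e23, e4, hst]
    · simp [hk, e22, e23, e4] at hb
      rw [if_neg (not_lt.2 hb)] at hst
      funext a l
      simp [hk, e22, e23, e4, e26, hst]
  · intro m' hf h a ha l hl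
    simpa [ha] using h a ha l hl

end

/-! ### The sensing problem on the machine -/

/-- Compute the sizes. -/
def sensingSizes : Prog :=
  .seq (.assign 22 (.var 0)) (.seq (.assign 27 (.arr 0 (.const 1)))
    (.seq (.assign 23 (.add (.var 22) (.var 22))) (.assign 16 (.add (.var 23) (.var 27)))))

/-- Set up the assignment problem. -/
def sensingTable : Prog :=
  .seq sensingSizes (.seq reachInit (.seq warshall (.seq leaders (.seq bestStates fillTable))))

/-- The program for the sensing problem. -/
def sensingProg : Prog := .seq sensingTable (.seq Hungarian.main readStates)

/-- The memory holds the sizes and the table of the assignment problem. -/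
structure IsSensingTable {n N : ℕ} (A : Pattern n n) (c : Matrix (Fin N) (Fin n) ℝ)
    (best : Fin N → Fin n → Fin n) (m : Mem) : Prop where
  rows : m.nat 22 0 0 = n
  rows_two : m.nat 23 0 0 = n + n
  agents : m.nat 27 0 0 = N
  size : m.nat 16 0 0 = n + n + N
  best_eq : ∀ (a : Fin N) (l : Fin n), m.nat 26 a l = best a l
  isBest : IsBest A c best
  mask : ∀ y z : Node n N,
    m.nat 3 (nodeEquiv n N y) (nodeEquiv n N z) = 1 ↔ NodeAllowed A y z
  cost : ∀ y z : Node n N,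
    m.real 1 (nodeEquiv n N y) (nodeEquiv n N z) = nodeCost c best y z

theorem sensingTable_total {n N : ℕ} (A : Pattern n n) (c : Matrix (Fin N) (Fin n) ℝ) :
    Total (n + n + N) sensingTable (sensingInput A c) fun m =>
      ∃ best, IsSensingTable A c best m := by
  have hnK : n ≤ n + n + N := by omega
  have hNK : N ≤ n + n + N := by omega
  have hsizes : Total (n + n + N) sensingSizes (sensingInput A c) fun m =>
      m.nat 22 0 0 = n ∧ m.nat 27 0 0 = N ∧ m.nat 23 0 0 = n + n ∧ m.nat 16 0 0 = n + n + N := by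
    refine Total.seq (Total.setNat (Total.seq (Total.setNat (Total.seq (Total.setNat
      (Total.setNat ?_))))))
    simp [sensingInput]
  refine Total.seq (hsizes.mono ?_)
  rintro m1 hf1 ⟨h22, h27, h23, h16⟩
  have hA : ∀ i j : Fin n, m1.nat 1 i j = (A i j).toNat := by
    intro i j
    rw [hf1.nat 1 (by decide)]
    simp [sensingInput]
  have hc : ∀ (a : Fin N) (l : Fin n), m1.real 0 a l = c a l := by
    intro a l
    rw [hf1.real 0 (by decide)]
    simp [sensingInput]
  refine Total.seq ((reachInit_total hnK h22).mono fun m2 hf2 h2 => ?_)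
  have e22 : m2.nat 22 0 0 = n := by rw [hf2.nat 22 (by decide), h22]
  have hbase : ∀ i j : Fin n, m2.nat 25 i j = 1 ↔ Edge A i j ∨ i = j := by
    intro i j
    rw [h2 i i.2 j j.2, hA, Fin.val_inj]
    simp [Edge]
  refine Total.seq ((warshall_total hnK e22
    (G := fun i j => ∀ (hi : i < n) (hj : j < n), Reach A ⟨i, hi⟩ ⟨j, hj⟩) ?_ ?_).mono ?_)
  · intro i hi j hj hij _ _
    rcases (hbase ⟨i, hi⟩ ⟨j, hj⟩).1 hij with h | h
    · exact Relation.ReflTransGen.single h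
    · rw [h]
      exact Relation.ReflTransGen.refl
  · exact fun i hi j hj k hk h h' _ _ => (h hi hk).trans (h' hk hj)
  rintro m3 hf3 ⟨h3, h3', h3''⟩
  have e22 : m3.nat 22 0 0 = n := by rw [hf3.nat 22 (by decide), e22]
  have hreach : ∀ i j : Fin n, m3.nat 25 i j = 1 ↔ Reach A i j := by
    refine fun i j => ⟨fun h => h3 i i.2 j j.2 h i.2 j.2, fun h => ?_⟩
    induction h with
    | refl => exact h3' i i.2 i i.2 ((hbase i i).2 (Or.inr rfl))
    | @tail k j _ hkj ih =>
      exact h3'' i i.2 j j.2 k k.2 ih (h3' k k.2 j j.2 ((hbase k j).2 (Or.inl hkj)))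
  refine Total.seq ((leaders_total hnK e22).mono fun m4 hf4 h4 => ?_)
  have hlead : ∀ l : Fin n, m4.nat 24 0 l = 1 ↔ IsLeader A l := by
    intro l
    rw [h4 l l.2]
    refine ⟨fun h u hlu => ?_, fun h u hu hlu => ?_⟩
    · have := h u u.2 ((hreach l u).2 hlu)
      exact ⟨(hreach u l).1 this.1, this.2⟩
    · have := h ⟨u, hu⟩ ((hreach l ⟨u, hu⟩).1 hlu)
      exact ⟨(hreach ⟨u, hu⟩ l).2 this.1, this.2⟩
  have e22 : m4.nat 22 0 0 = n := by rw [hf4.nat 22 (by decide), e22]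
  have e27 : m4.nat 27 0 0 = N := by
    rw [hf4.nat 27 (by decide), hf3.nat 27 (by decide), hf2.nat 27 (by decide), h27]
  have e25 := hf4.nat 25 (by decide)
  have ec : m4.real 0 = m1.real 0 := by
    rw [hf4.real 0 (by decide), hf3.real 0 (by decide), hf2.real 0 (by decide)]
  refine Total.seq ((bestStates_total hnK hNK e22 e27 fun l hl => ?_).mono fun m5 hf5 h5 => ?_)
  · rw [e25]
    exact (hreach ⟨l, hl⟩ ⟨l, hl⟩).2 Relation.ReflTransGen.refl
  let best : Fin N → Fin n → Fin n := fun a l => ⟨m5.nat 26 a l, (h5 a a.2 l l.2).1⟩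
  have hbest : IsBest A c best := by
    intro a l
    obtain ⟨h6, h7, h8⟩ := h5 a a.2 l l.2
    rw [e25] at h7
    refine ⟨(hreach l (best a l)).1 h7, fun u hu => ?_⟩
    have := h8 u u.2 (by rw [e25]; exact (hreach l u).2 hu)
    rw [ec, hc a u] at this
    rw [← hc]
    exact this
  have e22 : m5.nat 22 0 0 = n := by rw [hf5.nat 22 (by decide), e22]
  have e23 : m5.nat 23 0 0 = n + n := by
    rw [hf5.nat 23 (by decide), hf4.nat 23 (by decide), hf3.nat 23 (by decide),
      hf2.nat 23 (by decide), h23]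
  have e16 : m5.nat 16 0 0 = n + n + N := by
    rw [hf5.nat 16 (by decide), hf4.nat 16 (by decide), hf3.nat 16 (by decide),
      hf2.nat 16 (by decide), h16]
  have e27 : m5.nat 27 0 0 = N := by rw [hf5.nat 27 (by decide), e27]
  have eA : m5.nat 1 = m1.nat 1 := by
    rw [hf5.nat 1 (by decide), hf4.nat 1 (by decide), hf3.nat 1 (by decide), hf2.nat 1 (by decide)]
  refine (fillTable_total le_rfl e22 e23 e16).mono fun m6 hf6 h6 => ⟨best, ?_⟩
  refine ⟨by rw [hf6.nat 22 (by decide), e22], by rw [hf6.nat 23 (by decide), e23],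
    by rw [hf6.nat 27 (by decide), e27], by rw [hf6.nat 16 (by decide), e16],
    fun a l => by rw [hf6.nat 26 (by decide)], hbest, fun y z => ?_, fun y z => ?_⟩
  · rw [(h6 _ (nodeEquiv n N y).2 _ (nodeEquiv n N z).2).1]
    exact maskVal_eq_one_iff (fun i j => by rw [eA, hA])
      (fun l => by rw [hf5.nat 24 (by decide), hlead]) y z
  · rw [(h6 _ (nodeEquiv n N y).2 _ (nodeEquiv n N z).2).2]
    exact costVal_eq (fun a l => by rw [hf5.real 0 (by decide), ec, hc]) (fun a l => rfl) y z

theorem sensingProg_total {n N : ℕ} {A : Pattern n n} (c : Matrix (Fin N) (Fin n) ℝ)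
    {M : Finset (Fin n × Fin n)} (hM : IsMaximumMatching A M)
    (hdisj : Pairwise fun s t => Disjoint (component A M s) (component A M t))
    (e : Fin N ≃ ParentSCC A ⊕ Unmatched M) :
    Total (n + n + N) sensingProg (sensingInput A c) fun m =>
      ∃ H : Pattern N n, Outputs m H ∧ SensingOptimal A c H := by
  -- A feasible structure is needed so that its encoding provides an allowed perfect matching for
  -- the Hungarian method.
  obtain ⟨H₀, hH₀⟩ : ∃ H, SensingFeasible A (H : Pattern N n) := by
    have hred := reducesToLSAP_component hM c hdisj e
    obtain ⟨Z, hZ⟩ := hred.exists_optimal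
    obtain ⟨H, hH⟩ := hred.realizable Z hZ
    exact ⟨H, ((hred.optimal_iff H).2 ⟨Z, hZ, hH⟩).1⟩
  refine Total.seq ((sensingTable_total A c).mono ?_)
  rintro m1 hf1 ⟨best, h1⟩
  have hperfect : ∀ H, SensingFeasible A (H : Pattern N n) → ∃ π,
      IsPerfect (n + n + N) (Hungarian.allowed m1) π ∧
        ∑ i ∈ Finset.range (n + n + N), m1.real 1 i (π i) ≤ totalCost c H := by
    intro H hH
    obtain ⟨τ, hτ, hle⟩ := encode_assignment hM hdisj e h1.isBest hH
    obtain ⟨π, hπ, hπτ⟩ := isPerfect_of_perm (nodeEquiv n N) (W := Hungarian.allowed m1) (τ := τ)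
      fun y => (h1.mask y (τ y)).2 (hτ y)
    refine ⟨π, hπ, ?_⟩
    rw [sum_range_eq_sum (nodeEquiv n N) hπτ]
    simpa only [h1.cost] using hle
  obtain ⟨π₀, hπ₀, -⟩ := hperfect H₀ hH₀
  refine Total.seq ((Hungarian.main_total le_rfl h1.size ?_ hπ₀).mono ?_)
  · intro j _
    rw [hf1.nat 4 (by decide)]
    simp [sensingInput]
  rintro m2 hf2 ⟨hq, hp, hopt⟩
  obtain ⟨τ, hπτ, hτ⟩ := hq.exists_perm (nodeEquiv n N)
  have hτ' : ∀ y, NodeAllowed A y (τ y) := fun y => (h1.mask y (τ y)).1 (hτ y)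
  have hcol : ∀ y, m2.nat 4 0 (nodeEquiv n N (τ y)) - 1 = nodeEquiv n N y := by
    intro y
    rw [← hπτ, hp _ (nodeEquiv n N y).2, Nat.add_sub_cancel]
  have hex : ∀ a : Fin N, ∃ s : Fin n, ((∃ l, τ (.inl (.inl l)) = .inr a ∧ s = l) ∨
      ∃ l, τ (.inl (.inr l)) = .inr a ∧ s = best a l) ∧
      (s : ℕ) = if m2.nat 4 0 (n + n + a) - 1 < n then m2.nat 4 0 (n + n + a) - 1
        else m2.nat 26 a (m2.nat 4 0 (n + n + a) - 1 - n) := by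
    intro a
    obtain ⟨y, hy⟩ := τ.surjective (Sum.inr a)
    have h2 := hcol y
    have h3 := hτ' y
    rw [hy] at h2 h3
    rw [nodeEquiv_agent] at h2
    rw [h2]
    rcases y with (l | l) | b
    · exact ⟨l, Or.inl ⟨l, hy, rfl⟩, by simp⟩
    · refine ⟨best a l, Or.inr ⟨l, hy, rfl⟩, ?_⟩
      simp [hf2.nat 26 (by decide), h1.best_eq]
    · exact h3.elim
  choose s hs hs' using hex
  obtain ⟨hfeas, hcost⟩ := decode_assignment h1.isBest hτ' hs
  refine (readStates_total (s := fun a => if h : a < N then s ⟨a, h⟩ else 0)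
    (by rw [hf2.nat 27 (by decide), h1.agents])
    (by omega) (by rw [hf2.nat 22 (by decide), h1.rows]) (by rw [hf2.nat 23 (by decide), h1.rows_two])
    ?_ ?_).mono fun m3 hf3 h3 => ?_
  · intro a _ l _
    rw [hf2.nat 2 (by decide), hf1.nat 2 (by decide)]
    simp [sensingInput]
  · intro a ha
    simpa [ha] using hs' ⟨a, ha⟩
  refine ⟨ofMap s, fun a l => ?_, hfeas, fun H hH => ?_⟩
  · rw [h3 a a.2 l l.2]
    simp only [Fin.is_lt, dif_pos, Fin.eta, Fin.val_inj, ofMap]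
    by_cases h : l = s a <;> simp [h]
  · obtain ⟨π, hπ, hle⟩ := hperfect H hH
    -- Decoded cost equals assignment cost, which is at most the cost of the encoding of `H`, hence
    -- at most that of `H`.
    refine le_trans ?_ ((hopt π hπ).trans hle)
    rw [hcost, sum_range_eq_sum (nodeEquiv n N) hπτ]
    simp only [h1.cost, le_refl]

theorem exists_sensing_program : ∃ (P : Prog) (p : Polynomial ℕ), ∀ (n N : ℕ) (A : Pattern n n)
    (c : Matrix (Fin N) (Fin n) ℝ),
    ((IsMatched A ∧ N = Nat.card (ParentSCC A)) ∨
      ∃ M, IsMaximumMatching A M ∧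
        Pairwise (fun s t => Disjoint (component A M s) (component A M t)) ∧
        N = Nat.card (ParentSCC A ⊕ Unmatched M)) →
    ∃ (m : Mem) (t : ℕ) (H : Pattern N n),
      Exec P (sensingInput A c) m t ∧ t ≤ p.eval (n + N) ∧ Outputs m H ∧
        SensingOptimal A c H := by
  obtain ⟨C, hC⟩ := sensingProg.exists_bound_le
  -- All loops make at most `n + n + N` rounds, and this is at most `2 * (n + N)`.
  refine ⟨sensingProg, Polynomial.C C * (2 * Polynomial.X + 1) ^ sensingProg.depth,
    fun n N A c h => ?_⟩
  obtain ⟨M, hM, hdisj, hN⟩ : ∃ M, IsMaximumMatching A M ∧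
      Pairwise (fun s t => Disjoint (component A M s) (component A M t)) ∧
      N = Nat.card (ParentSCC A ⊕ Unmatched M) := by
    rcases h with ⟨h, hN⟩ | h
    · obtain ⟨M, hM, hempty, hdisj⟩ := h.exists_matching
      exact ⟨M, hM, hdisj, hN.trans (Nat.card_congr (Equiv.sumEmpty _ _).symm)⟩
    · exact h
  obtain ⟨m, t, he, ht, H, hH, hopt⟩ :=
    sensingProg_total c hM hdisj (Finite.equivFinOfCardEq hN.symm).symm
  refine ⟨m, t, H, he, (ht.trans (hC _)).trans ?_, hH, hopt⟩
  simp only [Polynomial.eval_mul, Polynomial.eval_C, Polynomial.eval_pow, Polynomial.eval_add,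
    Polynomial.eval_ofNat, Polynomial.eval_X, Polynomial.eval_one]
  gcongr
  omega

end SensingCost

end

open SensingCost in
theorem mainTheorem3 :
    -- matched social digraphs: the agents are assigned to the parent SCCs
    (∀ (n N : ℕ) (A : Pattern n n) (c : Matrix (Fin N) (Fin n) ℝ), IsMatched A →
      ∀ e : Fin N ≃ ParentSCC A,
        ReducesToLSAP A c (fun j => (e j).1) (fun j => (e j).nonempty)) ∧
    -- disjoint contractions and parent SCCs: the agents are assigned to both
    (∀ (n N : ℕ) (A : Pattern n n) (c : Matrix (Fin N) (Fin n) ℝ)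
      (M : Finset (Fin n × Fin n)), IsMaximumMatching A M →
      Pairwise (fun s t => Disjoint (component A M s) (component A M t)) →
      ∀ e : Fin N ≃ ParentSCC A ⊕ Unmatched M,
        ReducesToLSAP A c (fun j => component A M (e j))
          (fun j => component_nonempty A M (e j))) ∧
    -- the assignment problem is solved in `O(N ^ 3)` steps
    (∃ (P : Prog) (C : ℕ), ∀ (N : ℕ) (d : Matrix (Fin N) (Fin N) ℝ),
      ∃ (m : Mem) (t : ℕ) (Z : Pattern N N),
        Exec P (lsapInput d) m t ∧ t ≤ C * (N + 1) ^ 3 ∧ Outputs m Z ∧ LSAPOptimal d Z) ∧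
    -- the sensing problem is solved in polynomial time in both cases
    (∃ (P : Prog) (p : Polynomial ℕ), ∀ (n N : ℕ) (A : Pattern n n)
      (c : Matrix (Fin N) (Fin n) ℝ),
      ((IsMatched A ∧ N = Nat.card (ParentSCC A)) ∨
        ∃ M, IsMaximumMatching A M ∧
          Pairwise (fun s t => Disjoint (component A M s) (component A M t)) ∧
          N = Nat.card (ParentSCC A ⊕ Unmatched M)) →
      ∃ (m : Mem) (t : ℕ) (H : Pattern N n),
        Exec P (sensingInput A c) m t ∧ t ≤ p.eval (n + N) ∧ Outputs m H ∧
          SensingOptimal A c H) :=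
  ⟨fun _ _ _ c h e => reducesToLSAP_parentSCC h c e,
    fun _ _ _ c _ hM hd e => reducesToLSAP_component hM c hd e,
    exists_lsap_program, exists_sensing_program⟩
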